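/- Let $G$ be a Lie group with Haar measure $dx$ that is stratified, that is, connected, simply connected, and with a Lie algebra $\mathfrak g = V_1 \oplus \dots \oplus V_k$ such that $[V_1,V_i]=V_{i+1}$ for $1\le i<k$ and $[V_1,V_k]=0$. A homogeneous sublaplacian on $G$ is an operator $L = -\sum_l X_l^2$, where $\{X_l\}_l$ is a basis of the first layer $V_1$, regarded as a family of left-invariant vector fields. The closure of $L$ from $C^\infty_c(G)$ is a self-adjoint operator on $L^2(G)$, and for Borel $F : \mathbb R \to \mathbb C$ the operator $F(L)$ is defined by the spectral theorem; $\mathcal K_{F(L)}$ denotes its convolution kernel, that is, $F(L)\phi = \phi * \mathcal K_{F(L)}$ for all $\phi \in C^\infty_c(G)$, where $(\phi * k)(x) = \int_G \phi(y)\, k(y^{-1}x)\,dy$. Moreover $W_2^s(\mathbb R)$ is the $L^2$ Sobolev space of fractional order $s$. For $t>0$ we say that an operator $L$ on $G$ for which these notions make sense satisfies Assumption $(B_t)$ if for all $s>t$ there exists a measurable weight $w_s : G \to [1,\infty)$ such that $w_s^{-1} \in L^2(G)$ and, for every compact set $K \subseteq \mathbb R$, there is a constant $C_{K,s}$ such that,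 for all Borel functions $F : \mathbb R \to \mathbb C$ in $W_2^s(\mathbb R)$ with $\operatorname{supp} F \subseteq K$, the operator $F(L)$ has a locally integrable convolution kernel and \[ \| w_s\, \mathcal K_{F(L)} \|_{L^2(G)} \le C_{K,s}\, \|F\|_{W_2^s(\mathbb R)} . \] Proposition. Let $n \ge 1$ and, for $j=1,\dots,n$, let $L_j$ be a homogeneous sublaplacian on a stratified Lie group $G_j$ satisfying Assumption $(B_{t_j})$ for some $t_j>0$. Let $G = G_1 \times \dots \times G_n$ and $L = L_1^\sharp + \dots + L_n^\sharp$, where $L_j^\sharp$ is the pushforward to $G$ of $L_j$ along the inclusion $i_j : G_j \to G$, that is, the left-invariant operator $(L_j^\sharp f)(x) = \bigl(L_j (y \mapsto f(x\, i_j(y)))\bigr)(1)$. Then the sublaplacian $L$ on $G$ satisfies Assumption $(B_t)$, where $t = t_1+\dots+t_n$. -/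

import Mathlib

open MeasureTheory
open scoped Manifold ContDiff ENNReal NNReal FourierTransform

noncomputable section

/-! ### Stratified Lie groups and homogeneous sublaplacians -/

/-- A stratification `𝔤 = V₁ ⊕ V₂ ⊕ ⋯` of the Lie algebra of `G`, with `[V₁, Vᵢ] = Vᵢ₊₁` for all `i`;
`layer i` is `Vᵢ₊₁`. When `𝔤` is finite-dimensional only finitely many layers are nonzero, so that
`𝔤` is nilpotent. -/
structure Stratification {E H : Type*} [NormedAddCommGroup E] [NormedSpace ℝ E]
    [TopologicalSpace H] (I : ModelWithCorners ℝ E H)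
    (G : Type*) [TopologicalSpace G] [ChartedSpace H G] [Group G] where
  layer : ℕ → Submodule ℝ (GroupLieAlgebra I G)
  isInternal : DirectSum.IsInternal layer
  bracket_layer : ∀ i, layer (i + 1) =
    Submodule.span ℝ {z | ∃ x ∈ layer 0, ∃ y ∈ layer i, ⁅x, y⁆ = z}

/-- The derivative of `f : G → ℂ` along the left-invariant vector field with value `v` at `1`. -/
def leftInvariantDeriv {E H : Type*} [NormedAddCommGroup E] [NormedSpace ℝ E]
    [TopologicalSpace H] (I : ModelWithCorners ℝ E H)
    {G : Type*} [TopologicalSpace G] [ChartedSpace H G] [Group G]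
    (v : GroupLieAlgebra I G) (f : G → ℂ) : G → ℂ :=
  fun x => (mfderiv I 𝓘(ℝ, ℂ) f x (mulInvariantVectorField v x) : ℂ)

/-- The operator `-∑ₗ Xₗ²`, for a finite family of left-invariant vector fields `Xₗ`. -/
def sumOfSquares {E H : Type*} [NormedAddCommGroup E] [NormedSpace ℝ E]
    [TopologicalSpace H] (I : ModelWithCorners ℝ E H)
    {G : Type*} [TopologicalSpace G] [ChartedSpace H G] [Group G]
    {κ : Type*} [Fintype κ] (X : κ → GroupLieAlgebra I G) (f : G → ℂ) : G → ℂ :=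
  fun x => -∑ l, leftInvariantDeriv I (X l) (leftInvariantDeriv I (X l) f) x

/-- A homogeneous sublaplacian on a stratified group: `L = -∑ₗ Xₗ²` for some basis `(Xₗ)` of the
first layer of the stratification. -/
def IsHomogeneousSublaplacian {E H : Type*} [NormedAddCommGroup E] [NormedSpace ℝ E]
    [TopologicalSpace H] {I : ModelWithCorners ℝ E H}
    {G : Type*} [TopologicalSpace G] [ChartedSpace H G] [Group G]
    (S : Stratification I G) (L : (G → ℂ) → (G → ℂ)) : Prop :=
  ∃ (m : ℕ) (X : Module.Basis (Fin m) ℝ (S.layer 0)),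
    L = sumOfSquares I (fun l => (X l : GroupLieAlgebra I G))

/-- The pushforward `D^♯` of a left-invariant operator `D` on `G'` along a homomorphism
`i : G' → G`: the left-invariant operator on `G` with `(D^♯ f)(x) = D (y ↦ f (x * i y)) (1)`. For a
left-invariant vector field this is the left-invariant vector field with value `di(X)` at `1`, and
pushforward is compatible with sums and products of left-invariant differential operators. -/
def pushforwardOperator {G' G : Type*} [Group G'] [Group G] (i : G' →* G)
    (D : (G' → ℂ) → (G' → ℂ)) (f : G → ℂ) : G → ℂ :=
  fun x => D (fun y => f (x * i y)) 1

/-! ### The functional calculus of a self-adjoint operator -/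

/-- A spectral representation (the multiplication operator form of the spectral theorem) of the
operator on the Hilbert space `𝓗` whose graph is `T`: a unitary map `U` from `𝓗` onto the space
`L²` of a σ-finite measure, and a measurable real function `symbol`, such that `U T U⁻¹` is the
operator of multiplication by `symbol`, with its maximal domain. In particular the operator is
self-adjoint. -/
structure SpectralRepresentation {𝓗 : Type*} [NormedAddCommGroup 𝓗] [InnerProductSpace ℂ 𝓗]
    (T : Set (𝓗 × 𝓗)) where
  carrier : Type
  [measurableSpace : MeasurableSpace carrier]
  ν : Measure carrier
  [sigmaFinite : SigmaFinite ν]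
  U : 𝓗 ≃ₗᵢ[ℂ] Lp ℂ 2 ν
  symbol : carrier → ℝ
  measurable_symbol : Measurable symbol
  mem_iff : ∀ u v : 𝓗, (u, v) ∈ T ↔ U v =ᵐ[ν] fun ξ => (symbol ξ : ℂ) * U u ξ

/-- `R.Maps F u v` says that `u` belongs to the domain of `F(T)` and that `F(T) u = v`, where
`F(T) = U⁻¹ (F ∘ symbol) U` is given by the Borel functional calculus. -/
def SpectralRepresentation.Maps {𝓗 : Type*} [NormedAddCommGroup 𝓗] [InnerProductSpace ℂ 𝓗]
    {T : Set (𝓗 × 𝓗)} (R : SpectralRepresentation T) (F : ℝ → ℂ) (u v : 𝓗) : Prop :=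
  letI := R.measurableSpace
  R.U v =ᵐ[R.ν] fun ξ => F (R.symbol ξ) * R.U u ξ

/-- The space `C_c^∞(G)` of complex-valued test functions. -/
def IsTestFunction {E H : Type*} [NormedAddCommGroup E] [NormedSpace ℝ E]
    [TopologicalSpace H] (I : ModelWithCorners ℝ E H)
    {G : Type*} [TopologicalSpace G] [ChartedSpace H G] (φ : G → ℂ) : Prop :=
  ContMDiff I 𝓘(ℝ, ℂ) ∞ φ ∧ HasCompactSupport φ

/-- The graph of the closure in `L²(G)` of the operator `L` with domain `C_c^∞(G)`. -/
def closureGraph {E H : Type*} [NormedAddCommGroup E] [NormedSpace ℝ E]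
    [TopologicalSpace H] (I : ModelWithCorners ℝ E H)
    {G : Type*} [TopologicalSpace G] [ChartedSpace H G] [MeasurableSpace G]
    (μ : Measure G) (L : (G → ℂ) → (G → ℂ)) : Set (Lp ℂ 2 μ × Lp ℂ 2 μ) :=
  closure {p | ∃ φ : G → ℂ, IsTestFunction I φ ∧ p.1 =ᵐ[μ] φ ∧ p.2 =ᵐ[μ] L φ}

/-- The convolution kernel of `F(L)`: a locally integrable function `k` on `G` such that
`F(L) φ = φ * k` for all `φ ∈ C_c^∞(G)`, where `(φ * k)(x) = ∫ φ(y) k(y⁻¹ x) dy`. -/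
def IsConvolutionKernel {E H : Type*} [NormedAddCommGroup E] [NormedSpace ℝ E]
    [TopologicalSpace H] (I : ModelWithCorners ℝ E H)
    {G : Type*} [TopologicalSpace G] [ChartedSpace H G] [Group G] [MeasurableSpace G]
    (μ : Measure G) {L : (G → ℂ) → (G → ℂ)}
    (R : SpectralRepresentation (closureGraph I μ L)) (F : ℝ → ℂ) (k : G → ℂ) : Prop :=
  LocallyIntegrable k μ ∧
  ∀ φ : G → ℂ, IsTestFunction I φ →
    ∃ u v : Lp ℂ 2 μ, u =ᵐ[μ] φ ∧ (v =ᵐ[μ] fun x => ∫ y, φ y * k (y⁻¹ * x) ∂μ) ∧ R.Maps F u v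

/-! ### The Sobolev norm and the weighted kernel estimate -/

open Classical in
/-- The norm of the `L²` Sobolev space `W₂ˢ(ℝ)` of order `s ≥ 0`: the `L²` norm of
`(1 + ξ²)^(s/2) (𝓕 F)(ξ)`, where `𝓕` is the Fourier transform of `L²(ℝ)`; it is infinite when `F` does
not belong to `W₂ˢ(ℝ)`. -/
def sobolevNorm (s : ℝ) (F : ℝ → ℂ) : ℝ≥0∞ :=
  if h : MemLp F 2 volume then
    eLpNorm (fun ξ : ℝ => (((1 + ξ ^ 2) ^ (s / 2) : ℝ) : ℂ) *
      (𝓕 (h.toLp F) : Lp ℂ 2 (volume : Measure ℝ)) ξ) 2 volume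
  else ⊤

/-- Assumption `(B_t)` for the operator `L` on `G`, with Haar measure `μ`: the closure of `L` has a
functional calculus and, for all `s > t`, there is a weight `w : G → [1, ∞)` with `w⁻¹ ∈ L²(G)` such
that, for all compact sets `K`, there is a constant `C` such that
`‖w 𝒦_{F(L)}‖_{L²(G)} ≤ C ‖F‖_{W₂ˢ(ℝ)}` for all Borel functions `F ∈ W₂ˢ(ℝ)` supported in `K`. -/
def AssumptionB {E H : Type*} [NormedAddCommGroup E] [NormedSpace ℝ E]
    [TopologicalSpace H] (I : ModelWithCorners ℝ E H)
    {G : Type*} [TopologicalSpace G] [ChartedSpace H G] [Group G] [MeasurableSpace G]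
    (μ : Measure G) (L : (G → ℂ) → (G → ℂ)) (t : ℝ) : Prop :=
  ∃ R : SpectralRepresentation (closureGraph I μ L),
    ∀ s : ℝ, t < s →
      ∃ w : G → ℝ, Measurable w ∧ (∀ x, 1 ≤ w x) ∧ MemLp (fun x => (w x)⁻¹) 2 μ ∧
        ∀ K : Set ℝ, IsCompact K →
          ∃ C : ℝ≥0, ∀ F : ℝ → ℂ, Measurable F → tsupport F ⊆ K → sobolevNorm s F < ⊤ →
            ∃ k : G → ℂ, IsConvolutionKernel I μ R F k ∧
              eLpNorm (fun x => (w x : ℂ) * k x) 2 μ ≤ C * sobolevNorm s F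

end

set_option linter.unusedSectionVars false
set_option linter.style.longLine false
set_option linter.style.haveILetI false
set_option linter.overlappingInstances false

noncomputable section

/-! ### Tensor products of square-integrable functions -/

section Tensor

variable {ι : Type*} [Fintype ι] {X : ι → Type*} [∀ i, MeasurableSpace (X i)]
  {μ : ∀ i, Measure (X i)} [∀ i, SigmaFinite (μ i)]

/-! Let `U j` diagonalize the closure of `L j` as multiplication by `σ j`. The tensor product `V` of
the `U j` then diagonalizes the closure of `L` with symbol `∑ j, σ j (ξ j)`, so that `F(L)` becomes
multiplication by `F (∑ j, σ j (ξ j))`.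

The kernel estimate separates variables by a Fourier series. Let `F` be supported in `[-r, r]`, and
let `χ` be a cutoff equal to 1 there. Every `σ j` is nonnegative almost everywhere, because
sublaplacians are positive. Hence `|∑ j, σ j| ≤ r` forces each `σ j ≤ r`, and `F (∑ σ j) = F (∑ σ j)
* ∏ χ (σ j)`. Expanding `F` on a long enough period `P` as `∑ c n * e n`, where `e n (x) = exp
(2πinx/P)` turns sums into products, the kernel of `F(L)` becomes `∑ c n * ⨂ j, k j n`, with `k j n`
the kernel of `(e n * χ)(L j)`.

By Assumption `(B)` on `G j`, applied to finite sums `∑ b n * e n * χ`, the functions `w j * k j n`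
divided by `bracket (s j) (n / P)` form a Bessel sequence in `L²(G j)` (`exists_bessel_kernels`).
The Gram matrix of a diagonal family of tensors is the Hadamard product of the Gram matrices, so by
the Schur product theorem the tensors are again a Bessel sequence (`norm_sq_sum_tensorLp_le`). The
brackets multiply to `bracket (∑ s j) (n / P)`, hence the squared weighted norm of the kernel is at
most a constant times `∑ |c n|² * bracket (∑ s j) (n / P) ^ 2`, which `tsum_fourier_coeff_le` bounds
by the squared Sobolev norm of `F` of order `∑ s j`. The weight on `G` is the product of the `w j`.

Two further points need care. The spectral representation of the product requires the closure of `L`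
on test functions to be the whole multiplication operator (`mem_closure_iff_ae_eq`). The Fourier
series converges only Lebesgue-almost everywhere, which suffices because the kernel estimate makes
the spectral measure of each factor absolutely continuous (`measure_symbol_preimage_eq_zero`). -/

theorem ae_pi_of_forall_ae {p : ∀ i, X i → Prop} (h : ∀ i, ∀ᵐ x ∂μ i, p i x) :
    ∀ᵐ x ∂Measure.pi μ, ∀ i, p i (x i) :=
  Filter.eventually_all.2 fun i => Measure.tendsto_eval_ae_ae.eventually (h i)

theorem aestronglyMeasurable_tensor {f : ∀ i, X i → ℂ}
    (hf : ∀ i, AEStronglyMeasurable (f i) (μ i)) :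
    AEStronglyMeasurable (fun x : ∀ i, X i => ∏ i, f i (x i)) (Measure.pi μ) := by
  refine Finset.aestronglyMeasurable_fun_prod _ fun i _ => ?_
  exact (hf i).comp_quasiMeasurePreserving (Measure.quasiMeasurePreserving_eval μ i)

theorem MeasureTheory.MemLp.tensor {f : ∀ i, X i → ℂ} (hf : ∀ i, MemLp (f i) 2 (μ i)) :
    MemLp (fun x : ∀ i, X i => ∏ i, f i (x i)) 2 (Measure.pi μ) := by
  rw [memLp_two_iff_integrable_sq_norm (aestronglyMeasurable_tensor fun i => (hf i).1)]
  have := Integrable.fintype_prod_dep (𝕜 := ℝ) (μ := μ) (f := fun i x => ‖f i x‖ ^ 2)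
    fun i => (memLp_two_iff_integrable_sq_norm (hf i).1).1 (hf i)
  simpa [norm_prod, Finset.prod_pow] using this

theorem tensor_congr {f g : ∀ i, X i → ℂ} (h : ∀ i, f i =ᵐ[μ i] g i) :
    (fun x : ∀ i, X i => ∏ i, f i (x i)) =ᵐ[Measure.pi μ] fun x => ∏ i, g i (x i) := by
  filter_upwards [ae_pi_of_forall_ae h] with x hx
  exact Finset.prod_congr rfl fun i _ => hx i

theorem inner_toLp_tensor (f g : ∀ i, Lp ℂ 2 (μ i)) :
    inner ℂ ((MemLp.tensor fun i => Lp.memLp (f i)).toLp _)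
      ((MemLp.tensor fun i => Lp.memLp (g i)).toLp _) = ∏ i, inner ℂ (f i) (g i) := by
  simp_rw [L2.inner_def]
  rw [← integral_fintype_prod_eq_prod]
  refine integral_congr_ae ?_
  filter_upwards [(MemLp.tensor fun i => Lp.memLp (f i)).coeFn_toLp,
    (MemLp.tensor fun i => Lp.memLp (g i)).coeFn_toLp] with x h1 h2
  rw [h1, h2]
  simp [Finset.prod_mul_distrib]

theorem norm_toLp_tensor (f : ∀ i, Lp ℂ 2 (μ i)) :
    ‖(MemLp.tensor fun i => Lp.memLp (f i)).toLp _‖ = ∏ i, ‖f i‖ := by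
  have h := inner_toLp_tensor f f
  simp_rw [inner_self_eq_norm_sq_to_K] at h
  rw [Finset.prod_pow] at h
  have h' : ‖(MemLp.tensor fun i => Lp.memLp (f i)).toLp _‖ ^ 2 = (∏ i, ‖f i‖) ^ 2 := by
    exact_mod_cast h
  exact (sq_eq_sq₀ (norm_nonneg _) (Finset.prod_nonneg fun _ _ => norm_nonneg _)).1 h'

variable (μ) in
/-- The tensor product of square-integrable functions, as a continuous multilinear map. -/
def tensorLp : ContinuousMultilinearMap ℂ (fun i => Lp ℂ 2 (μ i)) (Lp ℂ 2 (Measure.pi μ)) :=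
  MultilinearMap.mkContinuous
    { toFun := fun f => (MemLp.tensor fun i => Lp.memLp (f i)).toLp _
      map_update_add' := by
        intro _ f i u v
        apply Lp.ext
        have hu (w : Lp ℂ 2 (μ i)) (j : ι) :
            ((Function.update f i w j : Lp ℂ 2 (μ j)) : X j → ℂ) =
            Function.update (fun j => (f j : X j → ℂ)) i w j := by
          by_cases hj : j = i
          · subst hj; simp
          · simp [hj]
        filter_upwards [MemLp.coeFn_toLp (MemLp.tensor fun j => Lp.memLp (Function.update f i (u + v) j)),
          MemLp.coeFn_toLp (MemLp.tensor fun j => Lp.memLp (Function.update f i u j)),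
          MemLp.coeFn_toLp (MemLp.tensor fun j => Lp.memLp (Function.update f i v j)),
          Lp.coeFn_add ((MemLp.tensor fun j => Lp.memLp (Function.update f i u j)).toLp _)
            ((MemLp.tensor fun j => Lp.memLp (Function.update f i v j)).toLp _),
          Measure.tendsto_eval_ae_ae.eventually (Lp.coeFn_add u v)] with x h1 h2 h3 h4 h5
        rw [h4, Pi.add_apply, h1, h2, h3]
        rw [← Finset.mul_prod_erase _ _ (Finset.mem_univ i), ← Finset.mul_prod_erase _ _ (Finset.mem_univ i),
          ← Finset.mul_prod_erase _ _ (Finset.mem_univ i)]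
        have hc (w : Lp ℂ 2 (μ i)) : ∏ j ∈ Finset.univ.erase i, (Function.update f i w j : Lp ℂ 2 (μ j)) (x j)
            = ∏ j ∈ Finset.univ.erase i, f j (x j) :=
          Finset.prod_congr rfl fun j hj => by rw [hu, Function.update_of_ne (Finset.ne_of_mem_erase hj)]
        rw [hc, hc, hc]
        simp only [Function.update_self]
        rw [← add_mul]
        congr 1
      map_update_smul' := by
        intro _ f i c u
        apply Lp.ext
        have hu (w : Lp ℂ 2 (μ i)) (j : ι) :
            ((Function.update f i w j : Lp ℂ 2 (μ j)) : X j → ℂ) =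
            Function.update (fun j => (f j : X j → ℂ)) i w j := by
          by_cases hj : j = i
          · subst hj; simp
          · simp [hj]
        filter_upwards [MemLp.coeFn_toLp (MemLp.tensor fun j => Lp.memLp (Function.update f i (c • u) j)),
          MemLp.coeFn_toLp (MemLp.tensor fun j => Lp.memLp (Function.update f i u j)),
          Lp.coeFn_smul c ((MemLp.tensor fun j => Lp.memLp (Function.update f i u j)).toLp _),
          Measure.tendsto_eval_ae_ae.eventually (Lp.coeFn_smul c u)] with x h1 h2 h4 h5
        rw [h4, Pi.smul_apply, h1, h2]
        rw [← Finset.mul_prod_erase _ _ (Finset.mem_univ i), ← Finset.mul_prod_erase _ _ (Finset.mem_univ i)]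
        have hc (w : Lp ℂ 2 (μ i)) : ∏ j ∈ Finset.univ.erase i, (Function.update f i w j : Lp ℂ 2 (μ j)) (x j)
            = ∏ j ∈ Finset.univ.erase i, f j (x j) :=
          Finset.prod_congr rfl fun j hj => by rw [hu, Function.update_of_ne (Finset.ne_of_mem_erase hj)]
        rw [hc, hc]
        simp only [Function.update_self, smul_eq_mul]
        rw [← mul_assoc]
        congr 1 }
    1 fun f => by rw [one_mul]; exact (norm_toLp_tensor f).le

theorem tensorLp_ae_eq (f : ∀ i, Lp ℂ 2 (μ i)) :
    tensorLp μ f =ᵐ[Measure.pi μ] fun x => ∏ i, f i (x i) :=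
  MemLp.coeFn_toLp (MemLp.tensor fun i => Lp.memLp (f i))

theorem tensorLp_ae_eq_of_ae_eq {f : ∀ i, Lp ℂ 2 (μ i)} {g : ∀ i, X i → ℂ}
    (h : ∀ i, f i =ᵐ[μ i] g i) :
    tensorLp μ f =ᵐ[Measure.pi μ] fun x => ∏ i, g i (x i) :=
  (tensorLp_ae_eq f).trans (tensor_congr h)

theorem inner_tensorLp (f g : ∀ i, Lp ℂ 2 (μ i)) :
    inner ℂ (tensorLp μ f) (tensorLp μ g) = ∏ i, inner ℂ (f i) (g i) :=
  inner_toLp_tensor f g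

/-- A function whose integrals over all small measurable rectangles vanish is zero. -/
theorem ae_eq_zero_of_forall_setIntegral_rectangle {f : (∀ i, X i) → ℂ} (A : ℕ → ∀ i, Set (X i))
    (hA : ∀ k i, MeasurableSet (A k i)) (hAu : ∀ x : ∀ i, X i, ∃ k, ∀ i, x i ∈ A k i)
    (hf : ∀ k, IntegrableOn f (Set.univ.pi (A k)) (Measure.pi μ))
    (h0 : ∀ k, ∀ s : ∀ i, Set (X i), (∀ i, MeasurableSet (s i)) → (∀ i, s i ⊆ A k i) →
      ∫ x in Set.univ.pi s, f x ∂Measure.pi μ = 0) :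
    f =ᵐ[Measure.pi μ] 0 := by
  have hk : ∀ k, ∀ᵐ x ∂Measure.pi μ, x ∈ Set.univ.pi (A k) → f x = 0 := by
    intro k
    have hm : MeasurableSet (Set.univ.pi (A k)) := MeasurableSet.univ_pi (hA k)
    rw [← ae_restrict_iff' hm]
    -- Dynkin's π-λ argument: measurable rectangles form a generating π-system, and integrability on
    -- the box `A k` makes the complement and disjoint-union steps legitimate.
    have key : ∀ S : Set (∀ i, X i), MeasurableSet S →
        ∫ x in S, f x ∂((Measure.pi μ).restrict (Set.univ.pi (A k))) = 0 := by
      refine MeasurableSpace.induction_on_inter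
        (C := fun S _ => ∫ x in S, f x ∂((Measure.pi μ).restrict (Set.univ.pi (A k))) = 0)
        generateFrom_pi.symm isPiSystem_pi (by simp) ?_ ?_ ?_
      · rintro _ ⟨s, hs, rfl⟩
        have hs' : ∀ i, MeasurableSet (s i) := fun i => hs i (Set.mem_univ i)
        rw [Measure.restrict_restrict (MeasurableSet.univ_pi hs'), ← Set.pi_inter_distrib]
        exact h0 k _ (fun i => (hs' i).inter (hA k i)) fun i => Set.inter_subset_right
      · intro t ht ih
        have hu := h0 k (A k) (hA k) fun i => subset_rfl
        rw [setIntegral_compl ht (hf k), ih, hu, sub_zero]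
      · intro g hm hg ih
        rw [integral_iUnion hg hm (Integrable.integrableOn (hf k))]
        simp [ih]
    exact (hf k).ae_eq_zero_of_forall_setIntegral_eq_zero fun S hS _ => key S hS
  filter_upwards [ae_all_iff.2 hk] with x hx
  obtain ⟨k, hk⟩ := hAu x
  exact hx k fun i _ => hk i

theorem indicatorConstLp_one_ae_eq {Y : Type*} [MeasurableSpace Y] {ρ : Measure Y} {s : Set Y}
    (hs : MeasurableSet s) (h : ρ s ≠ ⊤) :
    (indicatorConstLp 2 hs h (1 : ℂ) : Y → ℂ) =ᵐ[ρ] s.indicator 1 :=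
  indicatorConstLp_coeFn

theorem prod_indicator_one (s : ∀ i, Set (X i)) (x : ∀ i, X i) :
    (∏ i, (s i).indicator (1 : X i → ℂ) (x i)) = (Set.univ.pi s).indicator 1 x := by
  classical
  by_cases hx : x ∈ Set.univ.pi s
  · rw [Set.indicator_of_mem hx]
    exact Finset.prod_eq_one fun i _ => by rw [Set.indicator_of_mem (hx i trivial)]; rfl
  · rw [Set.indicator_of_notMem hx]
    simp only [Set.mem_pi, not_forall] at hx
    obtain ⟨i, -, hi⟩ := hx
    exact Finset.prod_eq_zero (Finset.mem_univ i) (Set.indicator_of_notMem hi _)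

theorem integral_inner_tensorLp_indicator (f : (∀ i, X i) → ℂ) {s : ∀ i, Set (X i)}
    (hs : ∀ i, MeasurableSet (s i)) (h : ∀ i, μ i (s i) ≠ ⊤) :
    ∫ x, inner ℂ (tensorLp μ (fun i => indicatorConstLp 2 (hs i) (h i) (1 : ℂ)) x) (f x)
      ∂Measure.pi μ = ∫ x in Set.univ.pi s, f x ∂Measure.pi μ := by
  rw [← integral_indicator (MeasurableSet.univ_pi hs)]
  refine integral_congr_ae ?_
  filter_upwards [tensorLp_ae_eq_of_ae_eq fun i => indicatorConstLp_one_ae_eq (hs i) (h i)] with x hx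
  rw [hx, prod_indicator_one]
  by_cases hx' : x ∈ Set.univ.pi s <;> simp [hx']

/-- Totality of elementary tensors: indicators of rectangles of finite measure are tensors of
indicators, so the integrals of `f` over all small rectangles vanish. -/
theorem eq_zero_of_forall_inner_tensorLp {f : Lp ℂ 2 (Measure.pi μ)}
    (h : ∀ g : ∀ i, Lp ℂ 2 (μ i), inner ℂ (tensorLp μ g) f = 0) : f = 0 := by
  apply Lp.ext
  refine Filter.EventuallyEq.trans ?_ (Lp.coeFn_zero ℂ 2 _).symm
  have hfin : ∀ k i, μ i (spanningSets (μ i) k) ≠ ⊤ := fun k i => (measure_spanningSets_lt_top _ _).ne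
  refine ae_eq_zero_of_forall_setIntegral_rectangle (fun k i => spanningSets (μ i) k)
    (fun k i => measurableSet_spanningSets _ _) (fun x => ?_) (fun k => ?_) fun k s hs hsk => ?_
  · refine ⟨Finset.univ.sup fun i => spanningSetsIndex (μ i) (x i), fun i => ?_⟩
    exact monotone_spanningSets (μ i) (Finset.le_sup (f := fun i => spanningSetsIndex (μ i) (x i))
      (Finset.mem_univ i)) (mem_spanningSetsIndex (μ i) (x i))
  · have : IsFiniteMeasure ((Measure.pi μ).restrict
        (Set.univ.pi fun i => spanningSets (μ i) k)) := by
      refine ⟨?_⟩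
      rw [Measure.restrict_apply_univ, Measure.pi_pi]
      exact ENNReal.prod_lt_top fun i _ => (hfin k i).lt_top
    exact ((Lp.memLp f).restrict _).integrable (by norm_num)
  · have hfs : ∀ i, μ i (s i) ≠ ⊤ := fun i => measure_ne_top_of_subset (hsk i) (hfin k i)
    rw [← integral_inner_tensorLp_indicator _ hs hfs, ← L2.inner_def]
    exact h _

theorem denseRange_linearCombination_of_inner {I H : Type*} [NormedAddCommGroup H]
    [InnerProductSpace ℂ H] [CompleteSpace H] (a : I → H)
    (ha : ∀ x : H, (∀ i, inner ℂ (a i) x = 0) → x = 0) :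
    DenseRange (Finsupp.linearCombination ℂ a) := by
  have : (Submodule.span ℂ (Set.range a)).topologicalClosure = ⊤ := by
    rw [Submodule.topologicalClosure_eq_top_iff, Submodule.eq_bot_iff]
    intro x hx
    exact ha x fun f => (Submodule.mem_orthogonal _ _).1 hx _ (Submodule.subset_span ⟨f, rfl⟩)
  rw [← Finsupp.range_linearCombination] at this
  rw [DenseRange, ← LinearMap.coe_range]
  exact Submodule.dense_iff_topologicalClosure_eq_top.2 this

/-- Two total families with the same Gram matrix are related by a unitary map. -/
theorem exists_unitary_of_inner_eq {I H H' : Type*} [NormedAddCommGroup H]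
    [InnerProductSpace ℂ H] [CompleteSpace H] [NormedAddCommGroup H']
    [InnerProductSpace ℂ H'] [CompleteSpace H'] (a : I → H) (b : I → H')
    (ha : ∀ x : H, (∀ i, inner ℂ (a i) x = 0) → x = 0)
    (hb : ∀ x : H', (∀ i, inner ℂ (b i) x = 0) → x = 0)
    (hab : ∀ i j, inner ℂ (b i) (b j) = inner ℂ (a i) (a j)) :
    ∃ V : H ≃ₗᵢ[ℂ] H', ∀ i, V (a i) = b i := by
  have hn : ∀ x : I →₀ ℂ, ‖Finsupp.linearCombination ℂ b ((LinearEquiv.refl ℂ _) x)‖ =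
      ‖Finsupp.linearCombination ℂ a x‖ := by
    intro x
    have : inner ℂ (Finsupp.linearCombination ℂ b x) (Finsupp.linearCombination ℂ b x) =
        inner ℂ (Finsupp.linearCombination ℂ a x) (Finsupp.linearCombination ℂ a x) := by
      simp only [Finsupp.linearCombination_apply, Finsupp.sum, inner_sum, sum_inner,
        inner_smul_left, inner_smul_right, hab]
    rw [inner_self_eq_norm_sq_to_K, inner_self_eq_norm_sq_to_K] at this
    exact (sq_eq_sq₀ (norm_nonneg _) (norm_nonneg _)).1 (by exact_mod_cast this)
  refine ⟨(LinearEquiv.refl ℂ _).extendOfIsometry _ _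
    (denseRange_linearCombination_of_inner a ha)
    (denseRange_linearCombination_of_inner b hb) hn, fun i => ?_⟩
  have := (LinearEquiv.refl ℂ _).extendOfIsometry_eq _ _
    (denseRange_linearCombination_of_inner a ha)
    (denseRange_linearCombination_of_inner b hb) hn (Finsupp.single i 1)
  simpa using this

/-- The tensor product of unitary maps. -/
theorem exists_tensor_unitary {Y : ι → Type*} [∀ i, MeasurableSpace (Y i)]
    {ν : ∀ i, Measure (Y i)} [∀ i, SigmaFinite (ν i)]
    (U : ∀ i, Lp ℂ 2 (μ i) ≃ₗᵢ[ℂ] Lp ℂ 2 (ν i)) :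
    ∃ V : Lp ℂ 2 (Measure.pi μ) ≃ₗᵢ[ℂ] Lp ℂ 2 (Measure.pi ν),
      ∀ f, V (tensorLp μ f) = tensorLp ν fun i => U i (f i) := by
  refine exists_unitary_of_inner_eq (fun f => tensorLp μ f) _
    (fun x hx => eq_zero_of_forall_inner_tensorLp hx)
    (fun x hx => eq_zero_of_forall_inner_tensorLp fun g => ?_) fun f g => ?_
  · have := hx fun i => (U i).symm (g i)
    simp only [LinearIsometryEquiv.apply_symm_apply] at this
    exact this
  · simp only [inner_tensorLp, LinearIsometryEquiv.inner_map_map]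

open scoped ComplexOrder in
-- Schur product theorem, by induction on the set of factors. The empty product is the all-ones
-- matrix, the Gram matrix of a constant family in `ℂ`.
theorem posSemidef_prod_gram {κ : Type*} [Finite κ] {H : ι → Type*} [∀ i, NormedAddCommGroup (H i)]
    [∀ i, InnerProductSpace ℂ (H i)] (s : Finset ι) (f : ∀ i, κ → H i) :
    (Matrix.of fun m m' => ∏ i ∈ s, inner ℂ (f i m) (f i m')).PosSemidef := by
  classical
  induction s using Finset.induction_on with
  | empty => simpa [Matrix.gram] using Matrix.posSemidef_gram (𝕜 := ℂ) (fun _ : κ => (1 : ℂ))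
  | insert i s hi ih =>
    have : (Matrix.of fun m m' => ∏ i ∈ insert i s, inner ℂ (f i m) (f i m')) =
        (Matrix.gram ℂ (f i)).hadamard (Matrix.of fun m m' => ∏ i ∈ s, inner ℂ (f i m) (f i m')) := by
      ext m m'
      simp [Finset.prod_insert hi, Matrix.gram_apply]
    rw [this]
    exact (Matrix.posSemidef_gram (𝕜 := ℂ) (f i)).hadamard ih

open scoped ComplexOrder in
/-- A Bessel bound in one factor gives a bound for diagonal sums of tensors. -/
theorem norm_sq_sum_tensorLp_le [DecidableEq ι] {κ : Type*} [Fintype κ] (i₀ : ι)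
    (f : ∀ i, κ → Lp ℂ 2 (μ i)) (C : ℝ) (a : κ → ℂ)
    (h : ∀ b : κ → ℂ, ‖∑ m, b m • f i₀ m‖ ^ 2 ≤ C * ∑ m, ‖b m‖ ^ 2) :
    ‖∑ m, a m • tensorLp μ (fun i => f i m)‖ ^ 2 ≤
      C * ∑ m, ‖a m‖ ^ 2 * ∏ i ∈ Finset.univ.erase i₀, ‖f i m‖ ^ 2 := by
  classical
  -- The Bessel bound says exactly that `C • 1` dominates the Gram matrix of the factor `i₀`. The
  -- Hadamard product with the Gram matrices of the other factors preserves this; it turns the Gram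
  -- matrix into that of the tensors and `C • 1` into a diagonal matrix of norms.
  have h1 : ((C : ℂ) • (1 : Matrix κ κ ℂ) - Matrix.gram ℂ (f i₀)).PosSemidef := by
    refine .of_dotProduct_mulVec_nonneg ?_ fun x => ?_
    · refine Matrix.IsHermitian.sub ?_ (Matrix.isHermitian_gram _ _)
      rw [Matrix.IsHermitian, Matrix.conjTranspose_smul]
      simp
    · rw [Matrix.sub_mulVec, dotProduct_sub, Matrix.star_dotProduct_gram_mulVec,
        inner_self_eq_norm_sq_to_K, Matrix.smul_mulVec, Matrix.one_mulVec, dotProduct_smul,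
        sub_nonneg]
      have h2 : star x ⬝ᵥ x = ((∑ m, ‖x m‖ ^ 2 : ℝ) : ℂ) := by
        simp [dotProduct, ← Complex.conj_mul']
      rw [h2, smul_eq_mul]
      have h3 := Complex.real_le_real.2 (h x)
      push_cast at h3 ⊢
      exact h3
  have h2 := (h1.hadamard (posSemidef_prod_gram (Finset.univ.erase i₀) f)).dotProduct_mulVec_nonneg a
  have h3 : star a ⬝ᵥ ((((C : ℂ) • (1 : Matrix κ κ ℂ) - Matrix.gram ℂ (f i₀)).hadamard
      (Matrix.of fun m m' => ∏ i ∈ Finset.univ.erase i₀, inner ℂ (f i m) (f i m'))).mulVec a) =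
      ((C * ∑ m, ‖a m‖ ^ 2 * ∏ i ∈ Finset.univ.erase i₀, ‖f i m‖ ^ 2 -
        ‖∑ m, a m • tensorLp μ (fun i => f i m)‖ ^ 2 : ℝ) : ℂ) := by
    push_cast
    rw [← Complex.coe_algebraMap, ← inner_self_eq_norm_sq_to_K (𝕜 := ℂ)]
    simp only [inner_sum, sum_inner, inner_smul_left, inner_smul_right, inner_tensorLp]
    simp only [← Finset.mul_prod_erase _ _ (Finset.mem_univ i₀)]
    simp only [dotProduct, Matrix.mulVec, Matrix.hadamard_apply, Matrix.sub_apply,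
      Matrix.smul_apply, Matrix.gram_apply, Matrix.of_apply, sub_mul, Finset.sum_sub_distrib,
      mul_sub, Finset.mul_sum, Pi.star_apply]
    congr 1
    · refine Finset.sum_congr rfl fun m _ => ?_
      rw [Finset.sum_eq_single m (fun b _ hb => by simp [Matrix.one_apply_ne hb.symm]) (by simp)]
      simp only [Matrix.one_apply_eq, smul_eq_mul, mul_one, inner_self_eq_norm_sq_to_K,
        Complex.coe_algebraMap, ← Complex.conj_mul', RCLike.star_def]
      ring
    · rw [Finset.sum_comm]
      refine Finset.sum_congr rfl fun m _ => Finset.sum_congr rfl fun m' _ => ?_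
      simp only [RCLike.star_def]
      ring
  rw [h3] at h2
  have h4 : (0 : ℝ) ≤ C * ∑ m, ‖a m‖ ^ 2 * ∏ i ∈ Finset.univ.erase i₀, ‖f i m‖ ^ 2 -
        ‖∑ m, a m • tensorLp μ (fun i => f i m)‖ ^ 2 := by exact_mod_cast h2
  linarith

end Tensor

/-! ### Finite products of manifolds -/

section PiManifold

variable {ι : Type*} [Fintype ι] {E H : ι → Type*} [∀ i, NormedAddCommGroup (E i)]
  [∀ i, NormedSpace ℝ (E i)] [∀ i, TopologicalSpace (H i)]
  {I : ∀ i, ModelWithCorners ℝ (E i) (H i)} {M : ι → Type*} [∀ i, TopologicalSpace (M i)]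
  [∀ i, ChartedSpace (H i) (M i)] {n : ℕ∞ω}

/-- The charts of a product are products of charts, so in coordinates the evaluation is a linear
projection. -/
theorem contMDiff_eval (i : ι) :
    ContMDiff (ModelWithCorners.pi I) (I i) n (fun x : ∀ i, M i => x i) := by
  intro x
  rw [contMDiffAt_iff]
  refine ⟨(continuous_apply i).continuousAt, ?_⟩
  have hp : ContDiffWithinAt ℝ n (fun y : ∀ i, E i => y i) (Set.range (ModelWithCorners.pi I))
      (extChartAt (ModelWithCorners.pi I) x x) :=
    (ContinuousLinearMap.proj (R := ℝ) (φ := E) i).contDiff.contDiffWithinAt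
  refine hp.congr_of_eventuallyEq ?_ ?_
  · filter_upwards [extChartAt_target_mem_nhdsWithin (I := ModelWithCorners.pi I) x] with y hy
    have hy' : y i ∈ (extChartAt (I i) (x i)).target := by
      rw [extChartAt_target] at hy ⊢
      obtain ⟨h1, z, hz⟩ := hy
      exact ⟨h1 i trivial, z i, congrFun hz i⟩
    exact (extChartAt (I i) (x i)).right_inv hy'
  · exact (extChartAt (I i) (x i)).right_inv (mem_extChartAt_target (I := I i) (x i))

theorem contMDiff_pi_of_forall {E' H' : Type*} [NormedAddCommGroup E'] [NormedSpace ℝ E']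
    [TopologicalSpace H'] {J : ModelWithCorners ℝ E' H'} {N : Type*} [TopologicalSpace N]
    [ChartedSpace H' N] {f : N → ∀ i, M i} (h : ∀ i, ContMDiff J (I i) n fun x => f x i) :
    ContMDiff J (ModelWithCorners.pi I) n f := by
  intro x
  rw [contMDiffAt_iff]
  refine ⟨(continuous_pi fun i => (h i).continuous).continuousAt, ?_⟩
  rw [contDiffWithinAt_pi]
  exact fun i => (contMDiffAt_iff.1 (h i x)).2

instance isManifold_pi [∀ i, IsManifold (I i) n (M i)] :
    IsManifold (ModelWithCorners.pi I) n (∀ i, M i) := by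
  refine isManifold_of_contDiffOn _ _ _ ?_
  rintro _ _ ⟨e, he, rfl⟩ ⟨e', he', rfl⟩
  rw [contDiffOn_pi]
  intro i
  have hi := ((contDiffGroupoid n (I i)).compatible (he i trivial) (he' i trivial))
  rw [contDiffGroupoid, mem_groupoid_of_pregroupoid] at hi
  have h1 : ContDiffOn ℝ n (I i ∘ (e i).symm ≫ₕ e' i ∘ (I i).symm)
    ((I i).symm ⁻¹' ((e i).symm ≫ₕ e' i).source ∩ Set.range (I i)) := hi.1
  refine h1.comp (ContinuousLinearMap.proj (R := ℝ) (φ := E) i).contDiff.contDiffOn ?_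
  rintro y ⟨⟨h2, h3⟩, z, hz⟩
  exact ⟨⟨h2 i trivial, h3 i trivial⟩, z i, congrFun hz i⟩

end PiManifold

/-! ### Derivatives along a one-parameter family of right translations -/

section AlongDeriv

variable {E H : Type*} [NormedAddCommGroup E] [NormedSpace ℝ E] [TopologicalSpace H]
  {J : ModelWithCorners ℝ E H} {G : Type*} [TopologicalSpace G] [ChartedSpace H G] [Group G]
  {E' H' : Type*} [NormedAddCommGroup E'] [NormedSpace ℝ E'] [TopologicalSpace H']
  {I : ModelWithCorners ℝ E' H'} {G' : Type*} [TopologicalSpace G'] [ChartedSpace H' G'] [Group G']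
  [LieGroup I ∞ G'] [IsManifold J ∞ G]

/-- The derivative of `φ` along the left-invariant vector field which is the pushforward along the
homomorphism `i` of the left-invariant vector field with value `v` at `1`. -/
def alongDeriv (I : ModelWithCorners ℝ E' H') (i : G' →* G) (v : GroupLieAlgebra I G') (φ : G → ℂ) :
    G → ℂ :=
  fun x => (mfderiv I 𝓘(ℝ, ℂ) (fun y => φ (x * i y)) 1 v : ℂ)

/-- The operator `-∑ₗ Xₗ²` for pushforwards `Xₗ` of left-invariant vector fields. -/
def alongSumOfSquares (I : ModelWithCorners ℝ E' H') (i : G' →* G) {κ : Type*} [Fintype κ]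
    (X : κ → GroupLieAlgebra I G') (φ : G → ℂ) : G → ℂ :=
  fun x => -∑ l, alongDeriv I i (X l) (alongDeriv I i (X l) φ) x

variable (J) in
/-- Right translation by the image of `i` is jointly smooth. -/
def SmoothRightAction (I : ModelWithCorners ℝ E' H') (i : G' →* G) : Prop :=
  ContMDiff (J.prod I) J ∞ (fun p : G × G' => p.1 * i p.2)

variable {i : G' →* G} {v : GroupLieAlgebra I G'} {φ ψ : G → ℂ}

theorem SmoothRightAction.contMDiff_translate (hi : SmoothRightAction J I i)
    (hφ : ContMDiff J 𝓘(ℝ, ℂ) ∞ φ) (x : G) :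
    ContMDiff I 𝓘(ℝ, ℂ) ∞ (fun y => φ (x * i y)) :=
  hφ.comp (hi.comp (contMDiff_const.prodMk contMDiff_id))

/-- `(x, y) ↦ φ (x * i y)` is jointly smooth, hence its partial derivative in `y` at the fixed point
1 is smooth in `x`. -/
theorem contMDiff_alongDeriv (hi : SmoothRightAction J I i) (hφ : ContMDiff J 𝓘(ℝ, ℂ) ∞ φ) :
    ContMDiff J 𝓘(ℝ, ℂ) ∞ (alongDeriv I i v φ) := by
  intro x₀
  have h := ContMDiffAt.mfderiv_apply (x₀ := x₀) (m := ∞) (n := ∞) (I := I) (I' := 𝓘(ℝ, ℂ))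
    (J := J) (J' := J) (fun x y => φ (x * i y)) (fun _ => (1 : G')) id (fun _ => v)
    ((hφ.comp hi).contMDiffAt) contMDiffAt_const contMDiffAt_id contMDiffAt_const (by simp)
  refine h.congr_of_eventuallyEq (Filter.Eventually.of_forall fun x => ?_)
  have e := inTangentCoordinates_eq (I := I) (I' := 𝓘(ℝ, ℂ)) (fun _ : G => (1 : G'))
    (fun x => φ (x * i 1)) (fun x => mfderiv I 𝓘(ℝ, ℂ) (fun y => φ (x * i y)) 1)
    (x₀ := x₀) (x := x) (mem_chart_source _ _) (by rw [chartAt_self_eq]; trivial)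
  refine Eq.trans ?_ (congrArg (fun A : E' →L[ℝ] ℂ => A v) e.symm)
  -- The general theorem describes the derivative in tangent coordinates. Here the base point in
  -- `G'` is constant and the target is a vector space, so both coordinate changes are identities.
  have h1 := (tangentBundleCore I G').coordChange_self (achart H' (1 : G')) 1
    (mem_chart_source _ _) v
  have h2 (w : ℂ) : (tangentBundleCore 𝓘(ℝ, ℂ) ℂ).coordChange (achart ℂ (φ (x * i 1)))
      (achart ℂ (φ (x₀ * i 1))) (φ (x * i 1)) w = w :=
    (tangentBundleCore 𝓘(ℝ, ℂ) ℂ).coordChange_self (achart ℂ (φ (x * i 1))) _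
      (mem_chart_source _ _) w
  refine Eq.trans ?_ (h2 _).symm
  exact congrArg (mfderiv I 𝓘(ℝ, ℂ) (fun y => φ (x * i y)) 1) h1.symm

/-- Left invariance and the chain rule: `i` is a homomorphism, so a left translation by `y` in `G'`
is absorbed into the base point as `x * i y`. -/
theorem leftInvariantDeriv_translate (hi : SmoothRightAction J I i)
    (hφ : ContMDiff J 𝓘(ℝ, ℂ) ∞ φ) (x : G) (y : G') :
    leftInvariantDeriv I v (fun y => φ (x * i y)) y = alongDeriv I i v φ (x * i y) := by
  have h1 : (fun z => φ (x * i y * i z)) = (fun y => φ (x * i y)) ∘ (fun z => y * z) := by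
    ext z; simp [mul_assoc]
  have h2 := mfderiv_comp_apply_of_eq (I' := I) (x := (1 : G')) (y := y)
    ((hi.contMDiff_translate hφ x).mdifferentiable (by simp) y)
    ((contMDiff_mul_left (I := I) (n := ∞) (a := y)).mdifferentiable (by simp) 1) (mul_one y) v
  rw [alongDeriv, h1]
  exact h2.symm

theorem sumOfSquares_translate (hi : SmoothRightAction J I i)
    (hφ : ContMDiff J 𝓘(ℝ, ℂ) ∞ φ) {κ : Type*} [Fintype κ] (X : κ → GroupLieAlgebra I G')
    (x : G) (y : G') :
    sumOfSquares I X (fun y => φ (x * i y)) y = alongSumOfSquares I i X φ (x * i y) := by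
  simp only [sumOfSquares, alongSumOfSquares]
  congr 1
  refine Finset.sum_congr rfl fun l _ => ?_
  rw [show leftInvariantDeriv I (X l) (fun y => φ (x * i y)) =
    fun y => alongDeriv I i (X l) φ (x * i y) from
      funext fun y => leftInvariantDeriv_translate hi hφ x y]
  exact leftInvariantDeriv_translate hi (contMDiff_alongDeriv hi hφ) x y

/-- The pushforward evaluates the second-order operator only at 1. The translation identity at all
`y` is what allows the two derivatives to be pushed forward one after the other. -/
theorem pushforwardOperator_sumOfSquares (hi : SmoothRightAction J I i)
    (hφ : ContMDiff J 𝓘(ℝ, ℂ) ∞ φ) {κ : Type*} [Fintype κ] (X : κ → GroupLieAlgebra I G') :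
    pushforwardOperator i (sumOfSquares I X) φ = alongSumOfSquares I i X φ := by
  ext x
  rw [pushforwardOperator, sumOfSquares_translate hi hφ]
  simp

theorem alongDeriv_congr (hi : SmoothRightAction J I i) {x : G} (h : φ =ᶠ[nhds x] ψ) :
    alongDeriv I i v φ x = alongDeriv I i v ψ x := by
  have hc : Continuous fun y => x * i y :=
    hi.continuous.comp (continuous_const.prodMk continuous_id)
  have : Filter.Tendsto (fun y => x * i y) (nhds 1) (nhds x) := by
    have := hc.tendsto 1
    simpa using this
  have h' : (fun y => φ (x * i y)) =ᶠ[nhds 1] fun y => ψ (x * i y) := this.eventually h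
  simp only [alongDeriv]
  rw [h'.mfderiv_eq]
  rfl

theorem alongDeriv_const (c : ℂ) (x : G) : alongDeriv I i v (fun _ => c) x = 0 := by
  simp only [alongDeriv]
  rw [mfderiv_const]
  rfl

theorem alongDeriv_congr_nhds (hi : SmoothRightAction J I i) {x : G} (h : φ =ᶠ[nhds x] ψ) :
    alongDeriv I i v φ =ᶠ[nhds x] alongDeriv I i v ψ := by
  filter_upwards [eventually_eventually_nhds.2 h] with y hy
  exact alongDeriv_congr hi hy

theorem alongSumOfSquares_congr (hi : SmoothRightAction J I i) {κ : Type*} [Fintype κ]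
    (X : κ → GroupLieAlgebra I G') {x : G} (h : φ =ᶠ[nhds x] ψ) :
    alongSumOfSquares I i X φ x = alongSumOfSquares I i X ψ x := by
  simp only [alongSumOfSquares]
  congr 1
  exact Finset.sum_congr rfl fun l _ => alongDeriv_congr hi (alongDeriv_congr_nhds hi h)

theorem alongSumOfSquares_const {κ : Type*} [Fintype κ]
    (X : κ → GroupLieAlgebra I G') (c : ℂ) (x : G) :
    alongSumOfSquares I i X (fun _ => c) x = 0 := by
  have : ∀ l, alongDeriv I i (X l) (fun _ : G => c) = fun _ => 0 :=
    fun l => funext fun x => alongDeriv_const c x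
  simp [alongSumOfSquares, this, alongDeriv_const]

theorem contMDiff_alongSumOfSquares (hi : SmoothRightAction J I i)
    (hφ : ContMDiff J 𝓘(ℝ, ℂ) ∞ φ) {κ : Type*} [Fintype κ] (X : κ → GroupLieAlgebra I G') :
    ContMDiff J 𝓘(ℝ, ℂ) ∞ (alongSumOfSquares I i X φ) := by
  have : ContMDiff J 𝓘(ℝ, ℂ) ∞
      (fun x => ∑ l, alongDeriv I i (X l) (alongDeriv I i (X l) φ) x) := by
    refine contMDiff_finsetSum fun l _ => contMDiff_alongDeriv hi (contMDiff_alongDeriv hi hφ)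
  exact (contDiff_neg (𝕜 := ℝ) (F := ℂ)).contMDiff.comp this

theorem alongSumOfSquares_eq_zero_of_notMem (hi : SmoothRightAction J I i) {κ : Type*} [Fintype κ]
    (X : κ → GroupLieAlgebra I G') {x : G} (hx : x ∉ tsupport φ) :
    alongSumOfSquares I i X φ x = 0 := by
  have : φ =ᶠ[nhds x] fun _ => 0 := notMem_tsupport_iff_eventuallyEq.1 hx
  rw [alongSumOfSquares_congr hi X this, alongSumOfSquares_const]

theorem IsTestFunction.alongSumOfSquares (hi : SmoothRightAction J I i)
    (hφ : IsTestFunction J φ) {κ : Type*} [Fintype κ] (X : κ → GroupLieAlgebra I G') :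
    IsTestFunction J (alongSumOfSquares I i X φ) := by
  refine ⟨contMDiff_alongSumOfSquares hi hφ.1 X, ?_⟩
  refine hφ.2.mono' ?_
  intro x hx
  by_contra h
  exact hx (alongSumOfSquares_eq_zero_of_notMem hi X h)

theorem alongDeriv_add (hi : SmoothRightAction J I i) (hφ : ContMDiff J 𝓘(ℝ, ℂ) ∞ φ)
    (hψ : ContMDiff J 𝓘(ℝ, ℂ) ∞ ψ) (x : G) :
    alongDeriv I i v (fun x => φ x + ψ x) x = alongDeriv I i v φ x + alongDeriv I i v ψ x := by
  have h := mfderiv_add ((hi.contMDiff_translate hφ x).mdifferentiable (by simp) 1)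
    ((hi.contMDiff_translate hψ x).mdifferentiable (by simp) 1)
  have := congrArg (fun L => L v) h
  exact this

theorem alongDeriv_mul (hi : SmoothRightAction J I i) (hφ : ContMDiff J 𝓘(ℝ, ℂ) ∞ φ)
    (hψ : ContMDiff J 𝓘(ℝ, ℂ) ∞ ψ) (x : G) :
    alongDeriv I i v (fun x => φ x * ψ x) x =
      alongDeriv I i v φ x * ψ x + φ x * alongDeriv I i v ψ x := by
  have h := (((hi.contMDiff_translate hφ x).mdifferentiable (by simp) 1).hasMFDerivAt.mul
    ((hi.contMDiff_translate hψ x).mdifferentiable (by simp) 1).hasMFDerivAt).mfderiv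
  have := congrArg (fun L => L v) h
  simp only [alongDeriv]
  refine this.trans ?_
  change φ (x * i 1) * _ + ψ (x * i 1) * _ = _
  rw [map_one, mul_one, add_comm, mul_comm (ψ x)]
  rfl

theorem alongDeriv_comp_clm (hi : SmoothRightAction J I i) (hφ : ContMDiff J 𝓘(ℝ, ℂ) ∞ φ)
    (A : ℂ →L[ℝ] ℂ) (x : G) :
    alongDeriv I i v (fun x => A (φ x)) x = A (alongDeriv I i v φ x) := by
  have h := mfderiv_comp (I' := 𝓘(ℝ, ℂ)) (I'' := 𝓘(ℝ, ℂ)) (1 : G') (g := A) (A.contMDiff.mdifferentiable (n := 1) one_ne_zero _)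
    ((hi.contMDiff_translate hφ x).mdifferentiable (by simp) 1)
  have := congrArg (fun L => L v) h
  refine this.trans ?_
  rw [mfderiv_eq_fderiv, A.fderiv]
  rfl

end AlongDeriv

/-! ### Convolution with a square-integrable kernel -/

/-- Cauchy–Schwarz for the measure with density `f`. It serves both for the convolution inequality
and for the Schur tests on Fourier series. -/
theorem lintegral_mul_sq_le {Ω : Type*} [MeasurableSpace Ω] {ρ : Measure Ω} {f g : Ω → ℝ≥0∞}
    (hf : AEMeasurable f ρ) (hg : AEMeasurable g ρ) :
    (∫⁻ x, f x * g x ∂ρ) ^ 2 ≤ (∫⁻ x, f x ∂ρ) * ∫⁻ x, f x * g x ^ 2 ∂ρ := by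
  have h := ENNReal.lintegral_mul_norm_pow_le hf (hf.mul (hg.pow_const 2)) (p := 1 / 2)
    (q := 1 / 2) (by norm_num) (by norm_num) (by norm_num)
  have h1 : ∀ x, f x ^ (1 / 2 : ℝ) * (f x * g x ^ 2) ^ (1 / 2 : ℝ) = f x * g x := by
    intro x
    rw [ENNReal.mul_rpow_of_nonneg _ _ (by norm_num), ← mul_assoc,
      ← ENNReal.rpow_add_of_nonneg _ _ (by norm_num) (by norm_num), ← ENNReal.rpow_natCast,
      ← ENNReal.rpow_mul]
    norm_num
  simp only [Pi.mul_apply, h1] at h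
  calc (∫⁻ x, f x * g x ∂ρ) ^ 2
      ≤ ((∫⁻ x, f x ∂ρ) ^ (1 / 2 : ℝ) * (∫⁻ x, f x * g x ^ 2 ∂ρ) ^ (1 / 2 : ℝ)) ^ 2 := by gcongr
    _ = _ := by
      rw [mul_pow, ← ENNReal.rpow_natCast, ← ENNReal.rpow_mul, ← ENNReal.rpow_natCast,
        ← ENNReal.rpow_mul]
      norm_num

theorem eLpNorm_two_sq {Ω : Type*} [MeasurableSpace Ω] {ρ : Measure Ω} (f : Ω → ℂ) :
    eLpNorm f 2 ρ ^ 2 = ∫⁻ x, ‖f x‖ₑ ^ 2 ∂ρ := by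
  have := eLpNorm_nnreal_pow_eq_lintegral (μ := ρ) (f := f) (p := 2) (by norm_num)
  simpa using this

theorem integral_mul_star_le {Ω : Type*} [MeasurableSpace Ω] {ρ : Measure Ω} {f g : Ω → ℂ}
    (hf : MemLp f 2 ρ) (hg : MemLp g 2 ρ) :
    ∫ x, ‖f x * starRingEnd ℂ (g x)‖ ∂ρ ≤ (eLpNorm f 2 ρ).toReal * (eLpNorm g 2 ρ).toReal := by
  have hg' : MemLp (fun x => starRingEnd ℂ (g x)) 2 ρ := hg.star
  have h := eLpNorm_smul_le_mul_eLpNorm (p := 2) (q := 2) (r := 1) hg'.1 hf.1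
  have hge : eLpNorm (fun x => starRingEnd ℂ (g x)) 2 ρ = eLpNorm g 2 ρ :=
    eLpNorm_congr_norm_ae (Filter.Eventually.of_forall fun x => by simp)
  have hm : AEStronglyMeasurable (fun x => f x * starRingEnd ℂ (g x)) ρ := hf.1.mul hg'.1
  rw [integral_norm_eq_lintegral_enorm hm, ← ENNReal.toReal_mul]
  refine ENNReal.toReal_mono (ENNReal.mul_ne_top hf.2.ne hg.2.ne) ?_
  rw [hge, eLpNorm_one_eq_lintegral_enorm] at h
  simpa [mul_comm, smul_eq_mul] using h

section Convolution

variable {G : Type*} [TopologicalSpace G] [Group G] [IsTopologicalGroup G]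
  [SecondCountableTopology G] [MeasurableSpace G] [BorelSpace G] {μ : Measure G} [SigmaFinite μ]
  [μ.IsMulLeftInvariant]

variable (μ) in
/-- The convolution of two functions on a group. -/
def groupConv (φ k : G → ℂ) (x : G) : ℂ := ∫ y, φ y * k (y⁻¹ * x) ∂μ

variable {φ k ψ : G → ℂ}

theorem aestronglyMeasurable_kernel (hk : AEStronglyMeasurable k μ) :
    AEStronglyMeasurable (fun p : G × G => k (p.2⁻¹ * p.1)) (μ.prod μ) :=
  hk.comp_quasiMeasurePreserving (quasiMeasurePreserving_inv_mul_swap μ μ)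

theorem aestronglyMeasurable_conv_integrand (hφ : AEStronglyMeasurable φ μ)
    (hk : AEStronglyMeasurable k μ) :
    AEStronglyMeasurable (fun p : G × G => φ p.2 * k (p.2⁻¹ * p.1)) (μ.prod μ) :=
  hφ.comp_snd.mul (aestronglyMeasurable_kernel hk)

theorem memLp_translate (hk : MemLp k 2 μ) (y : G) : MemLp (fun x => k (y⁻¹ * x)) 2 μ :=
  hk.comp_measurePreserving (measurePreserving_mul_left μ y⁻¹)

theorem eLpNorm_translate (hk : AEStronglyMeasurable k μ) (y : G) :
    eLpNorm (fun x => k (y⁻¹ * x)) 2 μ = eLpNorm k 2 μ :=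
  eLpNorm_comp_measurePreserving hk (measurePreserving_mul_left μ y⁻¹)

theorem ae_aestronglyMeasurable_kernel (hk : AEStronglyMeasurable k μ) :
    ∀ᵐ x ∂μ, AEStronglyMeasurable (fun y => k (y⁻¹ * x)) μ :=
  (aestronglyMeasurable_kernel hk).prodMk_left

/-- Young's inequality for `L¹ * L²`: Cauchy–Schwarz with weight `|φ|`, then Tonelli and left
invariance. The absolute values inside also give almost everywhere convergence of the convolution
integral. -/
theorem lintegral_conv_sq_le (hφ : AEStronglyMeasurable φ μ) (hk : AEStronglyMeasurable k μ) :
    ∫⁻ x, (∫⁻ y, ‖φ y‖ₑ * ‖k (y⁻¹ * x)‖ₑ ∂μ) ^ 2 ∂μ ≤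
      (eLpNorm φ 1 μ * eLpNorm k 2 μ) ^ 2 := by
  calc ∫⁻ x, (∫⁻ y, ‖φ y‖ₑ * ‖k (y⁻¹ * x)‖ₑ ∂μ) ^ 2 ∂μ
      ≤ ∫⁻ x, eLpNorm φ 1 μ * ∫⁻ y, ‖φ y‖ₑ * ‖k (y⁻¹ * x)‖ₑ ^ 2 ∂μ ∂μ := by
        refine lintegral_mono_ae ?_
        filter_upwards [ae_aestronglyMeasurable_kernel hk] with x hx
        rw [eLpNorm_one_eq_lintegral_enorm]
        exact lintegral_mul_sq_le hφ.enorm hx.enorm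
    _ = eLpNorm φ 1 μ * ∫⁻ y, ∫⁻ x, ‖φ y‖ₑ * ‖k (y⁻¹ * x)‖ₑ ^ 2 ∂μ ∂μ := by
        have hm : AEMeasurable (Function.uncurry fun x y : G => ‖φ y‖ₑ * ‖k (y⁻¹ * x)‖ₑ ^ 2)
            (μ.prod μ) :=
          hφ.comp_snd.enorm.mul ((aestronglyMeasurable_kernel hk).enorm.pow_const 2)
        have hm' : AEMeasurable (fun x => ∫⁻ y, ‖φ y‖ₑ * ‖k (y⁻¹ * x)‖ₑ ^ 2 ∂μ) μ :=
          hm.lintegral_prod_right'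
        rw [lintegral_const_mul'' _ hm', lintegral_lintegral_swap hm]
    _ = eLpNorm φ 1 μ * ∫⁻ y, ‖φ y‖ₑ * eLpNorm k 2 μ ^ 2 ∂μ := by
        congr 1
        refine lintegral_congr fun y => ?_
        rw [lintegral_const_mul'' _ ?_, ← eLpNorm_translate hk y, eLpNorm_two_sq]
        exact (hk.comp_measurePreserving (measurePreserving_mul_left μ y⁻¹)).enorm.pow_const 2
    _ = _ := by
        rw [lintegral_mul_const'' _ hφ.enorm, ← eLpNorm_one_eq_lintegral_enorm]
        ring

/-- This is what makes convolution linear in the kernel, outside a null set. -/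
theorem ae_integrable_conv (hφ : MemLp φ 1 μ) (hk : MemLp k 2 μ) :
    ∀ᵐ x ∂μ, Integrable (fun y => φ y * k (y⁻¹ * x)) μ := by
  have h := lintegral_conv_sq_le hφ.1 hk.1
  have hm : AEMeasurable (fun x => (∫⁻ y, ‖φ y‖ₑ * ‖k (y⁻¹ * x)‖ₑ ∂μ) ^ 2) μ :=
    (AEMeasurable.lintegral_prod_right' (f := fun p : G × G => ‖φ p.2‖ₑ * ‖k (p.2⁻¹ * p.1)‖ₑ)
      (hφ.1.comp_snd.enorm.mul (aestronglyMeasurable_kernel hk.1).enorm)).pow_const 2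
  have h' := ae_lt_top' hm
    (h.trans_lt (ENNReal.pow_lt_top (ENNReal.mul_lt_top hφ.2 hk.2))).ne
  filter_upwards [h', ae_aestronglyMeasurable_kernel hk.1] with x hx hxm
  refine ⟨hφ.1.mul hxm, ?_⟩
  rw [HasFiniteIntegral]
  simp only [enorm_mul]
  by_contra hc
  rw [not_lt, top_le_iff] at hc
  simp [hc] at hx

theorem eLpNorm_groupConv_le (hφ : AEStronglyMeasurable φ μ) (hk : AEStronglyMeasurable k μ) :
    eLpNorm (groupConv μ φ k) 2 μ ≤ eLpNorm φ 1 μ * eLpNorm k 2 μ := by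
  rw [← ENNReal.pow_le_pow_left_iff two_ne_zero, eLpNorm_two_sq]
  refine le_trans (lintegral_mono fun x => ?_) (lintegral_conv_sq_le hφ hk)
  gcongr
  refine (enorm_integral_le_lintegral_enorm _).trans ?_
  simp only [enorm_mul]
  exact le_rfl

theorem aestronglyMeasurable_groupConv (hφ : AEStronglyMeasurable φ μ)
    (hk : AEStronglyMeasurable k μ) : AEStronglyMeasurable (groupConv μ φ k) μ :=
  (aestronglyMeasurable_conv_integrand hφ hk).integral_prod_right'

theorem memLp_groupConv (hφ : MemLp φ 1 μ) (hk : MemLp k 2 μ) : MemLp (groupConv μ φ k) 2 μ :=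
  ⟨aestronglyMeasurable_groupConv hφ.1 hk.1,
    (eLpNorm_groupConv_le hφ.1 hk.1).trans_lt (ENNReal.mul_lt_top hφ.2 hk.2)⟩

theorem groupConv_sub (hφ : MemLp φ 1 μ) {k' : G → ℂ} (hk : MemLp k 2 μ) (hk' : MemLp k' 2 μ) :
    groupConv μ φ (fun x => k x - k' x) =ᵐ[μ]
      fun x => groupConv μ φ k x - groupConv μ φ k' x := by
  filter_upwards [ae_integrable_conv hφ hk, ae_integrable_conv hφ hk'] with x h h'
  simp only [groupConv, mul_sub]
  rw [integral_sub h h']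

theorem groupConv_sum (hφ : MemLp φ 1 μ) {κ : Type*} (s : Finset κ) (c : κ → ℂ) {k : κ → G → ℂ}
    (hk : ∀ m, MemLp (k m) 2 μ) :
    groupConv μ φ (fun x => ∑ m ∈ s, c m * k m x) =ᵐ[μ]
      fun x => ∑ m ∈ s, c m * groupConv μ φ (k m) x := by
  have : ∀ᵐ x ∂μ, ∀ m ∈ s, Integrable (fun y => φ y * k m (y⁻¹ * x)) μ :=
    (Filter.eventually_all_finset s).2 fun m _ => ae_integrable_conv hφ (hk m)
  filter_upwards [this] with x h
  simp only [groupConv, Finset.mul_sum, ← integral_const_mul]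
  rw [← integral_finsetSum]
  · refine integral_congr_ae (Filter.Eventually.of_forall fun y => ?_)
    exact Finset.sum_congr rfl fun m _ => by ring
  · intro m hm
    exact (h m hm).const_mul (c m)

theorem groupConv_congr {k' : G → ℂ} (h : k =ᵐ[μ] k') (φ : G → ℂ) :
    groupConv μ φ k =ᵐ[μ] groupConv μ φ k' := by
  have h2 : (fun p : G × G => k (p.2⁻¹ * p.1)) =ᵐ[μ.prod μ] fun p => k' (p.2⁻¹ * p.1) :=
    (quasiMeasurePreserving_inv_mul_swap μ μ).ae_eq_comp h
  filter_upwards [Measure.ae_ae_of_ae_prod h2] with x hx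
  refine integral_congr_ae ?_
  filter_upwards [hx] with y hy
  rw [hy]

/-- The adjoint of `φ ↦ φ * k`. -/
def convAdjoint (μ : Measure G) (k ψ : G → ℂ) (y : G) : ℂ :=
  ∫ x, k (y⁻¹ * x) * starRingEnd ℂ (ψ x) ∂μ

theorem integrable_prod_conv (hφ : MemLp φ 1 μ) (hk : MemLp k 2 μ) (hψ : MemLp ψ 2 μ) :
    Integrable (fun p : G × G => φ p.2 * k (p.2⁻¹ * p.1) * starRingEnd ℂ (ψ p.1)) (μ.prod μ) := by
  have hψ' : MemLp (fun x => starRingEnd ℂ (ψ x)) 2 μ := hψ.star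
  have hm : AEStronglyMeasurable
      (fun p : G × G => φ p.2 * k (p.2⁻¹ * p.1) * starRingEnd ℂ (ψ p.1)) (μ.prod μ) :=
    (aestronglyMeasurable_conv_integrand hφ.1 hk.1).mul hψ'.1.comp_fst
  rw [integrable_prod_iff' hm]
  constructor
  · refine Filter.Eventually.of_forall fun y => ?_
    have := ((memLp_translate hk y).integrable_mul hψ').const_mul (φ y)
    simpa [mul_assoc] using this
  · refine Integrable.mono' (g := fun y => ‖φ y‖ * ((eLpNorm k 2 μ).toReal * (eLpNorm ψ 2 μ).toReal))
      ((memLp_one_iff_integrable.1 hφ).norm.mul_const _) ?_ ?_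
    · exact (hm.norm.prod_swap).integral_prod_right'
    · refine Filter.Eventually.of_forall fun y => ?_
      rw [Real.norm_of_nonneg (integral_nonneg fun _ => norm_nonneg _)]
      simp only [mul_assoc (φ y), norm_mul (φ y)]
      rw [integral_const_mul]
      gcongr
      rw [← eLpNorm_translate hk.1 y]
      exact integral_mul_star_le (memLp_translate hk y) hψ

/-- Fubini moves the kernel onto `ψ`. Working with the adjoint is useful because it is bounded
pointwise for `k` and `ψ` in `L²`, and because it factorizes on tensors. -/
theorem integral_groupConv_mul_star (hφ : MemLp φ 1 μ) (hk : MemLp k 2 μ) (hψ : MemLp ψ 2 μ) :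
    ∫ x, groupConv μ φ k x * starRingEnd ℂ (ψ x) ∂μ = ∫ y, φ y * convAdjoint μ k ψ y ∂μ := by
  have h := integral_integral_swap (f := fun x y => φ y * k (y⁻¹ * x) * starRingEnd ℂ (ψ x))
    (integrable_prod_conv hφ hk hψ)
  simp only [groupConv, convAdjoint, ← integral_mul_const, ← integral_const_mul]
  rw [h]
  simp only [mul_assoc]

theorem norm_convAdjoint_le (hk : MemLp k 2 μ) (hψ : MemLp ψ 2 μ) (y : G) :
    ‖convAdjoint μ k ψ y‖ ≤ (eLpNorm k 2 μ).toReal * (eLpNorm ψ 2 μ).toReal := by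
  refine (norm_integral_le_integral_norm _).trans ?_
  rw [← eLpNorm_translate hk.1 y]
  exact integral_mul_star_le (memLp_translate hk y) hψ

theorem aestronglyMeasurable_convAdjoint (hk : MemLp k 2 μ) (hψ : MemLp ψ 2 μ) :
    AEStronglyMeasurable (convAdjoint μ k ψ) μ := by
  have hψ' : MemLp (fun x => starRingEnd ℂ (ψ x)) 2 μ := hψ.star
  have hm : AEStronglyMeasurable
      (fun p : G × G => k (p.2⁻¹ * p.1) * starRingEnd ℂ (ψ p.1)) (μ.prod μ) :=
    (aestronglyMeasurable_kernel hk.1).mul hψ'.1.comp_fst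
  exact hm.prod_swap.integral_prod_right'

theorem locallyIntegrable_convAdjoint [IsLocallyFiniteMeasure μ] (hk : MemLp k 2 μ)
    (hψ : MemLp ψ 2 μ) : LocallyIntegrable (convAdjoint μ k ψ) μ := by
  intro x
  obtain ⟨s, hs, hs'⟩ := μ.finiteAt_nhds x
  exact ⟨s, hs, Measure.integrableOn_of_bounded hs'.ne (aestronglyMeasurable_convAdjoint hk hψ)
    (Filter.Eventually.of_forall fun y => norm_convAdjoint_le hk hψ y)⟩

end Convolution

/-! ### Spectral representations -/

attribute [instance] SpectralRepresentation.measurableSpace SpectralRepresentation.sigmaFinite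

theorem memLp_two_bdd_mul {Ω : Type*} [MeasurableSpace Ω] {ρ : Measure Ω} {m f : Ω → ℂ}
    (hm : AEStronglyMeasurable m ρ) {C : ℝ} (hC : ∀ x, ‖m x‖ ≤ C) (hf : MemLp f 2 ρ) :
    MemLp (fun x => m x * f x) 2 ρ := by
  refine hf.of_le_mul (c := C) (hm.mul hf.1) (Filter.Eventually.of_forall fun x => ?_)
  rw [norm_mul]
  gcongr
  exact hC x

section SpectralRepresentation

variable {𝓗 : Type*} [NormedAddCommGroup 𝓗] [InnerProductSpace ℂ 𝓗] {T : Set (𝓗 × 𝓗)}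

/-- The symbol is real. -/
theorem SpectralRepresentation.inner_symm (R : SpectralRepresentation T) {u v u' v' : 𝓗} (h : (u, v) ∈ T) (h' : (u', v') ∈ T) :
    inner ℂ v u' = inner ℂ u v' := by
  rw [← R.U.inner_map_map, ← R.U.inner_map_map, L2.inner_def, L2.inner_def]
  refine integral_congr_ae ?_
  filter_upwards [(R.mem_iff u v).1 h, (R.mem_iff u' v').1 h'] with ξ h1 h2
  rw [h1, h2]
  simp
  ring

theorem SpectralRepresentation.exists_mem (R : SpectralRepresentation T) (f : Lp ℂ 2 R.ν)
    (hf : MemLp (fun ξ => (R.symbol ξ : ℂ) * f ξ) 2 R.ν) :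
    (R.U.symm f, R.U.symm (hf.toLp _)) ∈ T := by
  rw [R.mem_iff]
  simpa using hf.coeFn_toLp

/-- On the indicator of a set `E` the quadratic form equals the integral of the symbol over `E`. It
would be negative on any set of positive finite measure where the symbol is negative and bounded. -/
theorem SpectralRepresentation.symbol_nonneg (R : SpectralRepresentation T)
    (hT : ∀ u v : 𝓗, (u, v) ∈ T → 0 ≤ (inner ℂ u v).re) : ∀ᵐ ξ ∂(R.ν), 0 ≤ R.symbol ξ := by
  -- Truncation at level `N` and intersection with a set of finite measure put the indicator in the
  -- domain; these pieces exhaust the negative set.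
  have key : ∀ N : ℕ, R.ν ({ξ | R.symbol ξ < 0 ∧ -N ≤ R.symbol ξ} ∩ spanningSets R.ν N) = 0 := by
    intro N
    set E := {ξ | R.symbol ξ < 0 ∧ -N ≤ R.symbol ξ} ∩ spanningSets R.ν N
    have hE : MeasurableSet E :=
      ((measurableSet_lt R.measurable_symbol measurable_const).inter
        (measurableSet_le measurable_const R.measurable_symbol)).inter (measurableSet_spanningSets _ _)
    have hE' : R.ν E ≠ ⊤ :=
      measure_ne_top_of_subset Set.inter_subset_right (measure_spanningSets_lt_top _ _).ne
    have hind := indicatorConstLp_one_ae_eq hE hE'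
    have hbd : ∀ ξ ∈ E, ‖(R.symbol ξ : ℂ)‖ ≤ N := by
      rintro ξ ⟨⟨h1, h2⟩, -⟩
      rw [Complex.norm_real, Real.norm_eq_abs, abs_le]
      exact ⟨h2, h1.le.trans (Nat.cast_nonneg _)⟩
    have hm : MemLp (fun ξ => (R.symbol ξ : ℂ) * (indicatorConstLp 2 hE hE' (1 : ℂ)) ξ) 2 R.ν := by
      refine (Lp.memLp (indicatorConstLp 2 hE hE' (1 : ℂ))).of_le_mul (c := N)
        ((Complex.measurable_ofReal.comp R.measurable_symbol).aestronglyMeasurable.mul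
          (Lp.aestronglyMeasurable _)) ?_
      filter_upwards [hind] with ξ hξ
      rw [hξ, norm_mul]
      by_cases h : ξ ∈ E
      · gcongr
        exact hbd ξ h
      · simp [h]
    have h1 := hT _ _ (R.exists_mem _ hm)
    rw [R.U.symm.inner_map_map, L2.inner_def] at h1
    have h2 : ∫ ξ, inner ℂ ((indicatorConstLp 2 hE hE' (1 : ℂ)) ξ) (hm.toLp _ ξ) ∂(R.ν) =
        ((∫ ξ in E, R.symbol ξ ∂(R.ν) : ℝ) : ℂ) := by
      rw [← integral_complex_ofReal, ← integral_indicator hE]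
      refine integral_congr_ae ?_
      filter_upwards [hind, hm.coeFn_toLp] with ξ h3 h4
      rw [h4, h3]
      by_cases h : ξ ∈ E <;> simp [h]
    rw [h2, Complex.ofReal_re] at h1
    have hint : IntegrableOn (fun ξ => -R.symbol ξ) E R.ν :=
      Measure.integrableOn_of_bounded (M := N) hE' R.measurable_symbol.neg.aestronglyMeasurable
        ((ae_restrict_iff' hE).2 (Filter.Eventually.of_forall fun ξ hξ => by
          simpa using hbd ξ hξ))
    have h0 : 0 ≤ᵐ[R.ν.restrict E] fun ξ => -R.symbol ξ :=
      (ae_restrict_iff' hE).2 (Filter.Eventually.of_forall fun ξ hξ => by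
        simpa using hξ.1.1.le)
    have h5 : ∫ ξ in E, -R.symbol ξ ∂(R.ν) = 0 := by
      refine le_antisymm ?_ (integral_nonneg_of_ae h0)
      rw [integral_neg]
      linarith
    rw [setIntegral_eq_zero_iff_of_nonneg_ae h0 hint] at h5
    have h6 : ∀ᵐ ξ ∂(R.ν), ξ ∉ E := by
      filter_upwards [(ae_restrict_iff' hE).1 h5] with ξ h7 h8
      have h9 := h7 h8
      have := h8.1.1
      simp at h9
      linarith
    simpa [ae_iff] using h6
  have : ∀ᵐ ξ ∂(R.ν), ∀ N : ℕ, ξ ∉ {ξ | R.symbol ξ < 0 ∧ -N ≤ R.symbol ξ} ∩ spanningSets R.ν N :=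
    ae_all_iff.2 fun N => measure_eq_zero_iff_ae_notMem.1 (key N)
  filter_upwards [this] with ξ hξ
  by_contra h
  rw [not_le] at h
  obtain ⟨N, hN⟩ := exists_nat_ge (-R.symbol ξ)
  refine hξ (max N (spanningSetsIndex R.ν ξ)) ⟨⟨h, ?_⟩,
    monotone_spanningSets R.ν (le_max_right _ _) (mem_spanningSetsIndex R.ν ξ)⟩
  have : (N : ℝ) ≤ ((max N (spanningSetsIndex R.ν ξ) : ℕ) : ℝ) := by exact_mod_cast le_max_left _ _
  linarith

end SpectralRepresentation

/-! ### Sublaplacians on a single group -/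

section SingleGroup

variable {E H : Type*} [NormedAddCommGroup E] [NormedSpace ℝ E] [TopologicalSpace H]
  {I : ModelWithCorners ℝ E H} {G : Type*} [TopologicalSpace G] [ChartedSpace H G]

theorem IsTestFunction.continuous {φ : G → ℂ} (hφ : IsTestFunction I φ) : Continuous φ :=
  hφ.1.continuous

theorem IsTestFunction.conj {φ : G → ℂ} (hφ : IsTestFunction I φ) :
    IsTestFunction I (fun x => starRingEnd ℂ (φ x)) := by
  refine ⟨Complex.conjCLE.toContinuousLinearMap.contMDiff.comp hφ.1, ?_⟩
  exact hφ.2.comp_left (g := starRingEnd ℂ) (map_zero _)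

theorem contMDiff_mul_complex {φ ψ : G → ℂ} (hφ : ContMDiff I 𝓘(ℝ, ℂ) ∞ φ)
    (hψ : ContMDiff I 𝓘(ℝ, ℂ) ∞ ψ) : ContMDiff I 𝓘(ℝ, ℂ) ∞ (fun x => φ x * ψ x) :=
  (contDiff_mul (𝕜 := ℝ) (𝔸 := ℂ)).contMDiff.comp (hφ.prodMk_space hψ)

theorem IsTestFunction.mul {φ ψ : G → ℂ} (hφ : IsTestFunction I φ) (hψ : IsTestFunction I ψ) :
    IsTestFunction I (fun x => φ x * ψ x) :=
  ⟨contMDiff_mul_complex hφ.1 hψ.1, hφ.2.mul_right⟩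

theorem IsTestFunction.ofReal {g : G → ℝ} (hg : ContMDiff I 𝓘(ℝ, ℝ) ∞ g) (hg' : HasCompactSupport g) :
    IsTestFunction I (fun x => (g x : ℂ)) :=
  ⟨Complex.ofRealCLM.contMDiff.comp hg, hg'.comp_left (g := fun r : ℝ => (r : ℂ)) Complex.ofReal_zero⟩

section Group

variable [Group G] [LieGroup I ∞ G]

theorem smoothRightAction_id : SmoothRightAction I I (MonoidHom.id G) := contMDiff_mul I ∞

theorem sumOfSquares_eq_along {κ : Type*} [Fintype κ] (X : κ → GroupLieAlgebra I G) {φ : G → ℂ}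
    (hφ : ContMDiff I 𝓘(ℝ, ℂ) ∞ φ) :
    sumOfSquares I X φ = alongSumOfSquares I (MonoidHom.id G) X φ := by
  rw [← pushforwardOperator_sumOfSquares smoothRightAction_id hφ X]
  ext x
  have := sumOfSquares_translate smoothRightAction_id hφ X x 1
  have h2 := sumOfSquares_translate smoothRightAction_id hφ X 1 x
  rw [pushforwardOperator, this]
  simpa using h2

theorem IsTestFunction.sumOfSquares {κ : Type*} [Fintype κ] (X : κ → GroupLieAlgebra I G)
    {φ : G → ℂ} (hφ : IsTestFunction I φ) : IsTestFunction I (sumOfSquares I X φ) := by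
  rw [sumOfSquares_eq_along X hφ.1]
  exact hφ.alongSumOfSquares smoothRightAction_id X

end Group

variable [FiniteDimensional ℝ E] [T2Space G] [MeasurableSpace G] [BorelSpace G] {μ : Measure G}
  [SigmaCompactSpace G]

theorem IsTestFunction.memLp [IsFiniteMeasureOnCompacts μ] {φ : G → ℂ} (hφ : IsTestFunction I φ)
    (p : ℝ≥0∞) : MemLp φ p μ :=
  hφ.continuous.memLp_of_hasCompactSupport hφ.2

theorem ae_eq_zero_of_forall_isTestFunction (I : ModelWithCorners ℝ E H) [IsManifold I ∞ G]
    {f : G → ℂ} (hf : LocallyIntegrable f μ)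
    (h : ∀ φ, IsTestFunction I φ → ∫ x, φ x * f x ∂μ = 0) : f =ᵐ[μ] 0 := by
  refine ae_eq_zero_of_integral_contMDiff_smul_eq_zero I hf fun g hg hg' => ?_
  simpa using h _ (IsTestFunction.ofReal hg hg')

theorem MeasureTheory.MemLp.locallyIntegrable_two [IsLocallyFiniteMeasure μ] {f : G → ℂ}
    (hf : MemLp f 2 μ) : LocallyIntegrable f μ :=
  hf.locallyIntegrable (by norm_num)

theorem eq_zero_of_forall_isTestFunction (I : ModelWithCorners ℝ E H) [IsManifold I ∞ G]
    [IsLocallyFiniteMeasure μ] {f : Lp ℂ 2 μ}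
    (h : ∀ φ, IsTestFunction I φ → ∫ x, φ x * f x ∂μ = 0) : f = 0 := by
  apply Lp.ext
  exact (ae_eq_zero_of_forall_isTestFunction I (Lp.memLp f).locallyIntegrable_two h).trans
    (Lp.coeFn_zero ℂ 2 _).symm

theorem exists_isTestFunction_eq_one (I : ModelWithCorners ℝ E H) [IsManifold I ∞ G]
    {K : Set G} (hK : IsCompact K) :
    ∃ ψ : G → ℂ, IsTestFunction I ψ ∧ ∀ x ∈ K, ψ =ᶠ[nhds x] fun _ => 1 := by
  haveI : LocallyCompactSpace H := I.locallyCompactSpace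
  haveI : LocallyCompactSpace G := ChartedSpace.locallyCompactSpace H G
  obtain ⟨K', hK', hKK'⟩ := exists_compact_superset hK
  obtain ⟨f, hf1, hf0, -⟩ := exists_contMDiffMap_one_nhds_of_subset_interior I (n := (⊤ : ℕ∞))
    hK.isClosed hKK'
  refine ⟨fun x => (f x : ℂ), IsTestFunction.ofReal f.contMDiff
    (HasCompactSupport.intro hK' hf0), fun x hx => ?_⟩
  filter_upwards [(eventually_nhdsSet_iff_forall.1 hf1) x hx] with y hy
  simp [hy]

variable [Group G] [LieGroup I ∞ G]

theorem toLp_mem_closureGraph [IsFiniteMeasureOnCompacts μ] {κ : Type*} [Fintype κ]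
    (X : κ → GroupLieAlgebra I G) {φ : G → ℂ} (hφ : IsTestFunction I φ) :
    ((hφ.memLp (μ := μ) 2).toLp φ, ((hφ.sumOfSquares X).memLp (μ := μ) 2).toLp (_root_.sumOfSquares I X φ)) ∈
      closureGraph I μ (_root_.sumOfSquares I X) :=
  subset_closure ⟨φ, hφ, (hφ.memLp 2).coeFn_toLp, ((hφ.sumOfSquares X).memLp 2).coeFn_toLp⟩

theorem inner_toLp {Ω : Type*} [MeasurableSpace Ω] {ρ : Measure Ω} {f g : Ω → ℂ}
    (hf : MemLp f 2 ρ) (hg : MemLp g 2 ρ) :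
    inner ℂ (hf.toLp f) (hg.toLp g) = ∫ x, starRingEnd ℂ (f x) * g x ∂ρ := by
  rw [L2.inner_def]
  refine integral_congr_ae ?_
  filter_upwards [hf.coeFn_toLp, hg.coeFn_toLp] with x h1 h2
  rw [h1, h2]
  simp [mul_comm]

/-- Symmetry against a test function `ψ` equal to 1 near the support of `φ`: there `Lψ` vanishes, so
`∫ Lφ = ⟨ψ, Lφ⟩ = ⟨Lψ, φ⟩ = 0`. The symmetry comes from the spectral representation, so no
integration by parts is needed. -/
theorem integral_sumOfSquares_eq_zero [IsFiniteMeasureOnCompacts μ] {κ : Type*} [Fintype κ]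
    (X : κ → GroupLieAlgebra I G)
    (R : SpectralRepresentation (closureGraph I μ (sumOfSquares I X))) {φ : G → ℂ}
    (hφ : IsTestFunction I φ) : ∫ x, sumOfSquares I X φ x ∂μ = 0 := by
  obtain ⟨ψ, hψ, hψ1⟩ := exists_isTestFunction_eq_one I hφ.2
  have h := R.inner_symm (toLp_mem_closureGraph X hψ) (toLp_mem_closureGraph X hφ)
  simp only [inner_toLp] at h
  have h1 : ∀ x, starRingEnd ℂ (sumOfSquares I X ψ x) * φ x = 0 := by
    intro x
    by_cases hx : x ∈ tsupport φ
    · rw [sumOfSquares_eq_along X hψ.1, alongSumOfSquares_congr smoothRightAction_id X (hψ1 x hx),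
        alongSumOfSquares_const]
      simp
    · simp [image_eq_zero_of_notMem_tsupport hx]
  have h2 : ∀ x, starRingEnd ℂ (ψ x) * sumOfSquares I X φ x = sumOfSquares I X φ x := by
    intro x
    by_cases hx : x ∈ tsupport φ
    · simp [(hψ1 x hx).eq_of_nhds]
    · rw [sumOfSquares_eq_along X hφ.1,
        alongSumOfSquares_eq_zero_of_notMem smoothRightAction_id X hx, mul_zero]
  simp only [h1, h2, integral_zero] at h
  exact h.symm

theorem alongDeriv_conj {v : GroupLieAlgebra I G} {φ : G → ℂ} (hφ : ContMDiff I 𝓘(ℝ, ℂ) ∞ φ) (x : G) :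
    alongDeriv I (MonoidHom.id G) v (fun x => starRingEnd ℂ (φ x)) x =
      starRingEnd ℂ (alongDeriv I (MonoidHom.id G) v φ x) :=
  alongDeriv_comp_clm smoothRightAction_id hφ Complex.conjCLE.toContinuousLinearMap x

/-- The product rule gives `Re (φ̄ Lφ) = ½ L|φ|² + ∑ |Xₗφ|²`. -/
theorem re_conj_mul_sumOfSquares_ge {κ : Type*} [Fintype κ] (X : κ → GroupLieAlgebra I G)
    {φ : G → ℂ} (hφ : ContMDiff I 𝓘(ℝ, ℂ) ∞ φ) (x : G) :
    (sumOfSquares I X (fun x => starRingEnd ℂ (φ x) * φ x) x).re / 2 ≤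
      (starRingEnd ℂ (φ x) * sumOfSquares I X φ x).re := by
  have hc : ContMDiff I 𝓘(ℝ, ℂ) ∞ (fun x => starRingEnd ℂ (φ x)) :=
    Complex.conjCLE.toContinuousLinearMap.contMDiff.comp hφ
  rw [sumOfSquares_eq_along X (contMDiff_mul_complex hc hφ), sumOfSquares_eq_along X hφ]
  simp only [alongSumOfSquares]
  have hi := smoothRightAction_id (I := I) (G := G)
  have key : ∀ l, alongDeriv I (MonoidHom.id G) (X l) (alongDeriv I (MonoidHom.id G) (X l)
      (fun x => starRingEnd ℂ (φ x) * φ x)) x =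
      starRingEnd ℂ (alongDeriv I (MonoidHom.id G) (X l) (alongDeriv I (MonoidHom.id G) (X l) φ) x) * φ x
      + 2 * (starRingEnd ℂ (alongDeriv I (MonoidHom.id G) (X l) φ x) * alongDeriv I (MonoidHom.id G) (X l) φ x)
      + starRingEnd ℂ (φ x) * alongDeriv I (MonoidHom.id G) (X l) (alongDeriv I (MonoidHom.id G) (X l) φ) x := by
    intro l
    have hd := contMDiff_alongDeriv (v := X l) hi hφ
    have hdc : ContMDiff I 𝓘(ℝ, ℂ) ∞ (fun x => starRingEnd ℂ (alongDeriv I (MonoidHom.id G) (X l) φ x)) :=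
      Complex.conjCLE.toContinuousLinearMap.contMDiff.comp hd
    have h1 : alongDeriv I (MonoidHom.id G) (X l) (fun x => starRingEnd ℂ (φ x) * φ x) =
        fun x => starRingEnd ℂ (alongDeriv I (MonoidHom.id G) (X l) φ x) * φ x +
          starRingEnd ℂ (φ x) * alongDeriv I (MonoidHom.id G) (X l) φ x := by
      ext y
      rw [alongDeriv_mul hi hc hφ, alongDeriv_conj hφ]
    rw [h1, alongDeriv_add hi (contMDiff_mul_complex hdc hφ) (contMDiff_mul_complex hc hd), alongDeriv_mul hi hdc hφ,
      alongDeriv_mul hi hc hd, alongDeriv_conj hφ, alongDeriv_conj hd]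
    ring
  simp only [key, Finset.sum_add_distrib, ← Finset.mul_sum, ← Finset.sum_mul, ← map_sum]
  set A := ∑ l, alongDeriv I (MonoidHom.id G) (X l) (alongDeriv I (MonoidHom.id G) (X l) φ) x
  have hB : 0 ≤ (∑ l, starRingEnd ℂ (alongDeriv I (MonoidHom.id G) (X l) φ x) * alongDeriv I (MonoidHom.id G) (X l) φ x).re := by
    rw [Complex.re_sum]
    refine Finset.sum_nonneg fun l _ => ?_
    rw [Complex.conj_mul']
    norm_cast
    positivity
  set B := ∑ l, starRingEnd ℂ (alongDeriv I (MonoidHom.id G) (X l) φ x) * alongDeriv I (MonoidHom.id G) (X l) φ x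
  simp
  linarith

/-- On test functions the pointwise inequality is integrated, and `∫ L|φ|² = 0`. Positivity of the
form is a closed condition, so it passes to the closure. -/
theorem re_inner_closureGraph_nonneg [IsFiniteMeasureOnCompacts μ] {κ : Type*} [Fintype κ]
    (X : κ → GroupLieAlgebra I G)
    (R : SpectralRepresentation (closureGraph I μ (sumOfSquares I X))) {u v : Lp ℂ 2 μ}
    (h : (u, v) ∈ closureGraph I μ (sumOfSquares I X)) : 0 ≤ (inner ℂ u v).re := by
  have hcl : IsClosed {p : Lp ℂ 2 μ × Lp ℂ 2 μ | 0 ≤ (inner ℂ p.1 p.2).re} :=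
    isClosed_le continuous_const (Complex.continuous_re.comp (continuous_fst.inner continuous_snd))
  refine closure_minimal ?_ hcl h
  rintro ⟨u, v⟩ ⟨φ, hφ, hu, hv⟩
  have hL := hφ.sumOfSquares X
  have hm := hφ.conj.mul hφ
  have h0 := integral_sumOfSquares_eq_zero X R hm
  have hint : Integrable (fun x => starRingEnd ℂ (φ x) * sumOfSquares I X φ x) μ :=
    memLp_one_iff_integrable.1 ((hφ.conj.mul hL).memLp 1)
  have hint2 : Integrable (sumOfSquares I X (fun x => starRingEnd ℂ (φ x) * φ x)) μ :=
    memLp_one_iff_integrable.1 ((hm.sumOfSquares X).memLp 1)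
  have h1 : inner ℂ u v = ∫ x, starRingEnd ℂ (φ x) * sumOfSquares I X φ x ∂μ := by
    rw [L2.inner_def]
    refine integral_congr_ae ?_
    filter_upwards [hu, hv] with x h1 h2
    rw [h1, h2]
    simp [mul_comm]
  change 0 ≤ (inner ℂ u v).re
  rw [h1, ← RCLike.re_eq_complex_re, ← integral_re hint]
  have h2 : ∫ x, (sumOfSquares I X (fun x => starRingEnd ℂ (φ x) * φ x) x).re / 2 ∂μ = 0 := by
    rw [integral_div]
    have := integral_re hint2
    rw [h0] at this
    simp only [map_zero, RCLike.re_eq_complex_re] at this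
    rw [this, zero_div]
  rw [← h2]
  exact integral_mono (hint2.re.div_const 2) hint.re fun x => re_conj_mul_sumOfSquares_ge X hφ.1 x

end SingleGroup

/-! ### Kernels of multipliers -/

section MultiplierKernel

variable {E H : Type*} [NormedAddCommGroup E] [NormedSpace ℝ E] [FiniteDimensional ℝ E]
  [TopologicalSpace H] {I : ModelWithCorners ℝ E H} {G : Type*} [TopologicalSpace G]
  [ChartedSpace H G] [Group G] [MeasurableSpace G] {μ : Measure G}
  {Ω : Type*} [MeasurableSpace Ω] {ν : Measure Ω} {U : Lp ℂ 2 μ ≃ₗᵢ[ℂ] Lp ℂ 2 ν}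

/-- `k` is the convolution kernel of the operator `U⁻¹ m U`. -/
def IsMultiplierKernel (I : ModelWithCorners ℝ E H) (U : Lp ℂ 2 μ ≃ₗᵢ[ℂ] Lp ℂ 2 ν) (m : Ω → ℂ)
    (k : G → ℂ) : Prop :=
  ∀ φ : G → ℂ, IsTestFunction I φ → ∃ u v : Lp ℂ 2 μ, u =ᵐ[μ] φ ∧
    (v =ᵐ[μ] fun x => ∫ y, φ y * k (y⁻¹ * x) ∂μ) ∧ U v =ᵐ[ν] fun ξ => m ξ * U u ξ

theorem isConvolutionKernel_iff {L : (G → ℂ) → (G → ℂ)}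
    {R : SpectralRepresentation (closureGraph I μ L)} {F : ℝ → ℂ} {k : G → ℂ} :
    IsConvolutionKernel I μ R F k ↔
      LocallyIntegrable k μ ∧ IsMultiplierKernel I R.U (fun ξ => F (R.symbol ξ)) k := Iff.rfl

theorem IsMultiplierKernel.apply_eq {m : Ω → ℂ} {k φ : G → ℂ} (h : IsMultiplierKernel I U m k)
    (hφ : IsTestFunction I φ) {u v : Lp ℂ 2 μ} (hu : u =ᵐ[μ] φ) (hv : v =ᵐ[μ] groupConv μ φ k) :
    U v =ᵐ[ν] fun ξ => m ξ * U u ξ := by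
  obtain ⟨u', v', hu', hv', h'⟩ := h φ hφ
  obtain rfl : u = u' := Lp.ext (hu.trans hu'.symm)
  obtain rfl : v = v' := Lp.ext (hv.trans hv'.symm)
  exact h'

variable [T2Space G] [SigmaCompactSpace G] [LocallyCompactSpace G] [IsTopologicalGroup G] [SecondCountableTopology G] [BorelSpace G] [SigmaFinite μ]
  [μ.IsMulLeftInvariant] [IsFiniteMeasureOnCompacts μ]

theorem IsMultiplierKernel.congr {m : Ω → ℂ} {k k' : G → ℂ} (h : IsMultiplierKernel I U m k)
    (hk : k =ᵐ[μ] k') : IsMultiplierKernel I U m k' := by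
  intro φ hφ
  obtain ⟨u, v, hu, hv, h'⟩ := h φ hφ
  exact ⟨u, v, hu, hv.trans (groupConv_congr hk φ), h'⟩

theorem IsMultiplierKernel.sum {κ : Type*} (s : Finset κ) (c : κ → ℂ) {m : κ → Ω → ℂ}
    {k : κ → G → ℂ} (hk : ∀ j, MemLp (k j) 2 μ) (h : ∀ j, IsMultiplierKernel I U (m j) (k j)) :
    IsMultiplierKernel I U (fun ξ => ∑ j ∈ s, c j * m j ξ) (fun x => ∑ j ∈ s, c j * k j x) := by
  intro φ hφ
  have hφ1 := hφ.memLp (μ := μ) 1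
  refine ⟨(hφ.memLp (μ := μ) 2).toLp φ, ∑ j ∈ s, c j • (memLp_groupConv hφ1 (hk j)).toLp _,
    MemLp.coeFn_toLp _, ?_, ?_⟩
  · refine Filter.EventuallyEq.trans ?_ (groupConv_sum hφ1 s c hk).symm
    have h1 := Lp.coeFn_finsetSum s fun j => c j • (memLp_groupConv hφ1 (hk j)).toLp _
    have h2 : ∀ᵐ x ∂μ, ∀ j ∈ s, (c j • (memLp_groupConv hφ1 (hk j)).toLp _ : Lp ℂ 2 μ) x =
        c j * groupConv μ φ (k j) x :=
      (Filter.eventually_all_finset s).2 fun j _ => by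
        filter_upwards [Lp.coeFn_smul (c j) ((memLp_groupConv hφ1 (hk j)).toLp _),
          (memLp_groupConv hφ1 (hk j)).coeFn_toLp] with x h3 h4
        rw [h3, Pi.smul_apply, h4, smul_eq_mul]
    filter_upwards [h1, h2] with x h3 h4
    rw [h3, Finset.sum_apply]
    exact Finset.sum_congr rfl h4
  · rw [map_sum]
    have h1 := Lp.coeFn_finsetSum s fun j => U (c j • (memLp_groupConv hφ1 (hk j)).toLp _)
    have h2 : ∀ᵐ ξ ∂ν, ∀ j ∈ s, U (c j • (memLp_groupConv hφ1 (hk j)).toLp _) ξ =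
        c j * (m j ξ * U ((hφ.memLp (μ := μ) 2).toLp φ) ξ) :=
      (Filter.eventually_all_finset s).2 fun j _ => by
        rw [map_smul]
        filter_upwards [Lp.coeFn_smul (c j) (U ((memLp_groupConv hφ1 (hk j)).toLp _)),
          (h j).apply_eq hφ ((hφ.memLp 2).coeFn_toLp) (memLp_groupConv hφ1 (hk j)).coeFn_toLp]
          with x h3 h4
        rw [h3, Pi.smul_apply, h4, smul_eq_mul]
    filter_upwards [h1, h2] with x h3 h4
    rw [h3, Finset.sum_apply, Finset.sum_mul]
    exact Finset.sum_congr rfl fun j hj => by rw [h4 j hj, mul_assoc]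

/-- The substitution `x ↦ y * x` moves the dependence on `y` from the merely square-integrable `k`
to the continuous compactly supported `ψ`. -/
theorem continuous_convAdjoint {k ψ : G → ℂ} (hk : MemLp k 2 μ) (hψ : Continuous ψ)
    (hψ' : HasCompactSupport ψ) : Continuous (convAdjoint μ k ψ) := by
  have h1 : convAdjoint μ k ψ = fun y => ∫ x, ContinuousLinearMap.mul ℂ ℂ (k x)
      (starRingEnd ℂ (ψ (y * x))) ∂μ := by
    ext y
    rw [convAdjoint, ← integral_mul_left_eq_self _ y]
    simp
  rw [h1, continuous_iff_continuousAt]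
  intro y₀
  obtain ⟨s, hs, hs'⟩ := exists_compact_mem_nhds y₀
  -- For `y` in the compact neighbourhood `s`, all translates `ψ (y * ·)` are supported in this one
  -- compact set.
  have hK : IsCompact ((fun p : G × G => p.1⁻¹ * p.2) '' (s ×ˢ tsupport ψ)) :=
    (hs.prod hψ').image (by fun_prop)
  refine (continuousOn_integral_bilinear_of_locally_integrable_of_compact_support
    (ContinuousLinearMap.mul ℂ ℂ) (f := fun y x => starRingEnd ℂ (ψ (y * x))) (s := s) hK
    ?_ ?_ ?_).continuousAt hs'
  · refine Continuous.continuousOn ?_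
    exact Complex.continuous_conj.comp (hψ.comp continuous_mul)
  · intro y x hy hx
    have : y * x ∉ tsupport ψ := fun h => hx ⟨(y, y * x), ⟨hy, h⟩, by simp⟩
    simp [image_eq_zero_of_notMem_tsupport this]
  · have : IsFiniteMeasure (μ.restrict
        ((fun p : G × G => p.1⁻¹ * p.2) '' (s ×ˢ tsupport ψ))) := ⟨by
      rw [Measure.restrict_apply_univ]; exact hK.measure_lt_top⟩
    exact (hk.restrict _).integrable (by norm_num)

/-- If `φ * k = 0` for every test function `φ`, the adjoint of `k` on each test function vanishes
almost everywhere. Being continuous, it vanishes also at 1, where it is the pairing of `k` with the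
test function. -/
theorem IsMultiplierKernel.unique [IsManifold I ∞ G] [μ.IsOpenPosMeasure] {m : Ω → ℂ} {k k' : G → ℂ} (hk : MemLp k 2 μ) (hk' : MemLp k' 2 μ)
    (h : IsMultiplierKernel I U m k) (h' : IsMultiplierKernel I U m k') : k =ᵐ[μ] k' := by
  have hd : MemLp (fun x => k x - k' x) 2 μ := hk.sub hk'
  have h0 : ∀ φ, IsTestFunction I φ → groupConv μ φ (fun x => k x - k' x) =ᵐ[μ] 0 := by
    intro φ hφ
    have hφ1 := hφ.memLp (μ := μ) 1
    have e1 := h.apply_eq hφ (hφ.memLp 2).coeFn_toLp (memLp_groupConv hφ1 hk).coeFn_toLp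
    have e2 := h'.apply_eq hφ (hφ.memLp 2).coeFn_toLp (memLp_groupConv hφ1 hk').coeFn_toLp
    have e3 := U.injective (Lp.ext (e1.trans e2.symm))
    filter_upwards [groupConv_sub hφ1 hk hk', (memLp_groupConv hφ1 hk).coeFn_toLp,
      (memLp_groupConv hφ1 hk').coeFn_toLp] with x h1 h2 h3
    rw [h1, ← h2, ← h3, e3, sub_self]
    rfl
  have h1 : ∀ ψ, IsTestFunction I ψ → convAdjoint μ (fun x => k x - k' x) ψ = 0 := by
    intro ψ hψ
    have hc := continuous_convAdjoint hd hψ.1.continuous hψ.2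
    refine (Continuous.ae_eq_iff_eq μ hc continuous_const).1 ?_
    refine ae_eq_zero_of_forall_isTestFunction I (locallyIntegrable_convAdjoint hd (hψ.memLp 2))
      fun φ hφ => ?_
    rw [← integral_groupConv_mul_star (hφ.memLp 1) hd (hψ.memLp 2)]
    refine integral_eq_zero_of_ae ?_
    filter_upwards [h0 φ hφ] with x hx
    rw [hx]
    simp
  have h2 : (fun x => k x - k' x) =ᵐ[μ] 0 := by
    refine ae_eq_zero_of_forall_isTestFunction I hd.locallyIntegrable_two fun ψ hψ => ?_
    have := congrFun (h1 _ hψ.conj) 1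
    simp only [convAdjoint, inv_one, one_mul, Complex.conj_conj, Pi.zero_apply] at this
    simpa [mul_comm] using this
  filter_upwards [h2] with x hx
  exact sub_eq_zero.1 hx

/-- The action of a bounded multiplier on a spectral representation space. -/
theorem exists_multiplier_apply {m : Ω → ℂ} (hm : AEStronglyMeasurable m ν) {C : ℝ} (hC : ∀ ξ, ‖m ξ‖ ≤ C)
    (U : Lp ℂ 2 μ ≃ₗᵢ[ℂ] Lp ℂ 2 ν) (ψ : Lp ℂ 2 μ) :
    ∃ B : Lp ℂ 2 μ, U B =ᵐ[ν] fun ξ => m ξ * U ψ ξ := by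
  have h := memLp_two_bdd_mul hm hC (Lp.memLp (U ψ))
  exact ⟨U.symm (h.toLp _), by simpa using h.coeFn_toLp⟩

theorem inner_multiplier {m : Ω → ℂ} {ψ B u v : Lp ℂ 2 μ}
    (hB : U B =ᵐ[ν] fun ξ => starRingEnd ℂ (m ξ) * U ψ ξ) (hv : U v =ᵐ[ν] fun ξ => m ξ * U u ξ) :
    inner ℂ ψ v = inner ℂ B u := by
  rw [← U.inner_map_map, ← U.inner_map_map, L2.inner_def, L2.inner_def]
  refine integral_congr_ae ?_
  filter_upwards [hB, hv] with ξ h1 h2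
  rw [h1, h2]
  simp
  ring

/-- The adjoint of `m(L)` has multiplier `m̄`. The function `convAdjoint` is a priori only bounded,
not square-integrable, so the two sides are compared by pairing with test functions. -/
theorem IsMultiplierKernel.convAdjoint_eq [IsManifold I ∞ G] {m : Ω → ℂ} {k : G → ℂ}
    (hk : MemLp k 2 μ) (h : IsMultiplierKernel I U m k) {ψ B : Lp ℂ 2 μ}
    (hB : U B =ᵐ[ν] fun ξ => starRingEnd ℂ (m ξ) * U ψ ξ) :
    convAdjoint μ k ψ =ᵐ[μ] fun y => starRingEnd ℂ (B y) := by
  have hBc : MemLp (fun y => starRingEnd ℂ (B y)) 2 μ := (Lp.memLp B).star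
  have hloc := (locallyIntegrable_convAdjoint hk (Lp.memLp ψ)).sub hBc.locallyIntegrable_two
  have : (fun y => convAdjoint μ k ψ y - starRingEnd ℂ (B y)) =ᵐ[μ] 0 := by
    refine ae_eq_zero_of_forall_isTestFunction I hloc fun φ hφ => ?_
    have hφ1 := hφ.memLp (μ := μ) 1
    have e1 := inner_multiplier hB
      (h.apply_eq hφ (hφ.memLp 2).coeFn_toLp (memLp_groupConv hφ1 hk).coeFn_toLp)
    have e2 := integral_groupConv_mul_star hφ1 hk (Lp.memLp ψ)
    have e3 : inner ℂ ψ ((memLp_groupConv hφ1 hk).toLp _) =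
        ∫ x, groupConv μ φ k x * starRingEnd ℂ (ψ x) ∂μ := by
      rw [L2.inner_def]
      refine integral_congr_ae ?_
      filter_upwards [(memLp_groupConv hφ1 hk).coeFn_toLp] with x hx
      rw [hx]
      simp
    have e4 : inner ℂ B ((hφ.memLp (μ := μ) 2).toLp φ) = ∫ x, φ x * starRingEnd ℂ (B x) ∂μ := by
      rw [L2.inner_def]
      refine integral_congr_ae ?_
      filter_upwards [(hφ.memLp (μ := μ) 2).coeFn_toLp] with x hx
      rw [hx]
      simp
    have i1 : Integrable (fun y => φ y * convAdjoint μ k ψ y) μ := by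
      refine (memLp_one_iff_integrable.1 hφ1).mul_bdd
        (c := (eLpNorm k 2 μ).toReal * (eLpNorm ψ 2 μ).toReal) (aestronglyMeasurable_convAdjoint hk (Lp.memLp ψ)) ?_
      exact Filter.Eventually.of_forall fun y => norm_convAdjoint_le hk (Lp.memLp ψ) y
    have i2 : Integrable (fun y => φ y * starRingEnd ℂ (B y)) μ :=
      (hφ.memLp 2).integrable_mul hBc
    simp only [mul_sub]
    rw [integral_sub i1 i2, ← e2, ← e3, ← e4, e1, sub_self]
  filter_upwards [this] with x hx
  exact sub_eq_zero.1 hx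

/-- Converse of the previous lemma: it suffices to know the adjoint on a total family, because `φ *
k` and `m(L) φ` then have the same inner product with each member. For products the family consists
of the elementary tensors. -/
theorem multiplier_groupConv_of_convAdjoint {m : Ω → ℂ} (hm : AEStronglyMeasurable m ν) {C : ℝ}
    (hC : ∀ ξ, ‖m ξ‖ ≤ C) {k : G → ℂ} (hk : MemLp k 2 μ) {κ : Type*} (ψ B : κ → Lp ℂ 2 μ)
    (hψ : ∀ u : Lp ℂ 2 μ, (∀ a, inner ℂ (ψ a) u = 0) → u = 0)
    (hB : ∀ a, U (B a) =ᵐ[ν] fun ξ => starRingEnd ℂ (m ξ) * U (ψ a) ξ)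
    (h : ∀ a, convAdjoint μ k (ψ a) =ᵐ[μ] fun y => starRingEnd ℂ (B a y)) {φ : G → ℂ}
    (hφ1 : MemLp φ 1 μ) (hφ2 : MemLp φ 2 μ) :
    U ((memLp_groupConv hφ1 hk).toLp _) =ᵐ[ν] fun ξ => m ξ * U (hφ2.toLp φ) ξ := by
  obtain ⟨v, hv⟩ := exists_multiplier_apply hm hC U (hφ2.toLp φ)
  suffices (memLp_groupConv hφ1 hk).toLp _ = v by rw [this]; exact hv
  rw [← sub_eq_zero]
  refine hψ _ fun a => ?_
  have e4 : inner ℂ (B a) (hφ2.toLp φ) = ∫ x, φ x * starRingEnd ℂ (B a x) ∂μ := by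
    rw [L2.inner_def]
    refine integral_congr_ae ?_
    filter_upwards [hφ2.coeFn_toLp] with x hx
    rw [hx]
    simp
  have e3 : inner ℂ (ψ a) ((memLp_groupConv hφ1 hk).toLp _) =
      ∫ x, groupConv μ φ k x * starRingEnd ℂ (ψ a x) ∂μ := by
    rw [L2.inner_def]
    refine integral_congr_ae ?_
    filter_upwards [(memLp_groupConv hφ1 hk).coeFn_toLp] with x hx
    rw [hx]
    simp
  rw [inner_sub_right, inner_multiplier (hB a) hv, e3, e4,
    integral_groupConv_mul_star hφ1 hk (Lp.memLp _), sub_eq_zero]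
  refine integral_congr_ae ?_
  filter_upwards [h a] with x hx
  rw [hx]

/-- Applied to indicators of Lebesgue null sets, which are nontrivial Borel functions on the
spectral side. -/
theorem sobolevNorm_eq_zero_of_ae {s : ℝ} {F : ℝ → ℂ} (hF : F =ᵐ[volume] 0) :
    sobolevNorm s F = 0 := by
  have h : MemLp F 2 volume := (MemLp.zero (ε := ℂ)).ae_eq hF.symm
  rw [sobolevNorm, dif_pos h]
  have h0 : h.toLp F = 0 := by
    rw [Lp.eq_zero_iff_ae_eq_zero]
    exact h.coeFn_toLp.trans hF
  have h1 : (𝓕 (h.toLp F) : Lp ℂ 2 (volume : Measure ℝ)) = 0 := by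
    rw [h0]
    exact (Lp.fourierTransformₗᵢ ℝ ℂ).map_zero
  rw [h1, eLpNorm_congr_ae (g := 0), eLpNorm_zero]
  filter_upwards [Lp.coeFn_zero ℂ 2 (volume : Measure ℝ)] with ξ hξ
  rw [hξ]
  simp

theorem ae_eq_zero_of_weighted {w : G → ℝ} (hw : ∀ x, 1 ≤ w x) {k : G → ℂ}
    (hk : AEStronglyMeasurable k μ) (hwm : Measurable w)
    (h : eLpNorm (fun x => (w x : ℂ) * k x) 2 μ = 0) : k =ᵐ[μ] 0 := by
  rw [eLpNorm_eq_zero_iff (by fun_prop) (by norm_num)] at h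
  filter_upwards [h] with x hx
  have : (w x : ℂ) ≠ 0 := by
    have := hw x
    exact_mod_cast (by linarith : w x ≠ 0)
  simpa [this] using hx

/-- Under a weighted kernel estimate the spectral measure is absolutely continuous. -/
theorem measure_symbol_preimage_eq_zero [IsManifold I ∞ G] {L : (G → ℂ) → (G → ℂ)}
    (R : SpectralRepresentation (closureGraph I μ L)) {s : ℝ} {w : G → ℝ} (hwm : Measurable w)
    (hw : ∀ x, 1 ≤ w x)
    (h : ∀ K : Set ℝ, IsCompact K → ∃ C : ℝ≥0, ∀ F : ℝ → ℂ, Measurable F → tsupport F ⊆ K →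
      sobolevNorm s F < ⊤ → ∃ k : G → ℂ, IsConvolutionKernel I μ R F k ∧
        eLpNorm (fun x => (w x : ℂ) * k x) 2 μ ≤ C * sobolevNorm s F)
    {N : Set ℝ} (hN : MeasurableSet N) (hN0 : volume N = 0) : R.ν (R.symbol ⁻¹' N) = 0 := by
  have key : ∀ r : ℕ, R.ν (R.symbol ⁻¹' (N ∩ Metric.closedBall 0 r) ∩ spanningSets R.ν r) = 0 := by
    intro r
    set N' := N ∩ Metric.closedBall (0 : ℝ) r
    have hN' : MeasurableSet N' := hN.inter Metric.isClosed_closedBall.measurableSet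
    obtain ⟨C, hC⟩ := h (Metric.closedBall 0 r) (isCompact_closedBall _ _)
    -- The indicator of a null set has Sobolev norm zero, so the estimate forces its kernel to
    -- vanish, that is, the spectral projection of `N'` is zero.
    have hF0 : N'.indicator (1 : ℝ → ℂ) =ᵐ[volume] 0 :=
      indicator_meas_zero (measure_mono_null Set.inter_subset_left hN0)
    have hs0 := sobolevNorm_eq_zero_of_ae (s := s) hF0
    obtain ⟨k, hk, hk'⟩ := hC (N'.indicator 1) (measurable_one.indicator hN')
      (closure_minimal (Set.support_indicator_subset.trans Set.inter_subset_right)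
        Metric.isClosed_closedBall) (by rw [hs0]; exact ENNReal.zero_lt_top)
    rw [hs0, mul_zero, nonpos_iff_eq_zero] at hk'
    have hk0 : k =ᵐ[μ] 0 := ae_eq_zero_of_weighted hw hk.1.aestronglyMeasurable hwm hk'
    have hker := (isConvolutionKernel_iff.1 hk).2
    set A := R.symbol ⁻¹' N' ∩ spanningSets R.ν r
    have hA : MeasurableSet A := (R.measurable_symbol hN').inter (measurableSet_spanningSets _ _)
    have hA' : R.ν A ≠ ⊤ :=
      measure_ne_top_of_subset Set.inter_subset_right (measure_spanningSets_lt_top _ _).ne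
    have hind := indicatorConstLp_one_ae_eq hA hA'
    set η := indicatorConstLp 2 hA hA' (1 : ℂ) with hη
    -- Since the kernel is zero, `U φ` vanishes where the symbol lies in `N'`, for every test
    -- function `φ`. Thus `η`, supported there, is orthogonal to all test functions.
    have hu : R.U.symm η = 0 := by
      refine eq_zero_of_forall_isTestFunction I fun φ hφ => ?_
      have hz : ((0 : Lp ℂ 2 μ) : G → ℂ) =ᵐ[μ] groupConv μ (fun x => starRingEnd ℂ (φ x)) k := by
        refine (Lp.coeFn_zero ℂ 2 μ).trans ((groupConv_congr hk0 _).trans ?_).symm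
        exact Filter.Eventually.of_forall fun x => by simp [groupConv]
      have h1 := hker.apply_eq hφ.conj (hφ.conj.memLp 2).coeFn_toLp hz
      have h2 : inner ℂ ((hφ.conj.memLp (μ := μ) 2).toLp _) (R.U.symm η) =
          ∫ x, φ x * R.U.symm η x ∂μ := by
        rw [L2.inner_def]
        refine integral_congr_ae ?_
        filter_upwards [(hφ.conj.memLp (μ := μ) 2).coeFn_toLp] with x hx
        rw [hx]
        simp [mul_comm]
      rw [← h2, ← R.U.inner_map_map, R.U.apply_symm_apply, L2.inner_def]
      refine integral_eq_zero_of_ae ?_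
      rw [map_zero] at h1
      filter_upwards [h1, hind, Lp.coeFn_zero ℂ 2 R.ν] with ξ h3 h4 h5
      rw [h4]
      by_cases hξ : ξ ∈ A
      · have hξ' : R.symbol ξ ∈ N' := hξ.1
        rw [h5, Set.indicator_of_mem hξ'] at h3
        simp only [Pi.zero_apply, Pi.one_apply, one_mul] at h3
        rw [← h3]
        simp
      · simp [hξ]
    have hη0 : η = 0 := by simpa using hu
    have h3 : A.indicator (1 : R.carrier → ℂ) =ᵐ[R.ν] 0 := by
      refine hind.symm.trans ?_
      rw [hη0]
      exact Lp.coeFn_zero ℂ 2 R.ν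
    rw [Set.indicator_ae_eq_zero] at h3
    simpa [Function.support_one] using h3
  have : R.symbol ⁻¹' N ⊆ ⋃ r : ℕ, R.symbol ⁻¹' (N ∩ Metric.closedBall 0 r) ∩ spanningSets R.ν r := by
    intro ξ hξ
    obtain ⟨r, hr⟩ := exists_nat_ge |R.symbol ξ|
    refine Set.mem_iUnion.2 ⟨max r (spanningSetsIndex R.ν ξ), ⟨hξ, ?_⟩,
      monotone_spanningSets R.ν (le_max_right _ _) (mem_spanningSetsIndex R.ν ξ)⟩
    rw [mem_closedBall_zero_iff, Real.norm_eq_abs]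
    refine hr.trans ?_
    exact_mod_cast le_max_left _ _
  exact measure_mono_null this (measure_iUnion_null key)

end MultiplierKernel

/-! ### Sobolev norms and Fourier series -/

section Sobolev

/-- The weight `(1 + x²)^(s/2)`. -/
def bracket (s x : ℝ) : ℝ := (1 + x ^ 2) ^ (s / 2)

/-- The exponential `x ↦ exp (2πimx/P)`. -/
def fourierExp (P : ℝ) (m : ℤ) (x : ℝ) : ℂ :=
  Complex.exp (2 * Real.pi * Complex.I * m * x / P)

/-- The integrable majorant `(1 + x²)⁻¹`. -/
def majorant (x : ℝ) : ℝ≥0∞ := ENNReal.ofReal ((1 + x ^ 2)⁻¹)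

theorem bracket_pos (s x : ℝ) : 0 < bracket s x := Real.rpow_pos_of_pos (by positivity) _

theorem enorm_bracket (s x : ℝ) :
    ‖(((1 + x ^ 2) ^ (s / 2) : ℝ) : ℂ)‖ₑ = ENNReal.ofReal (bracket s x) := by
  change ‖((bracket s x : ℝ) : ℂ)‖ₑ = _
  rw [← ofReal_norm, Complex.norm_real, Real.norm_of_nonneg (bracket_pos s x).le]

theorem bracket_neg (s x : ℝ) : bracket s (-x) = bracket s x := by simp [bracket]

theorem measurable_bracket (s : ℝ) : Measurable (bracket s) := by
  unfold bracket; fun_prop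

theorem one_add_sq_add_le (a b : ℝ) : 1 + (a + b) ^ 2 ≤ 2 * (1 + a ^ 2) * (1 + b ^ 2) := by
  nlinarith [sq_nonneg (a - b), sq_nonneg (a * b)]

/-- Peetre's inequality; it moves the Sobolev weight between the frequency `ξ` and the lattice point
`m / P`. -/
theorem bracket_add_le {s : ℝ} (hs : 0 ≤ s) (a b : ℝ) :
    bracket s (a + b) ≤ 2 ^ (s / 2) * bracket s a * bracket s b := by
  simp only [bracket]
  rw [← Real.mul_rpow (by norm_num) (by positivity), ← Real.mul_rpow (by positivity) (by positivity)]
  exact Real.rpow_le_rpow (by positivity) (one_add_sq_add_le a b) (by positivity)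

theorem bracket_add_exponent (s t x : ℝ) : bracket (s + t) x = bracket s x * bracket t x := by
  simp only [bracket]
  rw [← Real.rpow_add (by positivity), add_div]

theorem prod_bracket {ι : Type*} (T : Finset ι) (s : ι → ℝ) (x : ℝ) :
    ∏ i ∈ T, bracket (s i) x = bracket (∑ i ∈ T, s i) x := by
  classical
  induction T using Finset.induction_on with
  | empty => simp [bracket]
  | insert i T hi ih => rw [Finset.prod_insert hi, Finset.sum_insert hi, ih, bracket_add_exponent]

theorem measurable_majorant : Measurable majorant := by
  unfold majorant; fun_prop

theorem lintegral_majorant_lt_top : ∫⁻ x, majorant x < ⊤ := by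
  have h := integrable_inv_one_add_sq
  have := h.2
  rw [hasFiniteIntegral_iff_ofReal (Filter.Eventually.of_forall fun x => by positivity)] at this
  exact this

theorem lintegral_majorant_sub (a : ℝ) : ∫⁻ x, majorant (x - a) = ∫⁻ x, majorant x :=
  lintegral_sub_right_eq_self majorant a

theorem majorant_le (a b : ℝ) :
    majorant (a + b) ≤ ENNReal.ofReal (2 * (1 + b ^ 2)) * majorant a := by
  rw [majorant, majorant, ← ENNReal.ofReal_mul (by positivity)]
  refine ENNReal.ofReal_le_ofReal ?_
  rw [inv_le_iff_one_le_mul₀ (by positivity)]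
  have h := one_add_sq_add_le (a + b) (-b)
  rw [show a + b + -b = a by ring, neg_sq] at h
  have : 2 * (1 + b ^ 2) * (1 + a ^ 2)⁻¹ * (1 + (a + b) ^ 2) =
    (2 * (1 + (a + b) ^ 2) * (1 + b ^ 2)) / (1 + a ^ 2) := by field_simp
  rw [this, le_div_iff₀ (by positivity)]
  linarith

/-- The uniform bound on lattice translates of the majorant is one of the two bounds of the Schur
test below; the other is the finiteness of its integral. -/
theorem exists_tsum_majorant_le {P : ℝ} (hP : 0 < P) :
    ∃ S : ℝ≥0, ∀ ξ : ℝ, ∑' m : ℤ, majorant (ξ - m / P) ≤ S := by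
  have hsum : Summable fun m : ℤ => (1 + ((m : ℝ) / P) ^ 2)⁻¹ := by
    have h := ((Real.summable_one_div_int_pow (p := 2)).2 (by norm_num)).mul_left (P ^ 2)
    refine Summable.of_norm_bounded_eventually (g := fun m : ℤ => P ^ 2 * (1 / (m : ℝ) ^ 2)) h ?_
    rw [Filter.eventually_cofinite]
    refine (Set.finite_singleton (0 : ℤ)).subset fun m hm => ?_
    by_contra h0
    refine hm ?_
    have hm0 : (m : ℝ) ≠ 0 := by exact_mod_cast h0
    rw [Real.norm_of_nonneg (by positivity), inv_le_iff_one_le_mul₀ (by positivity)]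
    have : P ^ 2 * (1 / (m : ℝ) ^ 2) * (1 + (m / P) ^ 2) = P ^ 2 / m ^ 2 + 1 := by
      field_simp
    rw [this]
    have : 0 ≤ P ^ 2 / (m : ℝ) ^ 2 := by positivity
    linarith
  have hfin : ∑' m : ℤ, majorant ((m : ℝ) / P) ≠ ⊤ := hsum.tsum_ofReal_ne_top
  set D := ENNReal.ofReal (2 * (1 + (1 / P) ^ 2)) with hD
  refine ⟨(D * ∑' m : ℤ, majorant ((m : ℝ) / P)).toNNReal, fun ξ => ?_⟩
  rw [ENNReal.coe_toNNReal (ENNReal.mul_ne_top ENNReal.ofReal_ne_top hfin)]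
  -- The point `m₀ / P` lies within `1 / P` below `ξ`. Reindexing by `m ↦ m₀ - m` compares the sum
  -- with the one at 0, at the cost of the factor `D`.
  set m₀ : ℤ := ⌊ξ * P⌋
  have e : ∑' m : ℤ, majorant ((m : ℝ) / P) = ∑' m : ℤ, majorant (((m₀ - m : ℤ) : ℝ) / P) :=
    ((Equiv.subLeft m₀).tsum_eq fun m : ℤ => majorant ((m : ℝ) / P)).symm
  rw [e, ← ENNReal.tsum_mul_left]
  refine ENNReal.tsum_le_tsum fun m => ?_
  have h := majorant_le (((m₀ - m : ℤ) : ℝ) / P) (ξ - m₀ / P)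
  rw [show ((m₀ - m : ℤ) : ℝ) / P + (ξ - m₀ / P) = ξ - m / P by push_cast; ring] at h
  refine h.trans ?_
  gcongr ?_ * _
  refine ENNReal.ofReal_le_ofReal ?_
  have h1 : ξ - m₀ / P = (ξ * P - m₀) / P := by field_simp
  have h2 : 0 ≤ ξ * P - m₀ := by have := Int.floor_le (ξ * P); linarith
  have h3 : ξ * P - m₀ ≤ 1 := by have := (Int.lt_floor_add_one (ξ * P)).le; linarith
  rw [h1]
  gcongr

open SchwartzMap in
theorem exists_schwartz_decay (f : 𝓢(ℝ, ℂ)) (s : ℝ) :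
    ∃ A : ℝ≥0, ∀ x, ENNReal.ofReal (bracket s x) * ‖f x‖ₑ ≤ A * majorant x := by
  obtain ⟨k, hk⟩ := exists_nat_ge (s / 2 + 1)
  set C := 2 ^ (2 * k) * ((Finset.Iic (2 * k, 0)).sup fun m => SchwartzMap.seminorm ℝ m.1 m.2) f
  have hC : ∀ x : ℝ, (1 + ‖x‖) ^ (2 * k) * ‖f x‖ ≤ C := by
    intro x
    have := SchwartzMap.one_add_le_sup_seminorm_apply (𝕜 := ℝ) (m := (2 * k, 0)) (k := 2 * k) (n := 0)
      le_rfl le_rfl f x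
    simpa using this
  have hC0 : 0 ≤ C := (by positivity : (0 : ℝ) ≤ _).trans (hC 0)
  refine ⟨C.toNNReal, fun x => ?_⟩
  have h1 : bracket s x * ‖f x‖ ≤ C * (1 + x ^ 2)⁻¹ := by
    rw [← div_eq_mul_inv, le_div_iff₀ (by positivity)]
    refine le_trans ?_ (hC x)
    have h2 : bracket s x * (1 + x ^ 2) ≤ (1 + ‖x‖) ^ (2 * k) := by
      have h3 : bracket s x * (1 + x ^ 2) = (1 + x ^ 2) ^ (s / 2 + 1) := by
        rw [bracket, Real.rpow_add (by positivity), Real.rpow_one]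
      rw [h3]
      calc (1 + x ^ 2) ^ (s / 2 + 1) ≤ (1 + x ^ 2) ^ (k : ℝ) :=
            Real.rpow_le_rpow_of_exponent_le (by nlinarith [sq_nonneg x]) hk
        _ = (1 + x ^ 2) ^ k := Real.rpow_natCast _ _
        _ ≤ ((1 + ‖x‖) ^ 2) ^ k := by
            gcongr
            have : ‖x‖ ^ 2 = x ^ 2 := by simp
            nlinarith [norm_nonneg x]
        _ = _ := by rw [← pow_mul]
    calc bracket s x * ‖f x‖ * (1 + x ^ 2) = bracket s x * (1 + x ^ 2) * ‖f x‖ := by ring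
      _ ≤ _ := by gcongr
  have h2 : (C.toNNReal : ℝ≥0∞) = ENNReal.ofReal C := rfl
  rw [h2, majorant, ← ENNReal.ofReal_mul hC0, ← ofReal_norm,
    ← ENNReal.ofReal_mul (bracket_pos s x).le]
  exact ENNReal.ofReal_le_ofReal h1

theorem contDiff_fourierExp (P : ℝ) (m : ℤ) : ContDiff ℝ ∞ (fourierExp P m) := by
  unfold fourierExp
  have : ContDiff ℝ ∞ (fun x : ℝ => (x : ℂ)) := Complex.ofRealCLM.contDiff
  fun_prop

theorem norm_fourierExp (P : ℝ) (m : ℤ) (x : ℝ) : ‖fourierExp P m x‖ = 1 := by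
  have : (2 * Real.pi * Complex.I * m * x / P : ℂ) = ((2 * Real.pi * m * x / P : ℝ) : ℂ) * Complex.I := by
    push_cast; ring
  rw [fourierExp, this, Complex.norm_exp_ofReal_mul_I]

theorem fourierExp_add (P : ℝ) (m : ℤ) (x y : ℝ) :
    fourierExp P m (x + y) = fourierExp P m x * fourierExp P m y := by
  rw [fourierExp, fourierExp, fourierExp, ← Complex.exp_add]
  congr 1
  push_cast
  ring

theorem fourierExp_sum (P : ℝ) (m : ℤ) {ι : Type*} (T : Finset ι) (x : ι → ℝ) :
    fourierExp P m (∑ i ∈ T, x i) = ∏ i ∈ T, fourierExp P m (x i) := by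
  classical
  induction T using Finset.induction_on with
  | empty => simp [fourierExp]
  | insert i T hi ih => rw [Finset.prod_insert hi, Finset.sum_insert hi, fourierExp_add, ih]

theorem conj_fourierExp (P : ℝ) (m : ℤ) (x : ℝ) :
    starRingEnd ℂ (fourierExp P m x) = fourierExp P (-m) x := by
  rw [fourierExp, fourierExp, ← Complex.exp_conj]
  congr 1
  simp [map_ofNat]

variable {χ : ℝ → ℂ}

/-- The Schwartz function `x ↦ exp (2πimx/P) χ(x)`. -/
def modulated (hχ : ContDiff ℝ ∞ χ) (hχ' : HasCompactSupport χ) (P : ℝ) (m : ℤ) :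
    SchwartzMap ℝ ℂ :=
  HasCompactSupport.toSchwartzMap (f := fun x => fourierExp P m x * χ x) hχ'.mul_left
    ((contDiff_fourierExp P m).mul hχ)

theorem modulated_apply (hχ : ContDiff ℝ ∞ χ) (hχ' : HasCompactSupport χ) (P : ℝ) (m : ℤ) (x : ℝ) :
    modulated hχ hχ' P m x = fourierExp P m x * χ x := rfl

open SchwartzMap in
theorem fourier_modulated (hχ : ContDiff ℝ ∞ χ) (hχ' : HasCompactSupport χ) (P : ℝ) (m : ℤ) (ξ : ℝ) :
    (𝓕 (modulated hχ hχ' P m)) ξ = (𝓕 (hχ'.toSchwartzMap hχ)) (ξ - m / P) := by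
  rw [SchwartzMap.fourier_coe, SchwartzMap.fourier_coe, Real.fourier_real_eq_integral_exp_smul,
    Real.fourier_real_eq_integral_exp_smul]
  refine integral_congr_ae (Filter.Eventually.of_forall fun x => ?_)
  simp only [modulated_apply, fourierExp, smul_eq_mul]
  rw [← mul_assoc, ← Complex.exp_add]
  have : (hχ'.toSchwartzMap hχ) x = χ x := rfl
  rw [this]
  congr 2
  push_cast
  ring

open SchwartzMap in
theorem sobolevNorm_schwartz_sq (s : ℝ) (f : 𝓢(ℝ, ℂ)) :
    sobolevNorm s f ^ 2 = ∫⁻ ξ, (ENNReal.ofReal (bracket s ξ) * ‖(𝓕 f) ξ‖ₑ) ^ 2 := by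
  have hf : MemLp f 2 volume := f.memLp 2 volume
  rw [sobolevNorm, dif_pos hf, eLpNorm_two_sq]
  have h : 𝓕 (hf.toLp f) = (𝓕 f).toLp 2 := SchwartzMap.toLp_fourier_eq f
  rw [h]
  refine lintegral_congr_ae ?_
  filter_upwards [(𝓕 f).coeFn_toLp 2] with ξ hξ
  rw [hξ, enorm_mul]
  congr 2
  exact enorm_bracket s ξ

/-- Peetre's inequality replaces the weight at `ξ` by the weight at `m / P` times one at `ξ - m /
P`, and the decay of `h` absorbs the latter. -/
theorem bracket_mul_enorm_sum_le {s P : ℝ} (hs : 0 ≤ s) {h : ℝ → ℂ} {A : ℝ≥0∞}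
    (hA : ∀ x, ENNReal.ofReal (bracket s x) * ‖h x‖ₑ ≤ A * majorant x)
    (T : Finset ℤ) (b : ℤ → ℂ) (ξ : ℝ) :
    ENNReal.ofReal (bracket s ξ) * ‖∑ m ∈ T, b m * h (ξ - m / P)‖ₑ ≤
      ENNReal.ofReal (2 ^ (s / 2)) * A * ∑ m ∈ T, majorant (ξ - m / P) *
        (‖b m‖ₑ * ENNReal.ofReal (bracket s (m / P))) := by
  refine (mul_le_mul_right (enorm_sum_le _ _) _).trans ?_
  rw [Finset.mul_sum, Finset.mul_sum]
  refine Finset.sum_le_sum fun m _ => ?_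
  have h2 := bracket_add_le hs (m / P) (ξ - m / P)
  rw [add_sub_cancel] at h2
  have h3 := ENNReal.ofReal_le_ofReal h2
  rw [ENNReal.ofReal_mul (by have := bracket_pos s (m / P); positivity),
    ENNReal.ofReal_mul (by positivity)] at h3
  refine (mul_le_mul_left h3 _).trans ?_
  rw [enorm_mul]
  calc _ = ENNReal.ofReal (2 ^ (s / 2)) * (‖b m‖ₑ * ENNReal.ofReal (bracket s (m / P))) *
        (ENNReal.ofReal (bracket s (ξ - m / P)) * ‖h (ξ - m / P)‖ₑ) := by ring
    _ ≤ ENNReal.ofReal (2 ^ (s / 2)) * (‖b m‖ₑ * ENNReal.ofReal (bracket s (m / P))) *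
        (A * majorant (ξ - m / P)) := mul_le_mul_right (hA _) _
    _ = _ := by ring

/-- The integral inequality for a finite sum of Dirac masses. -/
theorem sum_mul_sq_le {α : Type*} (T : Finset α) (f g : α → ℝ≥0∞) :
    (∑ m ∈ T, f m * g m) ^ 2 ≤ (∑ m ∈ T, f m) * ∑ m ∈ T, f m * g m ^ 2 := by
  letI : MeasurableSpace α := ⊤
  have h := lintegral_mul_sq_le (ρ := ∑ m ∈ T, Measure.dirac m) (f := f) (g := g)
    measurable_from_top.aemeasurable measurable_from_top.aemeasurable
  simpa [lintegral_finsetSum_measure] using h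

open SchwartzMap in
theorem fourier_sum_modulated (hχ : ContDiff ℝ ∞ χ) (hχ' : HasCompactSupport χ) (P : ℝ)
    (T : Finset ℤ) (b : ℤ → ℂ) (ξ : ℝ) :
    (𝓕 (∑ m ∈ T, b m • modulated hχ hχ' P m)) ξ =
      ∑ m ∈ T, b m * (𝓕 (hχ'.toSchwartzMap hχ)) (ξ - m / P) := by
  have h1 := map_sum (FourierTransform.fourierEquiv ℂ (SchwartzMap ℝ ℂ))
    (fun m => b m • modulated hχ hχ' P m) T
  simp only [map_smul] at h1
  have : 𝓕 (∑ m ∈ T, b m • modulated hχ hχ' P m) = ∑ m ∈ T, b m • 𝓕 (modulated hχ hχ' P m) := h1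
  rw [this, sum_apply]
  refine Finset.sum_congr rfl fun m _ => ?_
  rw [smul_apply, fourier_modulated, smul_eq_mul]

theorem measurable_majorant_sub (a : ℝ) : Measurable fun ξ : ℝ => majorant (ξ - a) :=
  measurable_majorant.comp (measurable_id.sub_const _)

theorem lintegral_sum_majorant (T : Finset ℤ) (P : ℝ) (B : ℤ → ℝ≥0∞) :
    ∫⁻ ξ, ∑ m ∈ T, majorant (ξ - m / P) * B m = (∑ m ∈ T, B m) * ∫⁻ x, majorant x := by
  rw [lintegral_finsetSum _ fun m _ => (measurable_majorant_sub _).mul_const _, Finset.sum_mul]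
  refine Finset.sum_congr rfl fun m _ => ?_
  rw [lintegral_mul_const _ (measurable_majorant_sub _), lintegral_majorant_sub, mul_comm]

/-- The Fourier transform of the sum is `∑ b m * χ̂ (ξ - m / P)`, a superposition of rapidly
decaying bumps centred on the lattice of step `1 / P`. They are almost orthogonal in weighted `L²`,
by a Schur test with the kernel `majorant (ξ - m / P)`. -/
theorem sobolevNorm_sum_modulated_le {s P : ℝ} (hs : 0 ≤ s) (hP : 0 < P) (hχ : ContDiff ℝ ∞ χ)
    (hχ' : HasCompactSupport χ) :
    ∃ C : ℝ≥0, ∀ (T : Finset ℤ) (b : ℤ → ℂ),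
      sobolevNorm s (fun x => ∑ m ∈ T, b m * (fourierExp P m x * χ x)) ^ 2 ≤
        C * ∑ m ∈ T, (‖b m‖ₑ * ENNReal.ofReal (bracket s (m / P))) ^ 2 := by
  obtain ⟨A, hA⟩ := exists_schwartz_decay (𝓕 (hχ'.toSchwartzMap hχ)) s
  obtain ⟨S, hS⟩ := exists_tsum_majorant_le hP
  set D := ENNReal.ofReal (2 ^ (s / 2)) * A with hD
  have hDt : D ≠ ⊤ := ENNReal.mul_ne_top ENNReal.ofReal_ne_top ENNReal.coe_ne_top
  have hIt := lintegral_majorant_lt_top.ne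
  refine ⟨(D ^ 2 * S * ∫⁻ x, majorant x).toNNReal, fun T b => ?_⟩
  rw [ENNReal.coe_toNNReal (ENNReal.mul_ne_top (ENNReal.mul_ne_top (ENNReal.pow_ne_top hDt)
    ENNReal.coe_ne_top) hIt)]
  have hfe : (fun x => ∑ m ∈ T, b m * (fourierExp P m x * χ x)) =
      ⇑(∑ m ∈ T, b m • modulated hχ hχ' P m) := by
    ext x
    rw [sum_apply]
    rfl
  rw [hfe, sobolevNorm_schwartz_sq]
  set B : ℤ → ℝ≥0∞ := fun m => ‖b m‖ₑ * ENNReal.ofReal (bracket s (m / P)) with hB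
  have hpt : ∀ ξ, (ENNReal.ofReal (bracket s ξ) *
      ‖(𝓕 (∑ m ∈ T, b m • modulated hχ hχ' P m)) ξ‖ₑ) ^ 2 ≤
      D ^ 2 * S * ∑ m ∈ T, majorant (ξ - m / P) * B m ^ 2 := by
    intro ξ
    rw [fourier_sum_modulated]
    refine (ENNReal.pow_le_pow_left (bracket_mul_enorm_sum_le (P := P) hs hA T b ξ)).trans ?_
    rw [mul_pow, mul_assoc (D ^ 2)]
    refine mul_le_mul_right ((sum_mul_sq_le T (fun m : ℤ => majorant (ξ - m / P)) B).trans ?_) _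
    exact mul_le_mul_left ((ENNReal.sum_le_tsum T).trans (hS ξ)) _
  refine (lintegral_mono hpt).trans_eq ?_
  rw [lintegral_const_mul _ (Finset.measurable_fun_sum _ fun m _ =>
    (measurable_majorant_sub _).mul_const _), lintegral_sum_majorant]
  ring

/-- The dual of the preceding bound. As `χ = 1` where `F ≠ 0`, the coefficient is the inner product
of `F` with the modulated cutoff, and by Plancherel it is `F̂` integrated against a bump at `m / P`.
The same Schur test applies with the roles of `ξ` and `m` exchanged. -/
theorem tsum_fourier_coeff_le {s P : ℝ} (hs : 0 ≤ s) (hP : 0 < P) (hχ : ContDiff ℝ ∞ χ)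
    (hχ' : HasCompactSupport χ) :
    ∃ C : ℝ≥0, ∀ F : ℝ → ℂ, MemLp F 2 volume → (∀ x, F x ≠ 0 → χ x = 1) →
      ∑' m : ℤ, (‖∫ x, F x * starRingEnd ℂ (fourierExp P m x)‖ₑ *
        ENNReal.ofReal (bracket s (m / P))) ^ 2 ≤ C * sobolevNorm s F ^ 2 := by
  obtain ⟨A, hA⟩ := exists_schwartz_decay (𝓕 (hχ'.toSchwartzMap hχ)) s
  obtain ⟨S, hS⟩ := exists_tsum_majorant_le hP
  set D := ENNReal.ofReal (2 ^ (s / 2)) * A with hD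
  have hDt : D ≠ ⊤ := ENNReal.mul_ne_top ENNReal.ofReal_ne_top ENNReal.coe_ne_top
  have hIt := lintegral_majorant_lt_top.ne
  refine ⟨(D ^ 2 * (∫⁻ x, majorant x) * S).toNNReal, fun F hF hFχ => ?_⟩
  rw [ENNReal.coe_toNNReal (ENNReal.mul_ne_top (ENNReal.mul_ne_top (ENNReal.pow_ne_top hDt) hIt)
    ENNReal.coe_ne_top)]
  set g : Lp ℂ 2 (volume : Measure ℝ) := 𝓕 (hF.toLp F) with hg
  set J : ℝ → ℝ≥0∞ := fun ξ => ENNReal.ofReal (bracket s ξ) * ‖g ξ‖ₑ with hJ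
  have hJm : AEMeasurable J volume :=
    (measurable_bracket s).ennreal_ofReal.aemeasurable.mul (Lp.aestronglyMeasurable g).enorm
  have hsob : sobolevNorm s F ^ 2 = ∫⁻ ξ, J ξ ^ 2 := by
    rw [sobolevNorm, dif_pos hF, eLpNorm_two_sq]
    refine lintegral_congr fun ξ => ?_
    rw [enorm_mul]
    congr 2
    exact enorm_bracket s ξ
  have hm : ∀ m : ℤ, Measurable fun ξ : ℝ => majorant (ξ - m / P) :=
    fun m => measurable_majorant_sub _
  have hmJ : ∀ m : ℤ, AEMeasurable (fun ξ => majorant (ξ - m / P) * J ξ) volume :=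
    fun m => (hm m).aemeasurable.mul hJm
  have hcoef : ∀ m : ℤ, ∫ x, F x * starRingEnd ℂ (fourierExp P m x) =
      ∫ ξ, g ξ * starRingEnd ℂ ((𝓕 (hχ'.toSchwartzMap hχ)) (ξ - m / P)) := by
    intro m
    have h1 : inner ℂ ((modulated hχ hχ' P m).toLp 2) (hF.toLp F) =
        ∫ x, F x * starRingEnd ℂ (fourierExp P m x) := by
      rw [L2.inner_def]
      refine integral_congr_ae ?_
      filter_upwards [hF.coeFn_toLp, (modulated hχ hχ' P m).coeFn_toLp 2] with x h1 h2
      rw [h1, h2, modulated_apply]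
      by_cases h0 : F x = 0
      · simp [h0]
      · simp [hFχ x h0]
    rw [← h1, ← Lp.inner_fourier_eq, SchwartzMap.toLp_fourier_eq, L2.inner_def]
    refine integral_congr_ae ?_
    filter_upwards [(𝓕 (modulated hχ hχ' P m)).coeFn_toLp 2] with ξ h2
    rw [h2, fourier_modulated]
    rfl
  have hterm : ∀ m : ℤ, (‖∫ x, F x * starRingEnd ℂ (fourierExp P m x)‖ₑ *
      ENNReal.ofReal (bracket s (m / P))) ^ 2 ≤
      D ^ 2 * (∫⁻ x, majorant x) * ∫⁻ ξ, majorant (ξ - m / P) * J ξ ^ 2 := by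
    intro m
    have h1 : ‖∫ x, F x * starRingEnd ℂ (fourierExp P m x)‖ₑ * ENNReal.ofReal (bracket s (m / P)) ≤
        D * ∫⁻ ξ, majorant (ξ - m / P) * J ξ := by
      rw [hcoef, ← lintegral_const_mul'' _ (hmJ m)]
      refine (mul_le_mul_left (enorm_integral_le_lintegral_enorm _) _).trans ?_
      rw [← lintegral_mul_const' _ _ ENNReal.ofReal_ne_top]
      refine lintegral_mono fun ξ => ?_
      have h2 := bracket_add_le hs ξ (-(ξ - m / P))
      rw [show ξ + -(ξ - m / P) = m / P by ring, bracket_neg] at h2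
      calc _ ≤ ‖g ξ * starRingEnd ℂ ((𝓕 (hχ'.toSchwartzMap hχ)) (ξ - m / P))‖ₑ *
            ENNReal.ofReal (2 ^ (s / 2) * bracket s ξ * bracket s (ξ - m / P)) := by gcongr
        _ = ENNReal.ofReal (2 ^ (s / 2)) * J ξ * (ENNReal.ofReal (bracket s (ξ - m / P)) *
            ‖(𝓕 (hχ'.toSchwartzMap hχ)) (ξ - m / P)‖ₑ) := by
            rw [ENNReal.ofReal_mul (by have := bracket_pos s ξ; positivity),
                  ENNReal.ofReal_mul (by positivity), enorm_mul, RCLike.enorm_conj]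
            ring
        _ ≤ ENNReal.ofReal (2 ^ (s / 2)) * J ξ * (A * majorant (ξ - m / P)) := by
            exact mul_le_mul_right (hA _) _
        _ = _ := by rw [hD]; ring
    calc _ ≤ (D * ∫⁻ ξ, majorant (ξ - m / P) * J ξ) ^ 2 := by gcongr
      _ = D ^ 2 * (∫⁻ ξ, majorant (ξ - m / P) * J ξ) ^ 2 := by ring
      _ ≤ D ^ 2 * ((∫⁻ ξ, majorant (ξ - m / P)) * ∫⁻ ξ, majorant (ξ - m / P) * J ξ ^ 2) := by
        gcongr
        exact lintegral_mul_sq_le (hm m).aemeasurable hJm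
      _ = _ := by rw [lintegral_majorant_sub]; ring
  calc _ ≤ ∑' m : ℤ, D ^ 2 * (∫⁻ x, majorant x) * ∫⁻ ξ, majorant (ξ - m / P) * J ξ ^ 2 :=
        ENNReal.tsum_le_tsum hterm
    _ = D ^ 2 * (∫⁻ x, majorant x) * ∫⁻ ξ, ∑' m : ℤ, majorant (ξ - m / P) * J ξ ^ 2 := by
        rw [ENNReal.tsum_mul_left, lintegral_tsum]
        exact fun m => (hm m).aemeasurable.mul (hJm.pow_const 2)
    _ ≤ D ^ 2 * (∫⁻ x, majorant x) * ∫⁻ ξ, S * J ξ ^ 2 := by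
        gcongr with ξ
        rw [ENNReal.tsum_mul_right]
        gcongr
        exact hS ξ
    _ = _ := by
        rw [lintegral_const_mul'' _ (hJm.pow_const 2), hsob]
        ring

theorem fourierCoeff_liftIoc_eq_integral {P : ℝ} [hP : Fact (0 < P)] {a : ℝ} {F : ℝ → ℂ}
    (hFP : ∀ x, F x ≠ 0 → x ∈ Set.Ioc a (a + P)) (m : ℤ) :
    fourierCoeff (AddCircle.liftIoc P a F) m =
      (1 / P : ℝ) * ∫ y, F y * starRingEnd ℂ (fourierExp P m y) := by
  rw [fourierCoeff_eq_intervalIntegral _ _ a, intervalIntegral.integral_of_le (by linarith [hP.out]),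
    Complex.real_smul]
  congr 1
  have h0 : ∀ x ∉ Set.Ioc a (a + P), F x * starRingEnd ℂ (fourierExp P m x) = 0 := by
    intro x hx
    by_contra h
    exact hx (hFP x (left_ne_zero_of_mul h))
  rw [← setIntegral_eq_integral_of_forall_compl_eq_zero h0]
  refine setIntegral_congr_fun (measurableSet_Ioc (a := a) (b := a + P)) fun x hx => ?_
  simp only [AddCircle.liftIoc_coe_apply hx, fourier_coe_apply, smul_eq_mul]
  rw [mul_comm, conj_fourierExp, fourierExp]

/-- The series converges in `L²` of the circle, hence in measure, hence almost everywhere along a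
subsequence of the symmetric partial sums. No pointwise convergence theorem is required. -/
theorem exists_seq_tendsto_fourier_series {P : ℝ} (hP : 0 < P) {F : ℝ → ℂ} (hF : MemLp F 2 volume)
    (hFP : ∀ x, F x ≠ 0 → x ∈ Set.Ioc (-(P / 2)) (P / 2)) :
    ∃ ns : ℕ → ℕ, StrictMono ns ∧ ∀ᵐ x, x ∈ Set.Ioc (-(P / 2)) (P / 2) →
      Filter.Tendsto (fun i => ∑ m ∈ Finset.Icc (-(ns i : ℤ)) (ns i),
        ((1 / P : ℝ) * ∫ y, F y * starRingEnd ℂ (fourierExp P m y)) * fourierExp P m x)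
        Filter.atTop (nhds (F x)) := by
  haveI : Fact (0 < P) := ⟨hP⟩
  -- Naming the left endpoint puts the period interval in the form `Set.Ioc a (a + P)` used by
  -- `AddCircle.liftIoc`.
  obtain ⟨a, ha⟩ : ∃ a, a = -(P / 2) := ⟨_, rfl⟩
  have hPP : P / 2 = a + P := by rw [ha]; ring
  rw [← ha, hPP] at hFP ⊢
  set f : AddCircle P → ℂ := AddCircle.liftIoc P a F with hf
  have hfm : MemLp f 2 AddCircle.haarAddCircle :=
    (hF.restrict (s := Set.Ioc a (a + P))).memLp_liftIoc.haarAddCircle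
  have hsum := hasSum_fourier_series_L2 (hfm.toLp f)
  have hcoef : ∀ m, fourierCoeff (hfm.toLp f) m =
      (1 / P : ℝ) * ∫ y, F y * starRingEnd ℂ (fourierExp P m y) := fun m => by
    rw [fourierCoeff_congr_ae hfm.coeFn_toLp, hf, fourierCoeff_liftIoc_eq_integral hFP]
  simp only [hcoef] at hsum
  have hN : Filter.Tendsto (fun N : ℕ => Finset.Icc (-(N : ℤ)) N) Filter.atTop Filter.atTop := by
    refine Filter.tendsto_atTop_finset_of_monotone (fun M N h => ?_) fun m => ⟨m.natAbs, ?_⟩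
    · exact Finset.Icc_subset_Icc (by simpa using h) (by simpa using h)
    · simp only [Finset.mem_Icc]; omega
  obtain ⟨ns, hns, hae⟩ :=
    (tendstoInMeasure_of_tendsto_Lp (hsum.comp hN)).exists_seq_tendsto_ae
  refine ⟨ns, hns, ?_⟩
  have hall : ∀ᵐ x ∂(AddCircle.haarAddCircle : Measure (AddCircle P)),
      Filter.Tendsto (fun i => ∑ m ∈ Finset.Icc (-(ns i : ℤ)) (ns i),
        ((1 / P : ℝ) * ∫ y, F y * starRingEnd ℂ (fourierExp P m y)) * fourier m x)
        Filter.atTop (nhds (f x)) := by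
    have h1 : ∀ N : ℕ, ∀ᵐ x ∂(AddCircle.haarAddCircle : Measure (AddCircle P)),
        (∑ m ∈ Finset.Icc (-(N : ℤ)) N, ((1 / P : ℝ) * ∫ y, F y * starRingEnd ℂ (fourierExp P m y)) •
          fourierLp (T := P) 2 m : Lp ℂ 2 AddCircle.haarAddCircle) x =
        ∑ m ∈ Finset.Icc (-(N : ℤ)) N,
          ((1 / P : ℝ) * ∫ y, F y * starRingEnd ℂ (fourierExp P m y)) * fourier m x := by
      intro N
      have h2 : ∀ m : ℤ, ∀ᵐ x ∂(AddCircle.haarAddCircle : Measure (AddCircle P)),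
          (((1 / P : ℝ) * ∫ y, F y * starRingEnd ℂ (fourierExp P m y)) •
            fourierLp (T := P) 2 m : Lp ℂ 2 AddCircle.haarAddCircle) x =
          ((1 / P : ℝ) * ∫ y, F y * starRingEnd ℂ (fourierExp P m y)) * fourier m x := by
        intro m
        filter_upwards [Lp.coeFn_smul ((1 / P : ℝ) * ∫ y, F y * starRingEnd ℂ (fourierExp P m y))
          (fourierLp (T := P) 2 m), coeFn_fourierLp (T := P) 2 m] with x h3 h4
        rw [h3, Pi.smul_apply, h4, smul_eq_mul]
      filter_upwards [Lp.coeFn_fun_finsetSum (Finset.Icc (-(N : ℤ)) N) fun m =>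
        ((1 / P : ℝ) * ∫ y, F y * starRingEnd ℂ (fourierExp P m y)) • fourierLp (T := P) 2 m,
        ae_all_iff.2 h2] with x h3 h4
      rw [h3]
      exact Finset.sum_congr rfl fun m _ => h4 m
    filter_upwards [hae, hfm.coeFn_toLp, ae_all_iff.2 h1] with x h2 h3 h4
    rw [h3] at h2
    exact h2.congr fun i => h4 (ns i)
  have hvol : ∀ᵐ x : AddCircle P, Filter.Tendsto (fun i => ∑ m ∈ Finset.Icc (-(ns i : ℤ)) (ns i),
        ((1 / P : ℝ) * ∫ y, F y * starRingEnd ℂ (fourierExp P m y)) * fourier m x)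
        Filter.atTop (nhds (f x)) := by
    rw [AddCircle.volume_eq_smul_haarAddCircle]
    exact Measure.ae_smul_measure hall _
  have := (AddCircle.measurePreserving_mk P a).quasiMeasurePreserving.ae hvol
  rw [ae_restrict_iff' measurableSet_Ioc] at this
  filter_upwards [this] with x hx hxa
  have h := hx hxa
  rw [hf, AddCircle.liftIoc_coe_apply hxa] at h
  simp only [fourier_coe_apply] at h
  exact h

end Sobolev

/-! ### Test functions on products -/

section PiGroup

variable {ι : Type*} [Fintype ι] [DecidableEq ι] {E H : ι → Type*} [∀ i, NormedAddCommGroup (E i)]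
  [∀ i, NormedSpace ℝ (E i)] [∀ i, TopologicalSpace (H i)]
  {I : ∀ i, ModelWithCorners ℝ (E i) (H i)} {G : ι → Type*} [∀ i, TopologicalSpace (G i)]
  [∀ i, ChartedSpace (H i) (G i)] [∀ i, Group (G i)]

theorem update_one_mul_mulSingle (x : ∀ i, G i) (j : ι) (y : G j) :
    Function.update x j 1 * MonoidHom.mulSingle G j y = Function.update x j y := by
  ext i
  by_cases h : i = j
  · subst h; simp
  · simp [h]

section Deriv

variable {E' H' : Type*} [NormedAddCommGroup E'] [NormedSpace ℝ E'] [TopologicalSpace H']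
  {J : ModelWithCorners ℝ E' H'} {G' : Type*} [TopologicalSpace G'] [ChartedSpace H' G'] [Group G']
  [IsManifold J ∞ G']
  {E'' H'' : Type*} [NormedAddCommGroup E''] [NormedSpace ℝ E''] [TopologicalSpace H'']
  {I' : ModelWithCorners ℝ E'' H''} {G'' : Type*} [TopologicalSpace G''] [ChartedSpace H'' G'']
  [Group G''] [LieGroup I' ∞ G''] {i : G'' →* G'} {κ : Type*} [Fintype κ]

theorem alongSumOfSquares_add (hi : SmoothRightAction J I' i) (X : κ → GroupLieAlgebra I' G'')
    {φ ψ : G' → ℂ} (hφ : ContMDiff J 𝓘(ℝ, ℂ) ∞ φ) (hψ : ContMDiff J 𝓘(ℝ, ℂ) ∞ ψ) (x : G') :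
    alongSumOfSquares I' i X (fun x => φ x + ψ x) x =
      alongSumOfSquares I' i X φ x + alongSumOfSquares I' i X ψ x := by
  have h : ∀ l, alongDeriv I' i (X l) (fun x => φ x + ψ x) =
      fun x => alongDeriv I' i (X l) φ x + alongDeriv I' i (X l) ψ x :=
    fun l => funext fun x => alongDeriv_add hi hφ hψ x
  simp only [alongSumOfSquares, h]
  rw [← neg_add, ← Finset.sum_add_distrib]
  congr 1
  exact Finset.sum_congr rfl fun l _ =>
    alongDeriv_add hi (contMDiff_alongDeriv hi hφ) (contMDiff_alongDeriv hi hψ) x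

theorem alongSumOfSquares_const_mul (hi : SmoothRightAction J I' i)
    (X : κ → GroupLieAlgebra I' G'') {φ : G' → ℂ} (hφ : ContMDiff J 𝓘(ℝ, ℂ) ∞ φ) (c : ℂ) (x : G') :
    alongSumOfSquares I' i X (fun x => c * φ x) x = c * alongSumOfSquares I' i X φ x := by
  have h0 (v : GroupLieAlgebra I' G'') {φ : G' → ℂ} (hφ : ContMDiff J 𝓘(ℝ, ℂ) ∞ φ) (x : G') :
      alongDeriv I' i v (fun x => c * φ x) x = c * alongDeriv I' i v φ x :=
    alongDeriv_comp_clm hi hφ (ContinuousLinearMap.mul ℝ ℂ c) x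
  have h : ∀ l, alongDeriv I' i (X l) (fun x => c * φ x) =
      fun x => c * alongDeriv I' i (X l) φ x :=
    fun l => funext fun x => h0 _ hφ x
  simp only [alongSumOfSquares, h]
  rw [mul_neg, Finset.mul_sum]
  congr 1
  exact Finset.sum_congr rfl fun l _ => h0 _ (contMDiff_alongDeriv hi hφ) x

theorem IsTestFunction.add {φ ψ : G' → ℂ} (hφ : IsTestFunction J φ) (hψ : IsTestFunction J ψ) :
    IsTestFunction J (fun x => φ x + ψ x) :=
  ⟨(contDiff_add (𝕜 := ℝ) (F := ℂ)).contMDiff.comp (hφ.1.prodMk_space hψ.1), hφ.2.add hψ.2⟩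

theorem IsTestFunction.const_mul {φ : G' → ℂ} (hφ : IsTestFunction J φ) (c : ℂ) :
    IsTestFunction J (fun x => c * φ x) :=
  ⟨contMDiff_mul_complex contMDiff_const hφ.1, hφ.2.mul_left⟩

end Deriv

theorem contMDiff_tensor {φ : ∀ i, G i → ℂ} (hφ : ∀ i, ContMDiff (I i) 𝓘(ℝ, ℂ) ∞ (φ i)) :
    ContMDiff (ModelWithCorners.pi I) 𝓘(ℝ, ℂ) ∞ (fun x : ∀ i, G i => ∏ i, φ i (x i)) := by
  have h1 : ContDiff ℝ ∞ (fun z : ι → ℂ => ∏ i, z i) := contDiff_prod fun i _ => contDiff_apply ℝ ℂ i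
  have h2 : ContMDiff (ModelWithCorners.pi I) 𝓘(ℝ, ι → ℂ) ∞
      (fun x : ∀ i, G i => fun i => φ i (x i)) :=
    contMDiff_pi_space.2 fun i => (hφ i).comp (contMDiff_eval i)
  exact h1.contMDiff.comp h2

theorem IsTestFunction.tensor {φ : ∀ i, G i → ℂ} (hφ : ∀ i, IsTestFunction (I i) (φ i)) :
    IsTestFunction (ModelWithCorners.pi I) (fun x : ∀ i, G i => ∏ i, φ i (x i)) := by
  refine ⟨contMDiff_tensor fun i => (hφ i).1, ?_⟩
  refine HasCompactSupport.intro' (isCompact_univ_pi fun i => (hφ i).2)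
    (isClosed_set_pi fun i _ => isClosed_tsupport _) fun x hx => ?_
  simp only [Set.mem_pi, not_forall] at hx
  obtain ⟨i, -, hi⟩ := hx
  exact Finset.prod_eq_zero (Finset.mem_univ i) (image_eq_zero_of_notMem_tsupport hi)

variable [∀ i, LieGroup (I i) ∞ (G i)]

theorem smoothRightAction_mulSingle (j : ι) :
    SmoothRightAction (ModelWithCorners.pi I) (I j) (MonoidHom.mulSingle G j) := by
  refine contMDiff_pi_of_forall fun i => ?_
  by_cases h : i = j
  · subst h
    have : (fun p : (∀ i, G i) × G i => (p.1 * MonoidHom.mulSingle G i p.2) i) =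
        fun p => p.1 i * p.2 := by ext p; simp
    rw [this]
    exact ((contMDiff_eval i).comp contMDiff_fst).mul contMDiff_snd
  · have : (fun p : (∀ i, G i) × G j => (p.1 * MonoidHom.mulSingle G j p.2) i) =
        fun p => p.1 i := by ext p; simp [h]
    rw [this]
    exact (contMDiff_eval i).comp contMDiff_fst

theorem IsTestFunction.slice [∀ i, T2Space (G i)] {φ : (∀ i, G i) → ℂ}
    (hφ : IsTestFunction (ModelWithCorners.pi I) φ) (j : ι) (x : ∀ i, G i) :
    IsTestFunction (I j) (fun y => φ (Function.update x j y)) := by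
  have h := (smoothRightAction_mulSingle (I := I) j).contMDiff_translate hφ.1 (Function.update x j 1)
  simp only [update_one_mul_mulSingle] at h
  refine ⟨h, ?_⟩
  refine HasCompactSupport.intro (hφ.2.image (continuous_apply j)) fun y hy => ?_
  by_contra h0
  exact hy ⟨Function.update x j y, subset_tsupport _ h0, by simp⟩

variable {κ : ι → Type*} [∀ j, Fintype (κ j)] (X : ∀ j, κ j → GroupLieAlgebra (I j) (G j))

/-- The pushforward of `L j` acts in the `j`-th variable only, so on each slice it is the original
operator. This is what reduces statements on the product to one factor. -/
theorem sumOfSquares_slice {φ : (∀ i, G i) → ℂ} (hφ : ContMDiff (ModelWithCorners.pi I) 𝓘(ℝ, ℂ) ∞ φ)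
    (j : ι) (x : ∀ i, G i) (y : G j) :
    sumOfSquares (I j) (X j) (fun y => φ (Function.update x j y)) y =
      alongSumOfSquares (I j) (MonoidHom.mulSingle G j) (X j) φ (Function.update x j y) := by
  have h := sumOfSquares_translate (smoothRightAction_mulSingle (I := I) j) hφ (X j)
    (Function.update x j 1) y
  simpa only [update_one_mul_mulSingle] using h

theorem alongSumOfSquares_tensor {φ : ∀ i, G i → ℂ} (hφ : ∀ i, ContMDiff (I i) 𝓘(ℝ, ℂ) ∞ (φ i))
    (j : ι) (x : ∀ i, G i) :
    alongSumOfSquares (I j) (MonoidHom.mulSingle G j) (X j) (fun x => ∏ i, φ i (x i)) x =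
      ∏ i, Function.update φ j (sumOfSquares (I j) (X j) (φ j)) i (x i) := by
  have h := sumOfSquares_slice X (contMDiff_tensor hφ) j x (x j)
  rw [Function.update_eq_self] at h
  rw [← h]
  have e : (fun y => ∏ i, φ i (Function.update x j y i)) =
      fun y => (∏ i ∈ Finset.univ.erase j, φ i (x i)) * φ j y := by
    ext y
    rw [← Finset.prod_erase_mul _ _ (Finset.mem_univ j)]
    congr 1
    · refine Finset.prod_congr rfl fun i hi => ?_
      rw [Function.update_of_ne (Finset.ne_of_mem_erase hi)]
    · simp
  rw [e, sumOfSquares_eq_along _ (contMDiff_mul_complex contMDiff_const (hφ j)),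
    alongSumOfSquares_const_mul smoothRightAction_id _ (hφ j),
    ← Finset.prod_erase_mul _ _ (Finset.mem_univ j), sumOfSquares_eq_along _ (hφ j)]
  congr 1
  · refine Finset.prod_congr rfl fun i hi => ?_
    rw [Function.update_of_ne (Finset.ne_of_mem_erase hi)]
  · simp

theorem sum_pushforwardOperator {φ : (∀ i, G i) → ℂ}
    (hφ : ContMDiff (ModelWithCorners.pi I) 𝓘(ℝ, ℂ) ∞ φ) :
    (fun x => ∑ j, pushforwardOperator (MonoidHom.mulSingle G j) (sumOfSquares (I j) (X j)) φ x) =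
      fun x => ∑ j, alongSumOfSquares (I j) (MonoidHom.mulSingle G j) (X j) φ x := by
  ext x
  refine Finset.sum_congr rfl fun j _ => ?_
  rw [pushforwardOperator_sumOfSquares (smoothRightAction_mulSingle (I := I) j) hφ]

end PiGroup

/-! ### Spectral representation of the sum on a product -/

section Mul

variable {Ω : Type*} [MeasurableSpace Ω] {ρ : Measure Ω}

/-- Multiplication by a bounded measurable function, as a bounded operator on `L²`. -/
def mulLp (ρ : Measure Ω) {m : Ω → ℂ} (hm : Measurable m) {C : ℝ} (hC : ∀ x, ‖m x‖ ≤ C) :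
    Lp ℂ 2 ρ →L[ℂ] Lp ℂ 2 ρ :=
  LinearMap.mkContinuous
    { toFun := fun f => (memLp_two_bdd_mul hm.aestronglyMeasurable hC (Lp.memLp f)).toLp _
      map_add' := by
        intro f g
        apply Lp.ext
        filter_upwards [(memLp_two_bdd_mul hm.aestronglyMeasurable hC (Lp.memLp (f + g))).coeFn_toLp,
          (memLp_two_bdd_mul hm.aestronglyMeasurable hC (Lp.memLp f)).coeFn_toLp,
          (memLp_two_bdd_mul hm.aestronglyMeasurable hC (Lp.memLp g)).coeFn_toLp,
          Lp.coeFn_add f g, Lp.coeFn_add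
            ((memLp_two_bdd_mul hm.aestronglyMeasurable hC (Lp.memLp f)).toLp _)
            ((memLp_two_bdd_mul hm.aestronglyMeasurable hC (Lp.memLp g)).toLp _)]
          with x h1 h2 h3 h4 h5
        rw [h1, h5, Pi.add_apply, h2, h3, h4, Pi.add_apply, mul_add]
      map_smul' := by
        intro c f
        apply Lp.ext
        filter_upwards [(memLp_two_bdd_mul hm.aestronglyMeasurable hC (Lp.memLp (c • f))).coeFn_toLp,
          (memLp_two_bdd_mul hm.aestronglyMeasurable hC (Lp.memLp f)).coeFn_toLp,
          Lp.coeFn_smul c f, Lp.coeFn_smul c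
            ((memLp_two_bdd_mul hm.aestronglyMeasurable hC (Lp.memLp f)).toLp _)]
          with x h1 h2 h4 h5
        rw [h1, RingHom.id_apply, h5, Pi.smul_apply, h2, h4, Pi.smul_apply, smul_eq_mul, smul_eq_mul]
        ring }
    C fun f => by
      refine Lp.norm_le_mul_norm_of_ae_le_mul ?_
      filter_upwards [(memLp_two_bdd_mul hm.aestronglyMeasurable hC (Lp.memLp f)).coeFn_toLp] with x hx
      refine (congrArg norm hx).trans_le ?_
      rw [norm_mul]
      gcongr
      exact hC x

theorem mulLp_ae_eq {m : Ω → ℂ} (hm : Measurable m) {C : ℝ} (hC : ∀ x, ‖m x‖ ≤ C) (f : Lp ℂ 2 ρ) :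
    mulLp ρ hm hC f =ᵐ[ρ] fun x => m x * f x :=
  (memLp_two_bdd_mul hm.aestronglyMeasurable hC (Lp.memLp f)).coeFn_toLp

theorem ofReal_add_I_ne_zero (r : ℝ) : (r : ℂ) + Complex.I ≠ 0 := fun h => by
  simpa using congrArg Complex.im h

theorem norm_inv_ofReal_add_I_le (r : ℝ) : ‖((r : ℂ) + Complex.I)⁻¹‖ ≤ 1 := by
  rw [norm_inv]
  refine inv_le_one_of_one_le₀ ?_
  simpa using Complex.abs_im_le_norm ((r : ℂ) + Complex.I)

theorem norm_mul_inv_ofReal_add_I_le (r : ℝ) : ‖(r : ℂ) * ((r : ℂ) + Complex.I)⁻¹‖ ≤ 1 := by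
  rw [norm_mul, norm_inv, ← div_eq_mul_inv]
  refine div_le_one_of_le₀ ?_ (norm_nonneg _)
  simpa using Complex.abs_re_le_norm ((r : ℂ) + Complex.I)

variable {σ : Ω → ℝ}

theorem measurable_inv_add_I (hσ : Measurable σ) :
    Measurable fun x => ((σ x : ℂ) + Complex.I)⁻¹ := by fun_prop

theorem measurable_mul_inv_add_I (hσ : Measurable σ) :
    Measurable fun x => (σ x : ℂ) * ((σ x : ℂ) + Complex.I)⁻¹ := by fun_prop

/-- The graph of the operator of multiplication by a real function is closed. -/
theorem isClosed_mulGraph (hσ : Measurable σ) :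
    IsClosed {p : Lp ℂ 2 ρ × Lp ℂ 2 ρ | p.2 =ᵐ[ρ] fun x => (σ x : ℂ) * p.1 x} := by
  -- Dividing by the nowhere vanishing `σ + i` turns the unbounded relation `v = σ u` into an
  -- equality between two bounded operators.
  have : {p : Lp ℂ 2 ρ × Lp ℂ 2 ρ | p.2 =ᵐ[ρ] fun x => (σ x : ℂ) * p.1 x} =
      {p | mulLp ρ (measurable_inv_add_I hσ) (fun x => norm_inv_ofReal_add_I_le (σ x)) p.2 =
        mulLp ρ (measurable_mul_inv_add_I hσ) (fun x => norm_mul_inv_ofReal_add_I_le (σ x)) p.1} := by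
    ext ⟨u, v⟩
    have h1 := mulLp_ae_eq (ρ := ρ) (measurable_inv_add_I hσ)
      (fun x => norm_inv_ofReal_add_I_le (σ x)) v
    have h2 := mulLp_ae_eq (ρ := ρ) (measurable_mul_inv_add_I hσ)
      (fun x => norm_mul_inv_ofReal_add_I_le (σ x)) u
    simp only [Set.mem_ofPred_eq]
    constructor
    · intro h
      apply Lp.ext
      filter_upwards [h, h1, h2] with x h h1 h2
      rw [h1, h2, h]
      ring
    · intro h
      rw [h] at h1
      filter_upwards [h1, h2] with x h1 h2
      rw [h2] at h1
      have h0 := ofReal_add_I_ne_zero (σ x)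
      field_simp at h1
      exact h1.symm
  rw [this]
  exact isClosed_eq ((ContinuousLinearMap.continuous _).comp continuous_snd)
    ((ContinuousLinearMap.continuous _).comp continuous_fst)

/-- A closed subspace of pairs contains the graph of the multiplication by a real function as soon
as it contains the graph over a set on which the resolvent is total. -/
theorem mulGraph_subset_of_total {𝓗 : Type*} [NormedAddCommGroup 𝓗] [InnerProductSpace ℂ 𝓗]
    [CompleteSpace 𝓗] (V : 𝓗 ≃ₗᵢ[ℂ] Lp ℂ 2 ρ) (hσ : Measurable σ) (Γ : Submodule ℂ (𝓗 × 𝓗))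
    (hΓ : IsClosed (Γ : Set (𝓗 × 𝓗))) {α : Type*} (a b : α → 𝓗) (hab : ∀ i, (a i, b i) ∈ Γ)
    (h : ∀ i, V (b i) =ᵐ[ρ] fun x => (σ x : ℂ) * V (a i) x)
    (htot : ∀ f : Lp ℂ 2 ρ, (∀ i, inner ℂ (V (b i) + Complex.I • V (a i)) f = 0) → f = 0)
    {u v : 𝓗} (huv : V v =ᵐ[ρ] fun x => (σ x : ℂ) * V u x) : (u, v) ∈ Γ := by
  set A := mulLp ρ (measurable_inv_add_I hσ) (fun x => norm_inv_ofReal_add_I_le (σ x)) with hA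
  set B := mulLp ρ (measurable_mul_inv_add_I hσ) (fun x => norm_mul_inv_ofReal_add_I_le (σ x)) with hB
  -- The vector `f = (σ + i) u` determines the graph point by bounded operators, `u = (σ + i)⁻¹ f`
  -- and `v = σ (σ + i)⁻¹ f`; the map `Φ` below parametrizes the graph in this way.
  have key : ∀ u v : 𝓗, V v =ᵐ[ρ] (fun x => (σ x : ℂ) * V u x) →
      V.symm (A (V v + Complex.I • V u)) = u ∧ V.symm (B (V v + Complex.I • V u)) = v := by
    intro u v huv
    have e : (V v + Complex.I • V u : Lp ℂ 2 ρ) =ᵐ[ρ] fun x => ((σ x : ℂ) + Complex.I) * V u x := by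
      filter_upwards [Lp.coeFn_add (V v) (Complex.I • V u), Lp.coeFn_smul Complex.I (V u), huv]
        with x h1 h2 h3
      rw [h1, Pi.add_apply, h2, Pi.smul_apply, h3, smul_eq_mul, add_mul]
    constructor
    · rw [LinearIsometryEquiv.symm_apply_eq]
      apply Lp.ext
      filter_upwards [e, mulLp_ae_eq (ρ := ρ) (measurable_inv_add_I hσ)
        (fun x => norm_inv_ofReal_add_I_le (σ x)) (V v + Complex.I • V u)] with x h1 h2
      rw [hA, h2, h1, inv_mul_cancel_left₀ (ofReal_add_I_ne_zero _)]
    · rw [LinearIsometryEquiv.symm_apply_eq]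
      apply Lp.ext
      filter_upwards [e, mulLp_ae_eq (ρ := ρ) (measurable_mul_inv_add_I hσ)
        (fun x => norm_mul_inv_ofReal_add_I_le (σ x)) (V v + Complex.I • V u), huv] with x h1 h2 h3
      rw [hB, h2, h1, h3, mul_assoc, inv_mul_cancel_left₀ (ofReal_add_I_ne_zero _)]
  set Φ : Lp ℂ 2 ρ →L[ℂ] 𝓗 × 𝓗 :=
    ((V.symm.toContinuousLinearEquiv : Lp ℂ 2 ρ →L[ℂ] 𝓗).comp A).prod
      ((V.symm.toContinuousLinearEquiv : Lp ℂ 2 ρ →L[ℂ] 𝓗).comp B) with hΦ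
  have hΦuv : ∀ u v : 𝓗, V v =ᵐ[ρ] (fun x => (σ x : ℂ) * V u x) →
      Φ (V v + Complex.I • V u) = (u, v) := fun u v huv =>
    Prod.ext (key u v huv).1 (key u v huv).2
  -- The vectors `f` whose graph point lies in `Γ` form a closed subspace. It contains a total
  -- family, hence is everything.
  set N : Submodule ℂ (Lp ℂ 2 ρ) := Γ.comap (Φ : Lp ℂ 2 ρ →ₗ[ℂ] 𝓗 × 𝓗) with hN
  have hNc : IsClosed (N : Set (Lp ℂ 2 ρ)) := hΓ.preimage Φ.continuous
  have htop : N = ⊤ := by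
    rw [← hNc.submodule_topologicalClosure_eq, Submodule.topologicalClosure_eq_top_iff,
      Submodule.eq_bot_iff]
    intro f hf
    refine htot f fun i => (Submodule.mem_orthogonal _ _).1 hf _ ?_
    change Φ _ ∈ Γ
    rw [hΦuv _ _ (h i)]
    exact hab i
  have : V v + Complex.I • V u ∈ N := htop ▸ Submodule.mem_top
  have h2 : Φ (V v + Complex.I • V u) ∈ Γ := this
  rwa [hΦuv _ _ huv] at h2

end Mul

/-! ### Integration over one coordinate of a product -/

section Fubini

theorem integral_pi_eq_zero_of_forall_slice {m : ℕ} {X : Fin (m + 1) → Type*}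
    [∀ i, MeasurableSpace (X i)] {μ : ∀ i, Measure (X i)} [∀ i, SigmaFinite (μ i)]
    (j : Fin (m + 1)) {f : (∀ i, X i) → ℂ} (hf : Integrable f (Measure.pi μ))
    (h : ∀ x : ∀ i, X i, ∫ y, f (Function.update x j y) ∂μ j = 0) : ∫ x, f x ∂Measure.pi μ = 0 := by
  have he := (measurePreserving_piFinSuccAbove μ j).symm
  have hf' := (he.integrable_comp_emb (MeasurableEquiv.measurableEmbedding _)).2 hf
  rw [← he.integral_comp (MeasurableEquiv.measurableEmbedding _)]
  refine (integral_prod_symm _ hf').trans ?_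
  refine integral_eq_zero_of_ae (Filter.Eventually.of_forall fun z => ?_)
  simp only [Pi.zero_apply]
  -- The hypothesis is indexed by full points, so the missing coordinate is filled with an arbitrary
  -- `y₀`, which the update then overwrites.
  rcases isEmpty_or_nonempty (X j) with h0 | ⟨⟨y₀⟩⟩
  · rw [Measure.eq_zero_of_isEmpty (μ j), integral_zero_measure]
  rw [← h (j.insertNth y₀ z)]
  refine integral_congr_ae (Filter.Eventually.of_forall fun y => ?_)
  simp only [Fin.update_insertNth]
  rfl

end Fubini

/-! ### Multipliers acting on elementary tensors -/

section PiTensor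

variable {ι : Type*} [Fintype ι] {X Y : ι → Type*} [∀ i, MeasurableSpace (X i)]
  [∀ i, MeasurableSpace (Y i)] {μ : ∀ i, Measure (X i)} {ν : ∀ i, Measure (Y i)}
  [∀ i, SigmaFinite (μ i)] [∀ i, SigmaFinite (ν i)] {U : ∀ i, Lp ℂ 2 (μ i) ≃ₗᵢ[ℂ] Lp ℂ 2 (ν i)}
  {V : Lp ℂ 2 (Measure.pi μ) ≃ₗᵢ[ℂ] Lp ℂ 2 (Measure.pi ν)}

theorem tensor_multiplier (hV : ∀ f, V (tensorLp μ f) = tensorLp ν fun i => U i (f i))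
    {m : ∀ i, Y i → ℂ} {g v : ∀ i, Lp ℂ 2 (μ i)}
    (h : ∀ i, U i (v i) =ᵐ[ν i] fun y => m i y * U i (g i) y) :
    V (tensorLp μ v) =ᵐ[Measure.pi ν] fun ξ => (∏ i, m i (ξ i)) * V (tensorLp μ g) ξ := by
  rw [hV, hV]
  filter_upwards [tensorLp_ae_eq_of_ae_eq h, tensorLp_ae_eq fun i => U i (g i)] with ξ h1 h2
  rw [h1, h2, Finset.prod_mul_distrib]

theorem tensor_update_multiplier [DecidableEq ι] (hV : ∀ f, V (tensorLp μ f) = tensorLp ν fun i => U i (f i))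
    {j : ι} {m : Y j → ℂ} {g : ∀ i, Lp ℂ 2 (μ i)} {v : Lp ℂ 2 (μ j)}
    (h : U j v =ᵐ[ν j] fun y => m y * U j (g j) y) :
    V (tensorLp μ (Function.update g j v)) =ᵐ[Measure.pi ν]
      fun ξ => m (ξ j) * V (tensorLp μ g) ξ := by
  have := tensor_multiplier hV (m := Function.update (fun _ _ => 1) j m) (g := g)
    (v := Function.update g j v) fun i => by
      by_cases hi : i = j
      · subst hi; simpa using h
      · simp only [Function.update_of_ne hi, one_mul]; rfl
  filter_upwards [this] with ξ hξ
  rw [hξ, ← Finset.prod_erase_mul _ _ (Finset.mem_univ j), Finset.prod_eq_one, one_mul,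
    Function.update_self]
  intro i hi
  rw [Function.update_of_ne (Finset.ne_of_mem_erase hi)]

end PiTensor

/-! ### The graph of the sum operator on test functions -/

section PiSpectral

variable {ι : Type*} [Fintype ι] {E H : ι → Type*} [∀ i, NormedAddCommGroup (E i)]
  [∀ i, NormedSpace ℝ (E i)] [∀ i, TopologicalSpace (H i)]
  {I : ∀ i, ModelWithCorners ℝ (E i) (H i)} {G : ι → Type*} [∀ i, TopologicalSpace (G i)]
  [∀ i, ChartedSpace (H i) (G i)] [∀ i, Group (G i)]
  [∀ i, FiniteDimensional ℝ (E i)]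
  [∀ i, T2Space (G i)] [∀ i, SecondCountableTopology (G i)] [∀ i, SigmaCompactSpace (G i)]
  [∀ i, MeasurableSpace (G i)] [∀ i, BorelSpace (G i)] {μ : ∀ i, Measure (G i)}
  [∀ i, SigmaFinite (μ i)] [∀ i, IsLocallyFiniteMeasure (μ i)]
  {κ : ι → Type*} [∀ j, Fintype (κ j)] {X : ∀ j, κ j → GroupLieAlgebra (I j) (G j)}

theorem IsTestFunction.memLp_pi {φ : (∀ i, G i) → ℂ} (hφ : IsTestFunction (ModelWithCorners.pi I) φ)
    (p : ℝ≥0∞) : MemLp φ p (Measure.pi μ) :=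
  hφ.continuous.memLp_of_hasCompactSupport hφ.2

variable [DecidableEq ι] [∀ i, LieGroup (I i) ∞ (G i)]

variable (I X) in
/-- The sum of the pushforwards of sums of squares to a product. -/
def sumPushforward (φ : (∀ i, G i) → ℂ) : (∀ i, G i) → ℂ :=
  fun x => ∑ j, alongSumOfSquares (I j) (MonoidHom.mulSingle G j) (X j) φ x

variable (X μ) in
/-- The graph of the sum of the pushforwards on test functions, as a subspace. -/
def testGraph : Submodule ℂ (Lp ℂ 2 (Measure.pi μ) × Lp ℂ 2 (Measure.pi μ)) where
  carrier := {p | ∃ φ : (∀ i, G i) → ℂ, IsTestFunction (ModelWithCorners.pi I) φ ∧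
    p.1 =ᵐ[Measure.pi μ] φ ∧ p.2 =ᵐ[Measure.pi μ] sumPushforward I X φ}
  zero_mem' := by
    have h0 : IsTestFunction (ModelWithCorners.pi I) (fun _ : ∀ i, G i => (0 : ℂ)) :=
      ⟨contMDiff_const, HasCompactSupport.zero⟩
    refine ⟨fun _ => 0, h0, Lp.coeFn_zero _ _ _, ?_⟩
    have : sumPushforward I X (fun _ => 0) = fun _ => 0 := by
      ext x
      exact Finset.sum_eq_zero fun j _ => alongSumOfSquares_const _ _ _
    rw [this]
    exact Lp.coeFn_zero _ _ _
  add_mem' := by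
    rintro p q ⟨φ, hφ, h1, h2⟩ ⟨ψ, hψ, h3, h4⟩
    refine ⟨fun x => φ x + ψ x, hφ.add hψ, ?_, ?_⟩
    · exact (Lp.coeFn_add p.1 q.1).trans (h1.add h3)
    · have : sumPushforward I X (fun x => φ x + ψ x) =
          sumPushforward I X φ + sumPushforward I X ψ := by
        ext x
        simp only [_root_.sumPushforward, Pi.add_apply, ← Finset.sum_add_distrib]
        exact Finset.sum_congr rfl fun j _ =>
          alongSumOfSquares_add (smoothRightAction_mulSingle j) (X j) hφ.1 hψ.1 x
      rw [this]
      exact (Lp.coeFn_add p.2 q.2).trans (h2.add h4)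
  smul_mem' := by
    rintro c p ⟨φ, hφ, h1, h2⟩
    refine ⟨fun x => c * φ x, hφ.const_mul c, ?_, ?_⟩
    · exact (Lp.coeFn_smul c p.1).trans (h1.const_smul c)
    · have : sumPushforward I X (fun x => c * φ x) = c • sumPushforward I X φ := by
        ext x
        simp only [_root_.sumPushforward, Pi.smul_apply, smul_eq_mul, Finset.mul_sum]
        exact Finset.sum_congr rfl fun j _ =>
          alongSumOfSquares_const_mul (smoothRightAction_mulSingle j) (X j) hφ.1 c x
      rw [this]
      exact (Lp.coeFn_smul c p.2).trans (h2.const_smul c)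

/-- Presents the closed graph as a closed subspace, to which the totality argument of
`mulGraph_subset_of_total` applies. -/
theorem closureGraph_pi : (closureGraph (ModelWithCorners.pi I) (Measure.pi μ)
    (fun (f : (∀ i, G i) → ℂ) x => ∑ j, pushforwardOperator (MonoidHom.mulSingle G j)
      (sumOfSquares (I j) (X j)) f x)) = (((testGraph μ X).topologicalClosure :
      Submodule ℂ (Lp ℂ 2 (Measure.pi μ) × Lp ℂ 2 (Measure.pi μ))) : Set _) := by
  rw [Submodule.topologicalClosure_coe]
  refine congrArg closure (Set.ext fun p => ?_)
  constructor
  · rintro ⟨φ, hφ, h1, h2⟩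
    exact ⟨φ, hφ, h1, h2.trans (Filter.EventuallyEq.of_eq (sum_pushforwardOperator X hφ.1))⟩
  · rintro ⟨φ, hφ, h1, h2⟩
    exact ⟨φ, hφ, h1, h2.trans (Filter.EventuallyEq.of_eq (sum_pushforwardOperator X hφ.1).symm)⟩

/-- Tensor products of elements of the graphs of the closures belong to the graph of the closure of
the sum. -/
theorem tensorLp_mem_closure {u v : ∀ j, Lp ℂ 2 (μ j)}
    (h : ∀ j, (u j, v j) ∈ closureGraph (I j) (μ j) (sumOfSquares (I j) (X j))) :
    (tensorLp μ u, ∑ j, tensorLp μ (Function.update u j (v j))) ∈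
      (testGraph μ X).topologicalClosure := by
  -- The map is continuous because the tensor product is, and the closure of a product of sets is
  -- the product of the closures. Hence it suffices to treat test functions in each factor.
  set Ψ : (∀ j, Lp ℂ 2 (μ j) × Lp ℂ 2 (μ j)) → Lp ℂ 2 (Measure.pi μ) × Lp ℂ 2 (Measure.pi μ) :=
    fun p => (tensorLp μ fun j => (p j).1,
      ∑ j, tensorLp μ (Function.update (fun j => (p j).1) j (p j).2)) with hΨ
  have hΨc : Continuous Ψ := by
    refine Continuous.prodMk ((tensorLp μ).cont.comp (by fun_prop)) ?_
    refine continuous_finsetSum _ fun j _ => (tensorLp μ).cont.comp ?_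
    exact Continuous.update (by fun_prop) j (by fun_prop)
  have hmem : (fun j => (u j, v j)) ∈ closure (Set.univ.pi fun j =>
      {p : Lp ℂ 2 (μ j) × Lp ℂ 2 (μ j) | ∃ φ : G j → ℂ, IsTestFunction (I j) φ ∧
        p.1 =ᵐ[μ j] φ ∧ p.2 =ᵐ[μ j] sumOfSquares (I j) (X j) φ}) := by
    rw [closure_pi_set]
    exact fun j _ => h j
  refine show Ψ (fun j => (u j, v j)) ∈ closure (testGraph μ X : Set _) from
    map_mem_closure hΨc hmem fun p hp => ?_
  choose φ hφ h1 h2 using fun j => hp j trivial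
  refine ⟨_, IsTestFunction.tensor hφ, tensorLp_ae_eq_of_ae_eq h1, ?_⟩
  have h3 : ∀ j, tensorLp μ (Function.update (fun j => (p j).1) j (p j).2) =ᵐ[Measure.pi μ]
      alongSumOfSquares (I j) (MonoidHom.mulSingle G j) (X j) (fun x => ∏ i, φ i (x i)) := by
    intro j
    have h4 : ∀ i, (Function.update (fun j => (p j).1) j (p j).2 i : Lp ℂ 2 (μ i)) =ᵐ[μ i]
        Function.update φ j (sumOfSquares (I j) (X j) (φ j)) i := by
      intro i
      by_cases hi : i = j
      · subst hi; simpa using h2 i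
      · simpa only [Function.update_of_ne hi] using h1 i
    filter_upwards [tensorLp_ae_eq_of_ae_eq h4] with x hx
    rw [hx, alongSumOfSquares_tensor X fun i => (hφ i).1]
  filter_upwards [Lp.coeFn_fun_finsetSum Finset.univ fun j =>
    tensorLp μ (Function.update (fun j => (p j).1) j (p j).2), ae_all_iff.2 h3] with x h4 h5
  exact h4.trans (Finset.sum_congr rfl fun j _ => h5 j)

end PiSpectral

/-! ### Boxes on which the symbols are bounded -/

section Box

variable {ι : Type*} {Y : ι → Type*} [∀ i, MeasurableSpace (Y i)]
  {ν : ∀ i, Measure (Y i)} [∀ i, SigmaFinite (ν i)] {σ : ∀ i, Y i → ℝ}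

variable (ν σ) in
/-- An increasing sequence of sets of finite measure on which `σ i` is bounded. -/
def boundedBox (k : ℕ) (i : ι) : Set (Y i) := {ξ | |σ i ξ| ≤ k} ∩ spanningSets (ν i) k

theorem measurableSet_boundedBox (hσ : ∀ i, Measurable (σ i)) (k : ℕ) (i : ι) :
    MeasurableSet (boundedBox ν σ k i) :=
  (measurableSet_le (measurable_norm.comp (hσ i)) measurable_const).inter
    (measurableSet_spanningSets _ _)

theorem measure_ne_top_of_subset_boundedBox {k : ℕ} {i : ι} {s : Set (Y i)}
    (hs : s ⊆ boundedBox ν σ k i) : ν i s ≠ ⊤ :=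
  ((measure_mono (hs.trans Set.inter_subset_right)).trans_lt (measure_spanningSets_lt_top _ _)).ne

variable [Fintype ι]

theorem exists_forall_mem_boundedBox (ξ : ∀ i, Y i) : ∃ k, ∀ i, ξ i ∈ boundedBox ν σ k i := by
  obtain ⟨k, hk⟩ : ∃ k : ℕ, ∀ i, |σ i (ξ i)| ≤ k := by
    obtain ⟨k, hk⟩ := exists_nat_ge (∑ i, |σ i (ξ i)|)
    exact ⟨k, fun i => (Finset.single_le_sum (f := fun i => |σ i (ξ i)|)
      (fun i _ => abs_nonneg _) (Finset.mem_univ i)).trans hk⟩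
  refine ⟨max k (Finset.univ.sup fun i => spanningSetsIndex (ν i) (ξ i)), fun i => ⟨?_, ?_⟩⟩
  · exact (hk i).trans (by exact_mod_cast le_max_left _ _)
  · exact monotone_spanningSets (ν i)
      ((Finset.le_sup (f := fun i => spanningSetsIndex (ν i) (ξ i)) (Finset.mem_univ i)).trans
        (le_max_right _ _)) (mem_spanningSetsIndex _ _)

theorem integrableOn_of_subset_boundedBox {k : ℕ} {s : ∀ i, Set (Y i)}
    (hs : ∀ i, s i ⊆ boundedBox ν σ k i) (f : Lp ℂ 2 (Measure.pi ν)) :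
    IntegrableOn f (Set.univ.pi s) (Measure.pi ν) := by
  haveI : IsFiniteMeasure ((Measure.pi ν).restrict (Set.univ.pi s)) := by
    refine ⟨?_⟩
    rw [Measure.restrict_apply_univ, Measure.pi_pi]
    exact lt_top_iff_ne_top.2
      (ENNReal.prod_ne_top fun i _ => measure_ne_top_of_subset_boundedBox (hs i))
  exact ((Lp.memLp f).restrict _).integrable (by norm_num)

theorem integrableOn_mul_of_subset_boundedBox (hσ : ∀ i, Measurable (σ i)) {k : ℕ}
    {s : ∀ i, Set (Y i)} (hsm : ∀ i, MeasurableSet (s i)) (hs : ∀ i, s i ⊆ boundedBox ν σ k i)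
    (j : ι) (f : Lp ℂ 2 (Measure.pi ν)) :
    IntegrableOn (fun ξ => (σ j (ξ j) : ℂ) * f ξ) (Set.univ.pi s) (Measure.pi ν) := by
  have hσm : Measurable fun ξ : ∀ i, Y i => (σ j (ξ j) : ℂ) :=
    Complex.measurable_ofReal.comp ((hσ j).comp (measurable_pi_apply j))
  refine Integrable.bdd_mul (c := (k : ℝ)) (integrableOn_of_subset_boundedBox hs f)
    hσm.aestronglyMeasurable ?_
  refine (ae_restrict_iff' (MeasurableSet.univ_pi hsm)).2 (Filter.Eventually.of_forall fun ξ hξ => ?_)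
  have := (hs j (hξ j trivial)).1
  simpa using this

/-- Indicator functions of subsets of a box correspond to elements of the domain. -/
theorem SpectralRepresentation.exists_mem_indicator {𝓗 : Type*} [NormedAddCommGroup 𝓗]
    [InnerProductSpace ℂ 𝓗] {T : Set (𝓗 × 𝓗)} (R : SpectralRepresentation T) {s : Set R.carrier}
    (hs : MeasurableSet s) (hst : R.ν s ≠ ⊤) {k : ℕ} (hk : ∀ ξ ∈ s, |R.symbol ξ| ≤ k) :
    ∃ u v : 𝓗, (u, v) ∈ T ∧ R.U u = indicatorConstLp 2 hs hst (1 : ℂ) := by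
  have hqm : MemLp (fun ξ => (R.symbol ξ : ℂ) * indicatorConstLp 2 hs hst (1 : ℂ) ξ) 2 R.ν := by
    refine (Lp.memLp (indicatorConstLp 2 hs hst (1 : ℂ))).of_le_mul (c := (k : ℝ))
      ((Complex.measurable_ofReal.comp R.measurable_symbol).aestronglyMeasurable.mul
        (Lp.aestronglyMeasurable _)) ?_
    filter_upwards [indicatorConstLp_one_ae_eq hs hst] with ξ hξ
    rw [norm_mul]
    by_cases h : ξ ∈ s
    · have := hk ξ h
      gcongr
      simpa using this
    · rw [hξ, Set.indicator_of_notMem h]; simp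
  exact ⟨_, _, R.exists_mem _ hqm, by simp⟩

end Box

/-! ### The closure of the sum is the full multiplication operator -/

section FinSpectral

variable {m : ℕ} {E H : Fin (m + 1) → Type*} [∀ i, NormedAddCommGroup (E i)]
  [∀ i, NormedSpace ℝ (E i)] [∀ i, TopologicalSpace (H i)]
  {I : ∀ i, ModelWithCorners ℝ (E i) (H i)} {G : Fin (m + 1) → Type*} [∀ i, TopologicalSpace (G i)]
  [∀ i, ChartedSpace (H i) (G i)] [∀ i, Group (G i)] [∀ i, LieGroup (I i) ∞ (G i)]
  [∀ i, FiniteDimensional ℝ (E i)]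
  [∀ i, T2Space (G i)] [∀ i, SecondCountableTopology (G i)] [∀ i, SigmaCompactSpace (G i)]
  [∀ i, MeasurableSpace (G i)] [∀ i, BorelSpace (G i)] {μ : ∀ i, Measure (G i)}
  [∀ i, SigmaFinite (μ i)] [∀ i, IsLocallyFiniteMeasure (μ i)]
  {κ : Fin (m + 1) → Type*} [∀ j, Fintype (κ j)] {X : ∀ j, κ j → GroupLieAlgebra (I j) (G j)}

/-- Symmetry of `L j` applied slice by slice: with the other variables frozen, `φ` is a test
function on `G j`, and `g j` is only required to lie in the domain of the closure. -/
theorem inner_tensorLp_alongSumOfSquares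
    (R : ∀ j, SpectralRepresentation (closureGraph (I j) (μ j) (sumOfSquares (I j) (X j)))) {j : Fin (m + 1)} {g : ∀ i, Lp ℂ 2 (μ i)}
    {v : Lp ℂ 2 (μ j)} (hv : (g j, v) ∈ closureGraph (I j) (μ j) (sumOfSquares (I j) (X j)))
    {φ : (∀ i, G i) → ℂ} (hφ : IsTestFunction (ModelWithCorners.pi I) φ)
    {w w' : Lp ℂ 2 (Measure.pi μ)} (hw : w =ᵐ[Measure.pi μ] φ) (hw' : w' =ᵐ[Measure.pi μ]
      alongSumOfSquares (I j) (MonoidHom.mulSingle G j) (X j) φ) :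
    inner ℂ (tensorLp μ g) w' = inner ℂ (tensorLp μ (Function.update g j v)) w := by
  rw [← sub_eq_zero, L2.inner_def, L2.inner_def,
    ← integral_sub (L2.integrable_inner _ _) (L2.integrable_inner _ _)]
  set f : (∀ i, G i) → ℂ := fun x =>
    (∏ i ∈ Finset.univ.erase j, starRingEnd ℂ (g i (x i))) *
    (starRingEnd ℂ (g j (x j)) * alongSumOfSquares (I j) (MonoidHom.mulSingle G j) (X j) φ x -
      starRingEnd ℂ (v (x j)) * φ x) with hf
  have hfe : (fun x => inner ℂ (tensorLp μ g x) (w' x) -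
      inner ℂ (tensorLp μ (Function.update g j v) x) (w x)) =ᵐ[Measure.pi μ] f := by
    filter_upwards [hw, hw', tensorLp_ae_eq g, tensorLp_ae_eq (Function.update g j v)]
      with x h1 h2 h3 h4
    rw [h1, h2, h3, h4, ← Finset.prod_erase_mul _ _ (Finset.mem_univ j),
      ← Finset.prod_erase_mul _ _ (Finset.mem_univ j)]
    have : ∏ i ∈ Finset.univ.erase j, (Function.update g j v i : Lp ℂ 2 (μ i)) (x i) =
        ∏ i ∈ Finset.univ.erase j, g i (x i) := Finset.prod_congr rfl fun i hi => by
      rw [Function.update_of_ne (Finset.ne_of_mem_erase hi)]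
    rw [this, Function.update_self]
    simp only [RCLike.inner_apply, map_mul, map_prod, hf]
    ring
  rw [integral_congr_ae hfe]
  have hfi : Integrable f (Measure.pi μ) :=
    ((L2.integrable_inner _ _).sub (L2.integrable_inner _ _)).congr hfe
  refine integral_pi_eq_zero_of_forall_slice j hfi fun x => ?_
  have hs := hφ.slice j x
  have e : ∀ y, f (Function.update x j y) =
      (∏ i ∈ Finset.univ.erase j, starRingEnd ℂ (g i (x i))) *
      (starRingEnd ℂ (g j y) * sumOfSquares (I j) (X j) (fun y => φ (Function.update x j y)) y -
        starRingEnd ℂ (v y) * φ (Function.update x j y)) := by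
    intro y
    simp only [hf, Function.update_self, sumOfSquares_slice X hφ.1 j x y]
    congr 1
    refine Finset.prod_congr rfl fun i hi => ?_
    rw [Function.update_of_ne (Finset.ne_of_mem_erase hi)]
  simp only [e]
  have h1 := (R j).inner_symm hv (toLp_mem_closureGraph (μ := μ j) (X j) hs)
  have hi : ∀ (a : Lp ℂ 2 (μ j)) {ψ : G j → ℂ} (hψ : MemLp ψ 2 (μ j)),
      inner ℂ a (hψ.toLp ψ) = ∫ y, starRingEnd ℂ (a y) * ψ y ∂μ j := by
    intro a ψ hψ
    have := inner_toLp (Lp.memLp a) hψ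
    rwa [Lp.toLp_coeFn] at this
  rw [hi, hi] at h1
  have hI : ∀ (a : Lp ℂ 2 (μ j)) {ψ : G j → ℂ} (hψ : MemLp ψ 2 (μ j)),
      Integrable (fun y => starRingEnd ℂ (a y) * ψ y) (μ j) := fun a ψ hψ =>
    (Lp.memLp a).star.integrable_mul hψ
  rw [integral_const_mul, integral_sub (hI _ ((hs.sumOfSquares (X j)).memLp 2))
    (hI _ (hs.memLp 2)), h1, sub_self, mul_zero]

variable {R : ∀ j, SpectralRepresentation (closureGraph (I j) (μ j) (sumOfSquares (I j) (X j)))}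
  {V : Lp ℂ 2 (Measure.pi μ) ≃ₗᵢ[ℂ] Lp ℂ 2 (Measure.pi fun j => (R j).ν)}

/-- A general test function is not a tensor, so the identity is tested weakly. Indicators of
rectangles inside a box are images under `V` of tensors of domain elements, on which the symmetry
above moves the operator and yields the factor `σ j`. -/
theorem ae_eq_of_alongSumOfSquares
    (hV : ∀ f, V (tensorLp μ f) = tensorLp (fun j => (R j).ν) fun i => (R i).U (f i)) {j : Fin (m + 1)}
    {φ : (∀ i, G i) → ℂ} (hφ : IsTestFunction (ModelWithCorners.pi I) φ)
    {w w' : Lp ℂ 2 (Measure.pi μ)} (hw : w =ᵐ[Measure.pi μ] φ) (hw' : w' =ᵐ[Measure.pi μ]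
      alongSumOfSquares (I j) (MonoidHom.mulSingle G j) (X j) φ) :
    V w' =ᵐ[Measure.pi fun j => (R j).ν] fun ξ => ((R j).symbol (ξ j) : ℂ) * V w ξ := by
  have hσ : ∀ i, Measurable (R i).symbol := fun i => (R i).measurable_symbol
  have hbox := measurableSet_boundedBox (ν := fun j => (R j).ν) hσ
  have h0 : (fun ξ => V w' ξ - ((R j).symbol (ξ j) : ℂ) * V w ξ) =ᵐ[Measure.pi fun j => (R j).ν] 0 := by
    refine ae_eq_zero_of_forall_setIntegral_rectangle
      (boundedBox (fun j => (R j).ν) fun j => (R j).symbol) hbox exists_forall_mem_boundedBox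
      (fun k => ?_) fun k s hsm hs => ?_
    · exact (integrableOn_of_subset_boundedBox (fun i => subset_rfl) _).sub
        (integrableOn_mul_of_subset_boundedBox hσ (hbox k) (fun i => subset_rfl) j _)
    · rw [integral_sub (integrableOn_of_subset_boundedBox hs _)
        (integrableOn_mul_of_subset_boundedBox hσ hsm hs j _), sub_eq_zero]
      have hst : ∀ i, (R i).ν (s i) ≠ ⊤ := fun i => measure_ne_top_of_subset_boundedBox (hs i)
      choose g v hgv hg using fun i =>
        (R i).exists_mem_indicator (hsm i) (hst i) (k := k) fun ξ hξ => (hs i hξ).1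
      have hin := inner_tensorLp_alongSumOfSquares R (hgv j) hφ hw hw'
      have hVg : V (tensorLp μ g) =
          tensorLp (fun j => (R j).ν) fun i => indicatorConstLp 2 (hsm i) (hst i) (1 : ℂ) := by
        rw [hV]; simp only [hg]
      have hup := tensor_update_multiplier (g := g) hV (((R j).mem_iff _ _).1 (hgv j))
      rw [← V.inner_map_map, ← V.inner_map_map (tensorLp μ (Function.update g j _)), hVg,
        L2.inner_def, L2.inner_def, integral_inner_tensorLp_indicator _ hsm hst] at hin
      rw [hin, ← integral_inner_tensorLp_indicator _ hsm hst]
      refine integral_congr_ae ?_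
      filter_upwards [hup] with ξ h1
      rw [h1, hVg]
      simp only [RCLike.inner_apply, map_mul, Complex.conj_ofReal]
      ring
  filter_upwards [h0] with ξ hξ
  exact sub_eq_zero.1 hξ

theorem ae_eq_of_mem_testGraph
    (hV : ∀ f, V (tensorLp μ f) = tensorLp (fun j => (R j).ν) fun i => (R i).U (f i))
    {p : Lp ℂ 2 (Measure.pi μ) × Lp ℂ 2 (Measure.pi μ)} (hp : p ∈ testGraph μ X) :
    V p.2 =ᵐ[Measure.pi fun j => (R j).ν]
      fun ξ => ((∑ j, (R j).symbol (ξ j) : ℝ) : ℂ) * V p.1 ξ := by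
  obtain ⟨φ, hφ, h1, h2⟩ := hp
  set w' : Fin (m + 1) → Lp ℂ 2 (Measure.pi μ) := fun j =>
    ((hφ.alongSumOfSquares (smoothRightAction_mulSingle j) (X j)).memLp_pi 2).toLp _ with hw'
  have hw'e : ∀ j, w' j =ᵐ[Measure.pi μ] alongSumOfSquares (I j) (MonoidHom.mulSingle G j) (X j) φ :=
    fun j => MemLp.coeFn_toLp _
  have hp2 : p.2 = ∑ j, w' j := by
    apply Lp.ext
    filter_upwards [h2, Lp.coeFn_fun_finsetSum Finset.univ w', ae_all_iff.2 hw'e] with x h3 h4 h5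
    rw [h3, h4]
    exact (Finset.sum_congr rfl fun j _ => h5 j).symm
  rw [hp2, map_sum]
  filter_upwards [Lp.coeFn_fun_finsetSum Finset.univ fun j => V (w' j),
    ae_all_iff.2 fun j => ae_eq_of_alongSumOfSquares hV hφ h1 (hw'e j)] with ξ h3 h4
  rw [h3, Finset.sum_congr rfl fun j _ => h4 j, ← Finset.sum_mul, Complex.ofReal_sum]

/-- Essential self-adjointness. Tensors of spectrally bounded elements lie in the closed graph, and
the vectors `(σ + i) 1_Q`, for rectangles `Q` in the boxes, are total. -/
theorem mem_closure_of_ae_eq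
    (hV : ∀ f, V (tensorLp μ f) = tensorLp (fun j => (R j).ν) fun i => (R i).U (f i))
    {u v : Lp ℂ 2 (Measure.pi μ)} (huv : V v =ᵐ[Measure.pi fun j => (R j).ν]
      fun ξ => ((∑ j, (R j).symbol (ξ j) : ℝ) : ℂ) * V u ξ) :
    (u, v) ∈ (testGraph μ X).topologicalClosure := by
  have hσ : ∀ i, Measurable (R i).symbol := fun i => (R i).measurable_symbol
  have hbox := measurableSet_boundedBox (ν := fun j => (R j).ν) hσ
  have hσm : Measurable fun ξ : ∀ i, (R i).carrier => ∑ j, (R j).symbol (ξ j) :=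
    Finset.measurable_fun_sum _ fun j _ => (hσ j).comp (measurable_pi_apply j)
  set α := Σ k : ℕ, {s : ∀ i, Set (R i).carrier // (∀ i, MeasurableSet (s i)) ∧
    ∀ i, s i ⊆ boundedBox (fun j => (R j).ν) (fun j => (R j).symbol) k i}
  have hst : ∀ (a : α) i, (R i).ν (a.2.1 i) ≠ ⊤ := fun a i =>
    measure_ne_top_of_subset_boundedBox (a.2.2.2 i)
  choose g v' hgv hg using fun (a : α) i => (R i).exists_mem_indicator (a.2.2.1 i) (hst a i)
    (k := a.1) fun ξ hξ => (a.2.2.2 i hξ).1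
  have hVg : ∀ a, V (tensorLp μ (g a)) =
      tensorLp (fun j => (R j).ν) fun i => indicatorConstLp 2 (a.2.2.1 i) (hst a i) (1 : ℂ) := by
    intro a
    rw [hV]; simp only [hg]
  have hb : ∀ a, V (∑ j, tensorLp μ (Function.update (g a) j (v' a j))) =ᵐ[Measure.pi fun j => (R j).ν]
      fun ξ => ((∑ j, (R j).symbol (ξ j) : ℝ) : ℂ) * V (tensorLp μ (g a)) ξ := by
    intro a
    rw [map_sum]
    filter_upwards [Lp.coeFn_fun_finsetSum Finset.univ fun j =>
      V (tensorLp μ (Function.update (g a) j (v' a j))), ae_all_iff.2 fun j =>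
        tensor_update_multiplier (g := g a) hV (((R j).mem_iff _ _).1 (hgv a j))] with ξ h3 h4
    rw [h3, Finset.sum_congr rfl fun j _ => h4 j, ← Finset.sum_mul, Complex.ofReal_sum]
  refine mulGraph_subset_of_total V hσm (testGraph μ X).topologicalClosure
    (testGraph μ X).isClosed_topologicalClosure (fun a => tensorLp μ (g a)) _
    (fun a => tensorLp_mem_closure (hgv a)) hb (fun f hf => ?_) huv
  -- Orthogonality to `(σ + i) 1_Q` says that `(σ - i) f` has zero integral over `Q`. Thus `(σ - i)
  -- f = 0`, and `σ - i` never vanishes.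
  have h0 : (fun ξ => ((∑ j, (R j).symbol (ξ j) : ℝ) - Complex.I) * f ξ)
      =ᵐ[Measure.pi fun j => (R j).ν] 0 := by
    have hI : ∀ {k : ℕ} {s : ∀ i, Set (R i).carrier}, (∀ i, MeasurableSet (s i)) →
        (∀ i, s i ⊆ boundedBox (fun j => (R j).ν) (fun j => (R j).symbol) k i) →
        IntegrableOn (fun ξ => ((∑ j, (R j).symbol (ξ j) : ℝ) - Complex.I) * f ξ)
          (Set.univ.pi s) (Measure.pi fun j => (R j).ν) := by
      intro k s hsm hs
      have h1 := (integrable_finsetSum Finset.univ fun j _ =>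
        integrableOn_mul_of_subset_boundedBox hσ hsm hs j f).sub
          ((integrableOn_of_subset_boundedBox hs f).const_mul Complex.I)
      refine h1.congr (Filter.Eventually.of_forall fun ξ => ?_)
      simp [sub_mul, Finset.sum_mul]
    refine ae_eq_zero_of_forall_setIntegral_rectangle
      (boundedBox (fun j => (R j).ν) fun j => (R j).symbol) hbox exists_forall_mem_boundedBox
      (fun k => hI (hbox k) fun i => subset_rfl) fun k s hsm hs => ?_
    have h1 := hf ⟨k, s, hsm, hs⟩
    rw [L2.inner_def] at h1
    rw [← integral_inner_tensorLp_indicator _ hsm (hst ⟨k, s, hsm, hs⟩), ← h1]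
    refine integral_congr_ae ?_
    filter_upwards [hb ⟨k, s, hsm, hs⟩, Lp.coeFn_add
      (V (∑ j, tensorLp μ (Function.update (g ⟨k, s, hsm, hs⟩) j (v' ⟨k, s, hsm, hs⟩ j))))
      (Complex.I • V (tensorLp μ (g ⟨k, s, hsm, hs⟩))),
      Lp.coeFn_smul Complex.I (V (tensorLp μ (g ⟨k, s, hsm, hs⟩)))] with ξ h2 h3 h4
    rw [h3, Pi.add_apply, h2, h4, Pi.smul_apply, hVg]
    simp only [RCLike.inner_apply, map_mul, map_add, Complex.conj_ofReal, smul_eq_mul, Complex.conj_I]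
    ring
  apply Lp.ext
  filter_upwards [h0, Lp.coeFn_zero ℂ 2 (Measure.pi fun j => (R j).ν)] with ξ h1 h2
  rw [h2]
  refine (mul_eq_zero.1 h1).resolve_left fun h => ?_
  simpa using congrArg Complex.im h

theorem mem_closure_iff_ae_eq
    (hV : ∀ f, V (tensorLp μ f) = tensorLp (fun j => (R j).ν) fun i => (R i).U (f i))
    {u v : Lp ℂ 2 (Measure.pi μ)} :
    (u, v) ∈ (testGraph μ X).topologicalClosure ↔ V v =ᵐ[Measure.pi fun j => (R j).ν]
      fun ξ => ((∑ j, (R j).symbol (ξ j) : ℝ) : ℂ) * V u ξ := by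
  refine ⟨fun h => ?_, mem_closure_of_ae_eq hV⟩
  have hσm : Measurable fun ξ : ∀ i, (R i).carrier => ∑ j, (R j).symbol (ξ j) :=
    Finset.measurable_fun_sum _ fun j _ => (R j).measurable_symbol.comp (measurable_pi_apply j)
  have hcl := (isClosed_mulGraph (ρ := Measure.pi fun j => (R j).ν) hσm).preimage
    (V.continuous.prodMap V.continuous)
  exact closure_minimal (fun p hp => ae_eq_of_mem_testGraph hV hp) hcl h

end FinSpectral

/-! ### Convolution kernels on products -/

section Limit

variable {E H : Type*} [NormedAddCommGroup E] [NormedSpace ℝ E] [FiniteDimensional ℝ E]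
  [TopologicalSpace H] {I : ModelWithCorners ℝ E H} {G : Type*} [TopologicalSpace G]
  [ChartedSpace H G] [Group G] [MeasurableSpace G] {μ : Measure G}
  {Ω : Type*} [MeasurableSpace Ω] {ν : Measure Ω} {U : Lp ℂ 2 μ ≃ₗᵢ[ℂ] Lp ℂ 2 ν}
  [T2Space G] [SigmaCompactSpace G] [LocallyCompactSpace G] [IsTopologicalGroup G]
  [SecondCountableTopology G] [BorelSpace G] [SigmaFinite μ]
  [μ.IsMulLeftInvariant] [IsFiniteMeasureOnCompacts μ]

/-- A limit of convolution kernels in `L²` is the kernel of the limit of the multipliers. -/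
theorem IsMultiplierKernel.of_tendsto {M : ℕ → Ω → ℂ} {M' : Ω → ℂ} {k : ℕ → G → ℂ} {k' : G → ℂ}
    (hk : ∀ i, MemLp (k i) 2 μ) (hk' : MemLp k' 2 μ) (h : ∀ i, IsMultiplierKernel I U (M i) (k i))
    (hkk : Filter.Tendsto (fun i => eLpNorm (fun x => k i x - k' x) 2 μ) Filter.atTop (nhds 0))
    (hM : ∀ᵐ ξ ∂ν, Filter.Tendsto (fun i => M i ξ) Filter.atTop (nhds (M' ξ))) :
    IsMultiplierKernel I U M' k' := by
  intro φ hφ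
  have hφ1 := hφ.memLp (μ := μ) 1
  have hφ2 := hφ.memLp (μ := μ) 2
  refine ⟨hφ2.toLp φ, (memLp_groupConv hφ1 hk').toLp _, hφ2.coeFn_toLp, MemLp.coeFn_toLp _, ?_⟩
  have h1 : Filter.Tendsto (fun i => (memLp_groupConv hφ1 (hk i)).toLp _) Filter.atTop
      (nhds ((memLp_groupConv hφ1 hk').toLp _)) := by
    rw [Lp.tendsto_Lp_iff_tendsto_eLpNorm'']
    have h2 : Filter.Tendsto (fun i => eLpNorm φ 1 μ * eLpNorm (fun x => k i x - k' x) 2 μ)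
        Filter.atTop (nhds 0) := by
      simpa using ENNReal.Tendsto.const_mul hkk (Or.inr hφ1.2.ne)
    refine tendsto_of_tendsto_of_tendsto_of_le_of_le tendsto_const_nhds h2 (fun _ => zero_le) fun i => ?_
    refine le_trans (le_of_eq ?_) (eLpNorm_groupConv_le hφ1.1 ((hk i).sub hk').1)
    exact eLpNorm_congr_ae (groupConv_sub hφ1 (hk i) hk').symm
  have h2 := (U.continuous.tendsto _).comp h1
  -- The `L²` limit and the pointwise limit of the multipliers are compared along an almost
  -- everywhere convergent subsequence.
  obtain ⟨ns, hns, hae⟩ := (tendstoInMeasure_of_tendsto_Lp h2).exists_seq_tendsto_ae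
  have h3 := fun i => (h i).apply_eq hφ hφ2.coeFn_toLp (memLp_groupConv hφ1 (hk i)).coeFn_toLp
  filter_upwards [hae, hM, ae_all_iff.2 h3] with ξ h4 h5 h6
  refine tendsto_nhds_unique h4 ?_
  refine (((h5.comp hns.tendsto_atTop).mul_const _)).congr fun i => ?_
  exact (h6 (ns i)).symm

end Limit

/-! ### Tensor products of kernels -/

section PiKernel

variable {ι : Type*} [Fintype ι] {E H : ι → Type*} [∀ i, NormedAddCommGroup (E i)]
  [∀ i, NormedSpace ℝ (E i)] [∀ i, TopologicalSpace (H i)]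
  {I : ∀ i, ModelWithCorners ℝ (E i) (H i)} {G : ι → Type*} [∀ i, TopologicalSpace (G i)]
  [∀ i, ChartedSpace (H i) (G i)] [∀ i, Group (G i)] [∀ i, IsManifold (I i) ∞ (G i)]
  [∀ i, FiniteDimensional ℝ (E i)] [∀ i, IsTopologicalGroup (G i)] [∀ i, LocallyCompactSpace (G i)]
  [∀ i, T2Space (G i)] [∀ i, SecondCountableTopology (G i)] [∀ i, SigmaCompactSpace (G i)]
  [∀ i, MeasurableSpace (G i)] [∀ i, BorelSpace (G i)] {μ : ∀ i, Measure (G i)}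
  [∀ i, SigmaFinite (μ i)] [∀ i, IsLocallyFiniteMeasure (μ i)] [∀ i, (μ i).IsMulLeftInvariant]
  {Y : ι → Type*} [∀ i, MeasurableSpace (Y i)] {ν : ∀ i, Measure (Y i)} [∀ i, SigmaFinite (ν i)]
  {U : ∀ i, Lp ℂ 2 (μ i) ≃ₗᵢ[ℂ] Lp ℂ 2 (ν i)}
  {V : Lp ℂ 2 (Measure.pi μ) ≃ₗᵢ[ℂ] Lp ℂ 2 (Measure.pi ν)}

theorem convAdjoint_tensor (k : ∀ i, G i → ℂ) (g : ∀ i, Lp ℂ 2 (μ i)) (y : ∀ i, G i) :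
    convAdjoint (Measure.pi μ) (fun x => ∏ i, k i (x i)) (tensorLp μ g) y =
      ∏ i, convAdjoint (μ i) (k i) (g i) (y i) := by
  simp only [convAdjoint]
  rw [← integral_fintype_prod_eq_prod]
  refine integral_congr_ae ?_
  filter_upwards [tensorLp_ae_eq g] with x hx
  rw [hx, map_prod, ← Finset.prod_mul_distrib]
  rfl

/-- The tensor product of convolution kernels is the kernel of the tensor product of the
multipliers. -/
theorem IsMultiplierKernel.pi (hV : ∀ f, V (tensorLp μ f) = tensorLp ν fun i => U i (f i))
    {m : ∀ i, Y i → ℂ} (hm : ∀ i, AEStronglyMeasurable (m i) (ν i)) {C : ι → ℝ}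
    (hC : ∀ i ξ, ‖m i ξ‖ ≤ C i) {k : ∀ i, G i → ℂ} (hk : ∀ i, MemLp (k i) 2 (μ i))
    (h : ∀ i, IsMultiplierKernel (I i) (U i) (m i) (k i)) :
    IsMultiplierKernel (ModelWithCorners.pi I) V (fun ξ => ∏ i, m i (ξ i))
      (fun x => ∏ i, k i (x i)) := by
  intro φ hφ
  have hφ1 := hφ.memLp_pi (μ := μ) 1
  have hφ2 := hφ.memLp_pi (μ := μ) 2
  refine ⟨hφ2.toLp φ, (memLp_groupConv hφ1 (MemLp.tensor hk)).toLp _, hφ2.coeFn_toLp,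
    MemLp.coeFn_toLp _, ?_⟩
  have hCs : ∀ i ξ, ‖starRingEnd ℂ (m i ξ)‖ ≤ C i := fun i ξ => (RCLike.norm_conj _).trans_le (hC i ξ)
  have hms : ∀ i, AEStronglyMeasurable (fun ξ => starRingEnd ℂ (m i ξ)) (ν i) := fun i => (hm i).star
  -- `b i g` is the adjoint operator, with multiplier the conjugate of `m i`, applied to `g`. On
  -- tensors both the adjoint multiplier and `convAdjoint` factorize, so the one-factor identities
  -- can be multiplied.
  choose b hb using fun (i : ι) (g : Lp ℂ 2 (μ i)) =>
    exists_multiplier_apply (hms i)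
      (hCs i) (U i) g
  have hC' : ∀ ξ : ∀ i, Y i, ‖∏ i, m i (ξ i)‖ ≤ ∏ i, C i := fun ξ => by
    rw [norm_prod]
    exact Finset.prod_le_prod (fun _ _ => norm_nonneg _) fun i _ => hC i _
  have hB : ∀ g : ∀ i, Lp ℂ 2 (μ i), V (tensorLp μ fun i => b i (g i)) =ᵐ[Measure.pi ν]
      fun ξ => starRingEnd ℂ (∏ i, m i (ξ i)) * V (tensorLp μ g) ξ := fun g => by
    simp only [map_prod]
    exact tensor_multiplier (m := fun i ξ => starRingEnd ℂ (m i ξ)) (g := g)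
      (v := fun i => b i (g i)) hV fun i => hb i (g i)
  have hA : ∀ g : ∀ i, Lp ℂ 2 (μ i),
      convAdjoint (Measure.pi μ) (fun x => ∏ i, k i (x i)) (tensorLp μ g) =ᵐ[Measure.pi μ]
        fun y => starRingEnd ℂ (tensorLp μ (fun i => b i (g i)) y) := fun g => by
    filter_upwards [ae_pi_of_forall_ae fun i => (h i).convAdjoint_eq (hk i) (hb i (g i)),
      tensorLp_ae_eq fun i => b i (g i)] with y h1 h2
    rw [convAdjoint_tensor, h2, map_prod]
    exact Finset.prod_congr rfl fun i _ => h1 i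
  exact multiplier_groupConv_of_convAdjoint (μ := Measure.pi μ) (ν := Measure.pi ν) (U := V)
    (m := fun ξ => ∏ i, m i (ξ i)) (k := fun x => ∏ i, k i (x i)) (C := ∏ i, C i)
    (aestronglyMeasurable_tensor hm) hC' (MemLp.tensor hk)
    (ψ := fun g : ∀ i, Lp ℂ 2 (μ i) => tensorLp μ g)
    (B := fun g => tensorLp μ fun i => b i (g i))
    (fun u hu => eq_zero_of_forall_inner_tensorLp hu) hB hA hφ1 hφ2

end PiKernel

/-! ### Absolute continuity of the distribution of the summed symbol -/

section SumSymbol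

variable {m : ℕ} {Y : Fin (m + 1) → Type*} [∀ i, MeasurableSpace (Y i)] {ν : ∀ i, Measure (Y i)}
  [∀ i, SigmaFinite (ν i)] {σ : ∀ i, Y i → ℝ}

/-- Absolute continuity in a single factor suffices: with the other coordinates fixed, the condition
on `σ j` is membership in a translate of `N`, again a null set. -/
theorem measure_pi_sum_preimage_eq_zero (hσ : ∀ i, Measurable (σ i)) (j : Fin (m + 1))
    (h : ∀ N : Set ℝ, MeasurableSet N → volume N = 0 → ν j (σ j ⁻¹' N) = 0) {N : Set ℝ}
    (hN : MeasurableSet N) (hN0 : volume N = 0) :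
    Measure.pi ν {ξ | ∑ i, σ i (ξ i) ∈ N} = 0 := by
  have hm : MeasurableSet {ξ : ∀ i, Y i | ∑ i, σ i (ξ i) ∈ N} :=
    (Finset.measurable_fun_sum _ fun i _ => (hσ i).comp (measurable_pi_apply i)) hN
  have he := (measurePreserving_piFinSuccAbove ν j).symm
  rw [← he.measure_preimage_equiv, Measure.prod_apply_symm (he.measurable hm)]
  refine (lintegral_congr fun z => ?_).trans lintegral_zero
  have : (fun y => (y, z)) ⁻¹' ((MeasurableEquiv.piFinSuccAbove Y j).symm ⁻¹'
      {ξ : ∀ i, Y i | ∑ i, σ i (ξ i) ∈ N}) =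
      σ j ⁻¹' ((fun x => x + ∑ i, σ (j.succAbove i) (z i)) ⁻¹' N) := by
    ext y
    simp [Fin.sum_univ_succAbove _ j]
  rw [this]
  exact h _ (measurable_id.add_const _ hN) (by rw [measure_preimage_add_right, hN0])

theorem ae_pi_sum (hσ : ∀ i, Measurable (σ i)) (j : Fin (m + 1))
    (h : ∀ N : Set ℝ, MeasurableSet N → volume N = 0 → ν j (σ j ⁻¹' N) = 0) {p : ℝ → Prop}
    (hp : ∀ᵐ x, p x) : ∀ᵐ ξ ∂Measure.pi ν, p (∑ i, σ i (ξ i)) := by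
  have h0 := measure_pi_sum_preimage_eq_zero hσ j h
    (measurableSet_toMeasurable volume {x | ¬ p x}) (by rw [measure_toMeasurable]; exact hp)
  rw [ae_iff]
  refine measure_mono_null (fun ξ hξ => ?_) h0
  exact subset_toMeasurable volume {x | ¬ p x} hξ

end SumSymbol

/-! ### Series of kernels -/

section Bessel

theorem norm_sq_le_of_enorm_sq_le {𝓗 : Type*} [SeminormedAddCommGroup 𝓗] {x : 𝓗} {D : ℝ≥0}
    {T : Finset ℤ} {b : ℤ → ℂ} (h : ‖x‖ₑ ^ 2 ≤ D * ∑ m ∈ T, ‖b m‖ₑ ^ 2) :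
    ‖x‖ ^ 2 ≤ D * ∑ m ∈ T, ‖b m‖ ^ 2 := by
  simp only [enorm_eq_nnnorm] at h
  have h' : ‖x‖₊ ^ 2 ≤ D * ∑ m ∈ T, ‖b m‖₊ ^ 2 := by exact_mod_cast h
  have h2 := NNReal.coe_le_coe.2 h'
  push_cast at h2
  exact h2

/-- The Bessel bound on finite sums gives the Cauchy criterion from square-summability of the
coefficients, and survives in the limit. -/
theorem hasSum_of_bessel {𝓗 : Type*} [NormedAddCommGroup 𝓗] [NormedSpace ℂ 𝓗] [CompleteSpace 𝓗]
    {t : ℤ → 𝓗} {B : ℝ} (hB : 0 ≤ B)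
    (h : ∀ (T : Finset ℤ) (a : ℤ → ℂ), ‖∑ m ∈ T, a m • t m‖ ^ 2 ≤ B * ∑ m ∈ T, ‖a m‖ ^ 2)
    {a : ℤ → ℂ} (ha : ∑' m, ‖a m‖ₑ ^ 2 ≠ ⊤) :
    ∃ g : 𝓗, HasSum (fun m => a m • t m) g ∧ ‖g‖ₑ ^ 2 ≤ ENNReal.ofReal B * ∑' m, ‖a m‖ₑ ^ 2 := by
  have ha' : Summable fun m => ‖a m‖ ^ 2 := by
    have h1 : Summable fun m => ‖a m‖₊ ^ 2 := by
      rw [← ENNReal.tsum_coe_ne_top_iff_summable]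
      simpa [enorm_eq_nnnorm] using ha
    have h2 := NNReal.summable_coe.2 h1
    push_cast at h2
    exact h2
  have hs : Summable fun m => a m • t m := by
    rw [summable_iff_vanishing_norm]
    intro ε hε
    obtain ⟨T₀, hT₀⟩ := summable_iff_vanishing_norm.1 ha' (ε ^ 2 / (B + 1)) (by positivity)
    refine ⟨T₀, fun T hT => ?_⟩
    have h1 := hT₀ T hT
    rw [Real.norm_of_nonneg (Finset.sum_nonneg fun m _ => by positivity),
      lt_div_iff₀ (by positivity)] at h1
    have h2 : 0 ≤ ∑ m ∈ T, ‖a m‖ ^ 2 := Finset.sum_nonneg fun m _ => by positivity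
    refine lt_of_pow_lt_pow_left₀ 2 hε.le ((h T a).trans_lt ?_)
    nlinarith
  refine ⟨_, hs.hasSum, ?_⟩
  have h1 : ‖∑' m, a m • t m‖ ^ 2 ≤ B * ∑' m, ‖a m‖ ^ 2 := by
    refine le_of_tendsto' ((hs.hasSum.norm).pow 2) fun T => (h T a).trans ?_
    gcongr
    exact ha'.sum_le_tsum T fun m _ => by positivity
  have h2 := ENNReal.ofReal_le_ofReal h1
  rw [ENNReal.ofReal_mul hB, ENNReal.ofReal_tsum_of_nonneg (fun m => by positivity) ha',
    ENNReal.ofReal_pow (norm_nonneg _), ofReal_norm] at h2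
  simpa only [ENNReal.ofReal_pow (norm_nonneg _), ofReal_norm] using h2

variable {ι : Type*} [Fintype ι] {X : ι → Type*} [∀ i, MeasurableSpace (X i)]
  {μ : ∀ i, Measure (X i)} [∀ i, SigmaFinite (μ i)]

/-- The full Bessel bound is used in one factor only. In the others the case of a single term, `‖f j
m‖ ^ 2 ≤ D j`, is enough. -/
theorem norm_sq_sum_tensorLp_le_prod [Nonempty ι] {f : ∀ j, ℤ → Lp ℂ 2 (μ j)} {D : ι → ℝ}
    (hf : ∀ j (T : Finset ℤ) (b : ℤ → ℂ), ‖∑ m ∈ T, b m • f j m‖ ^ 2 ≤ D j * ∑ m ∈ T, ‖b m‖ ^ 2)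
    (T : Finset ℤ) (a : ℤ → ℂ) :
    ‖∑ m ∈ T, a m • tensorLp μ (fun j => f j m)‖ ^ 2 ≤ (∏ j, D j) * ∑ m ∈ T, ‖a m‖ ^ 2 := by
  classical
  obtain ⟨i₀⟩ := ‹Nonempty ι›
  have hfD : ∀ j m, ‖f j m‖ ^ 2 ≤ D j := fun j m => by simpa using hf j {m} fun _ => 1
  have hD0 : ∀ j, 0 ≤ D j := fun j => (sq_nonneg _).trans (hfD j 0)
  have h := norm_sq_sum_tensorLp_le (μ := μ) (κ := T) i₀ (fun j m => f j m) (D i₀) (fun m => a m)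
    fun b => by
      set b' : ℤ → ℂ := fun m => if h : m ∈ T then b ⟨m, h⟩ else 0 with hb'
      have h1 := hf i₀ T b'
      rw [← Finset.sum_coe_sort T, ← Finset.sum_coe_sort T] at h1
      simpa [hb'] using h1
  rw [← Finset.sum_coe_sort T, ← Finset.sum_coe_sort T]
  refine h.trans ?_
  rw [← Finset.mul_prod_erase _ _ (Finset.mem_univ i₀), mul_assoc, Finset.mul_sum Finset.univ _ (∏ x ∈ _, D x)]
  refine mul_le_mul_of_nonneg_left (Finset.sum_le_sum fun m _ => ?_) (hD0 i₀)
  rw [mul_comm]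
  gcongr
  exact hfD _ _

end Bessel

/-! ### Cutoffs and Bessel sequences of weighted kernels -/

section WeightedKernels

theorem exists_cutoff {r : ℝ} (hr : 0 ≤ r) : ∃ χ : ℝ → ℂ, ContDiff ℝ ∞ χ ∧ HasCompactSupport χ ∧
    (∀ x, |x| ≤ r → χ x = 1) ∧ (∀ x, r + 2 ≤ |x| → χ x = 0) ∧ ∀ x, ‖χ x‖ ≤ 1 := by
  -- Inner radius `r + 1` rather than `r`, since `r = 0` is allowed and a bump needs a positive
  -- inner radius.
  let b : ContDiffBump (0 : ℝ) := ⟨r + 1, r + 2, by linarith, by linarith⟩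
  refine ⟨fun x => (b x : ℂ), Complex.ofRealCLM.contDiff.comp b.contDiff,
    b.hasCompactSupport.comp_left (g := fun r : ℝ => (r : ℂ)) Complex.ofReal_zero,
    fun x hx => ?_, fun x hx => ?_, fun x => ?_⟩
  · change ((b x : ℝ) : ℂ) = 1
    rw [b.one_of_mem_closedBall, Complex.ofReal_one]
    simp only [mem_closedBall_zero_iff, Real.norm_eq_abs]
    exact hx.trans (by change r ≤ r + 1; linarith)
  · change ((b x : ℝ) : ℂ) = 0
    rw [b.zero_of_le_dist, Complex.ofReal_zero]
    simpa using hx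
  · rw [Complex.norm_real, Real.norm_of_nonneg b.nonneg]
    exact b.le_one

theorem MeasureTheory.memLp_of_sobolevNorm_lt_top {s : ℝ} {F : ℝ → ℂ} (h : sobolevNorm s F < ⊤) :
    MemLp F 2 volume := by
  by_contra h0
  rw [sobolevNorm, dif_neg h0] at h
  exact lt_irrefl _ h

variable {E H : Type*} [NormedAddCommGroup E] [NormedSpace ℝ E] [FiniteDimensional ℝ E]
  [TopologicalSpace H] {I : ModelWithCorners ℝ E H} {G : Type*} [TopologicalSpace G]
  [ChartedSpace H G] [Group G] [MeasurableSpace G] {μ : Measure G}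
  [T2Space G] [SigmaCompactSpace G] [LocallyCompactSpace G] [IsTopologicalGroup G]
  [SecondCountableTopology G] [BorelSpace G] [SigmaFinite μ]
  [μ.IsMulLeftInvariant] [IsFiniteMeasureOnCompacts μ] [IsManifold I ∞ G] [μ.IsOpenPosMeasure]

theorem memLp_of_weighted {w : G → ℝ} (hw : ∀ x, 1 ≤ w x) {k : G → ℂ}
    (hk : AEStronglyMeasurable k μ) (h : MemLp (fun x => (w x : ℂ) * k x) 2 μ) : MemLp k 2 μ := by
  refine h.mono hk (Filter.Eventually.of_forall fun x => ?_)
  rw [norm_mul, Complex.norm_real, Real.norm_of_nonneg (by linarith [hw x])]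
  exact le_mul_of_one_le_left (norm_nonneg _) (hw x)

/-- The weighted kernels of the operators `exp (2πimL/P) χ(L)`, suitably normalized, form a Bessel
sequence. -/
theorem exists_bessel_kernels {L : (G → ℂ) → (G → ℂ)}
    (R : SpectralRepresentation (closureGraph I μ L)) {s : ℝ} (hs : 0 ≤ s) {w : G → ℝ}
    (hwm : Measurable w) (hw : ∀ x, 1 ≤ w x) {K : Set ℝ} {C₀ : ℝ≥0}
    (h : ∀ F : ℝ → ℂ, Measurable F → tsupport F ⊆ K → sobolevNorm s F < ⊤ →
      ∃ k : G → ℂ, IsConvolutionKernel I μ R F k ∧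
        eLpNorm (fun x => (w x : ℂ) * k x) 2 μ ≤ C₀ * sobolevNorm s F)
    {χ : ℝ → ℂ} (hχ : ContDiff ℝ ∞ χ) (hχ' : HasCompactSupport χ) (hχK : tsupport χ ⊆ K)
    {P : ℝ} (hP : 0 < P) :
    ∃ (D : ℝ) (f : ℤ → Lp ℂ 2 μ),
      (∀ m, IsMultiplierKernel I R.U (fun ξ => fourierExp P m (R.symbol ξ) * χ (R.symbol ξ))
        (fun x => ((bracket s (m / P) * (w x)⁻¹ : ℝ) : ℂ) * f m x)) ∧
      ∀ (T : Finset ℤ) (b : ℤ → ℂ), ‖∑ m ∈ T, b m • f m‖ ^ 2 ≤ D * ∑ m ∈ T, ‖b m‖ ^ 2 := by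
  obtain ⟨C, hC⟩ := sobolevNorm_sum_modulated_le hs hP hχ hχ'
  -- The hypothesis is used on whole finite sums, not term by term. This is where the Bessel
  -- property, rather than a mere bound on each kernel, comes from.
  have key : ∀ (T : Finset ℤ) (b : ℤ → ℂ), ∃ k : G → ℂ,
      IsConvolutionKernel I μ R (fun x => ∑ m ∈ T, b m * (fourierExp P m x * χ x)) k ∧
      eLpNorm (fun x => (w x : ℂ) * k x) 2 μ ^ 2 ≤
        (C₀ ^ 2 * C : ℝ≥0) * ∑ m ∈ T, (‖b m‖ₑ * ENNReal.ofReal (bracket s (m / P))) ^ 2 := by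
    intro T b
    have hfin : (C : ℝ≥0∞) * ∑ m ∈ T, (‖b m‖ₑ * ENNReal.ofReal (bracket s (m / P))) ^ 2 < ⊤ := by
      refine ENNReal.mul_lt_top ENNReal.coe_lt_top (ENNReal.sum_lt_top.2 fun m _ => ?_)
      exact ENNReal.pow_lt_top (ENNReal.mul_lt_top enorm_lt_top ENNReal.ofReal_lt_top)
    have hcont : Continuous fun x => ∑ m ∈ T, b m * (fourierExp P m x * χ x) :=
      continuous_finsetSum _ fun m _ =>
        continuous_const.mul ((contDiff_fourierExp P m).continuous.mul hχ.continuous)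
    obtain ⟨k, hk, hk'⟩ := h _ hcont.measurable
      (by
        refine subset_trans (closure_mono ?_) hχK
        intro x hx h0
        exact hx (Finset.sum_eq_zero fun m _ => by rw [h0, mul_zero, mul_zero]))
      (by
        by_contra h0
        rw [not_lt_top_iff] at h0
        have := (hC T b).trans_lt hfin
        rw [h0] at this
        simp at this)
    refine ⟨k, hk, (ENNReal.pow_le_pow_left hk').trans ?_⟩
    rw [mul_pow, ENNReal.coe_mul, ENNReal.coe_pow, mul_assoc]
    exact mul_le_mul_right (hC T b) _
  have hwk : ∀ {k : G → ℂ}, LocallyIntegrable k μ →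
      AEStronglyMeasurable (fun x => (w x : ℂ) * k x) μ := fun hk =>
    (Complex.measurable_ofReal.comp hwm).aestronglyMeasurable.mul hk.aestronglyMeasurable
  choose k hk hk' using key
  have hmem : ∀ T b, MemLp (fun x => (w x : ℂ) * k T b x) 2 μ := fun T b => by
    refine ⟨hwk (hk T b).1, ?_⟩
    by_contra h0
    rw [not_lt_top_iff] at h0
    have h1 := hk' T b
    rw [h0] at h1
    have hfin : ((C₀ ^ 2 * C : ℝ≥0) : ℝ≥0∞) *
        ∑ m ∈ T, (‖b m‖ₑ * ENNReal.ofReal (bracket s (m / P))) ^ 2 < ⊤ := by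
      refine ENNReal.mul_lt_top ENNReal.coe_lt_top (ENNReal.sum_lt_top.2 fun m _ => ?_)
      exact ENNReal.pow_lt_top (ENNReal.mul_lt_top enorm_lt_top ENNReal.ofReal_lt_top)
    have := h1.trans_lt hfin
    simp at this
  have hmemk : ∀ T b, MemLp (k T b) 2 μ := fun T b =>
    memLp_of_weighted hw (hk T b).1.aestronglyMeasurable (hmem T b)
  -- The weighted kernels are divided by `bracket s (m / P)`, so that the Sobolev bound for a
  -- combination becomes the plain `ℓ²` norm of its coefficients.
  set f : ℤ → Lp ℂ 2 μ := fun m =>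
    ((bracket s (m / P))⁻¹ : ℂ) • (hmem {m} fun _ => 1).toLp _ with hf
  have hfe : ∀ m, f m =ᵐ[μ] fun x => ((bracket s (m / P))⁻¹ : ℂ) * ((w x : ℂ) * k {m} (fun _ => 1) x) := by
    intro m
    filter_upwards [Lp.coeFn_smul ((bracket s (m / P))⁻¹ : ℂ) ((hmem {m} fun _ => 1).toLp _),
      (hmem {m} fun _ => 1).coeFn_toLp] with x h1 h2
    rw [hf, h1, Pi.smul_apply, h2, smul_eq_mul]
  have hbr : ∀ m : ℤ, (bracket s (m / P) : ℂ) ≠ 0 := fun m => by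
    exact_mod_cast (bracket_pos s _).ne'
  have hw0 : ∀ x, (w x : ℂ) ≠ 0 := fun x => by
    exact_mod_cast (zero_lt_one.trans_le (hw x)).ne'
  have hk1 : ∀ m, IsMultiplierKernel I R.U
      (fun ξ => fourierExp P m (R.symbol ξ) * χ (R.symbol ξ)) (k {m} fun _ => 1) := fun m => by
    have := (isConvolutionKernel_iff.1 (hk {m} fun _ => 1)).2
    simpa using this
  refine ⟨(C₀ ^ 2 * C : ℝ≥0), f, fun m => (hk1 m).congr ?_, fun T b => ?_⟩
  · filter_upwards [hfe m] with x hx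
    rw [hx]
    push_cast
    field_simp [hbr m, hw0 x]
  · refine norm_sq_le_of_enorm_sq_le ?_
    set b' : ℤ → ℂ := fun m => b m * (bracket s (m / P) : ℂ)⁻¹ with hb'
    -- The kernel chosen for a finite sum is not linear in the coefficients by construction.
    -- Uniqueness of square-integrable kernels identifies it with the corresponding combination of
    -- the individual kernels.
    have hsum := IsMultiplierKernel.sum T b' (fun m => hmemk {m} fun _ => 1) hk1
    have huniq := (isConvolutionKernel_iff.1 (hk T b')).2.unique (hmemk T b')
      (by exact memLp_finsetSum _ fun m _ => (hmemk {m} fun _ => 1).const_mul (b' m)) hsum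
    have he : (∑ m ∈ T, b m • f m : Lp ℂ 2 μ) =ᵐ[μ] fun x => (w x : ℂ) * k T b' x := by
      have h1 : ∀ m, (b m • f m : Lp ℂ 2 μ) =ᵐ[μ] fun x => b m * f m x := fun m =>
        Lp.coeFn_smul (b m) (f m)
      filter_upwards [Lp.coeFn_fun_finsetSum T fun m => b m • f m, ae_all_iff.2 h1,
        ae_all_iff.2 hfe, huniq] with x h2 h3 h4 h5
      rw [h2, h5, Finset.mul_sum]
      refine Finset.sum_congr rfl fun m _ => ?_
      rw [h3, h4, hb']
      ring
    rw [Lp.enorm_def, eLpNorm_congr_ae he]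
    refine (hk' T b').trans_eq ?_
    congr 1
    refine Finset.sum_congr rfl fun m _ => ?_
    congr 1
    have h1 : ENNReal.ofReal (bracket s (m / P)) = ‖(bracket s (m / P) : ℂ)‖ₑ := by
      rw [← ofReal_norm, Complex.norm_real, Real.norm_of_nonneg (bracket_pos s _).le]
    rw [h1, ← enorm_mul, hb', inv_mul_cancel_right₀ (hbr m)]

end WeightedKernels

/-! ### The weighted estimate on the product -/

section ProductEstimate

variable {ι : Type*} [Fintype ι] {E H : ι → Type*} [∀ i, NormedAddCommGroup (E i)]
  [∀ i, NormedSpace ℝ (E i)] [∀ i, TopologicalSpace (H i)]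
  {I : ∀ i, ModelWithCorners ℝ (E i) (H i)} {G : ι → Type*} [∀ i, TopologicalSpace (G i)]
  [∀ i, ChartedSpace (H i) (G i)] [∀ i, Group (G i)] [∀ i, IsManifold (I i) ∞ (G i)]
  [∀ i, FiniteDimensional ℝ (E i)] [∀ i, IsTopologicalGroup (G i)] [∀ i, LocallyCompactSpace (G i)]
  [∀ i, T2Space (G i)] [∀ i, SecondCountableTopology (G i)] [∀ i, SigmaCompactSpace (G i)]
  [∀ i, MeasurableSpace (G i)] [∀ i, BorelSpace (G i)] {μ : ∀ i, Measure (G i)}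
  [∀ i, SigmaFinite (μ i)] [∀ i, IsLocallyFiniteMeasure (μ i)] [∀ i, (μ i).IsMulLeftInvariant]
  {Y : ι → Type*} [∀ i, MeasurableSpace (Y i)] {ν : ∀ i, Measure (Y i)} [∀ i, SigmaFinite (ν i)]
  {U : ∀ i, Lp ℂ 2 (μ i) ≃ₗᵢ[ℂ] Lp ℂ 2 (ν i)}
  {V : Lp ℂ 2 (Measure.pi μ) ≃ₗᵢ[ℂ] Lp ℂ 2 (Measure.pi ν)} {w : ∀ i, G i → ℝ} {s : ι → ℝ}
  {σ : ∀ i, Y i → ℝ} {χ : ℝ → ℂ} {P : ℝ} {f : ∀ i, ℤ → Lp ℂ 2 (μ i)}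

theorem norm_prod_inv_weight_le (hw : ∀ j x, 1 ≤ w j x) (x : ∀ i, G i) :
    ‖((∏ j, (w j (x j))⁻¹ : ℝ) : ℂ)‖ ≤ 1 := by
  have h0 : ∀ j, 0 ≤ (w j (x j))⁻¹ := fun j => inv_nonneg.2 (zero_le_one.trans (hw j _))
  rw [Complex.norm_real, Real.norm_of_nonneg (Finset.prod_nonneg fun j _ => h0 j)]
  exact Finset.prod_le_one (fun j _ => h0 j) fun j _ => inv_le_one_of_one_le₀ (hw j _)

theorem measurable_prod_inv_weight (hwm : ∀ j, Measurable (w j)) :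
    Measurable fun x : ∀ i, G i => ((∏ j, (w j (x j))⁻¹ : ℝ) : ℂ) :=
  Complex.measurable_ofReal.comp
    (Finset.measurable_fun_prod _ fun j _ => ((hwm j).comp (measurable_pi_apply j)).inv)

/-- Finite combinations of tensor products of weighted kernels, divided by the weight, are kernels. -/
theorem isMultiplierKernel_partial_sum (hV : ∀ f, V (tensorLp μ f) = tensorLp ν fun i => U i (f i))
    (hwm : ∀ j, Measurable (w j)) (hw : ∀ j x, 1 ≤ w j x) (hσ : ∀ j, Measurable (σ j))
    (hχ : Continuous χ) (hχ1 : ∀ x, ‖χ x‖ ≤ 1)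
    (hf : ∀ j m, IsMultiplierKernel (I j) (U j)
      (fun ξ => fourierExp P m (σ j ξ) * χ (σ j ξ))
      (fun x => ((bracket (s j) (m / P) * (w j x)⁻¹ : ℝ) : ℂ) * f j m x))
    (T : Finset ℤ) (c : ℤ → ℂ) :
    IsMultiplierKernel (ModelWithCorners.pi I) V
      (fun ξ => ∑ m ∈ T, c m * (fourierExp P m (∑ j, σ j (ξ j)) * ∏ j, χ (σ j (ξ j))))
      (fun x => ((∏ j, (w j (x j))⁻¹ : ℝ) : ℂ) *
        (∑ m ∈ T, (c m * (bracket (∑ j, s j) (m / P) : ℂ)) • tensorLp μ (fun j => f j m) :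
          Lp ℂ 2 (Measure.pi μ)) x) := by
  have hmem : ∀ j (m : ℤ), MemLp (fun x => ((bracket (s j) (m / P) * (w j x)⁻¹ : ℝ) : ℂ) * f j m x)
      2 (μ j) := fun j m => by
    refine memLp_two_bdd_mul (C := bracket (s j) (m / P)) ?_ (fun x => ?_) (Lp.memLp _)
    · exact (Complex.measurable_ofReal.comp ((hwm j).inv.const_mul _)).aestronglyMeasurable
    · have h0 : 0 ≤ (w j x)⁻¹ := inv_nonneg.2 (zero_le_one.trans (hw j x))
      rw [Complex.norm_real, Real.norm_of_nonneg (mul_nonneg (bracket_pos _ _).le h0)]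
      exact mul_le_of_le_one_right (bracket_pos _ _).le (inv_le_one_of_one_le₀ (hw j x))
  have hker : ∀ m : ℤ, IsMultiplierKernel (ModelWithCorners.pi I) V
      (fun ξ => ∏ j, (fourierExp P m (σ j (ξ j)) * χ (σ j (ξ j))))
      (fun x => ∏ j, (((bracket (s j) (m / P) * (w j (x j))⁻¹ : ℝ) : ℂ) * f j m (x j))) := fun m =>
    IsMultiplierKernel.pi (m := fun j ξ => fourierExp P m (σ j ξ) * χ (σ j ξ)) (C := fun _ => 1)
      (k := fun j x => ((bracket (s j) (m / P) * (w j x)⁻¹ : ℝ) : ℂ) * f j m x) hV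
      (fun j => ((((contDiff_fourierExp P m).continuous.mul hχ).measurable).comp
        (hσ j)).aestronglyMeasurable)
      (fun j ξ => by rw [norm_mul, norm_fourierExp, one_mul]; exact hχ1 _)
      (fun j => hmem j m) fun j => hf j m
  have hsum := IsMultiplierKernel.sum T c (fun m => MemLp.tensor fun j => hmem j m) hker
  -- Separation of variables: the exponential of the sum is the product of the exponentials.
  have hmul : (fun ξ : ∀ j, Y j =>
      ∑ m ∈ T, c m * ∏ j, (fourierExp P m (σ j (ξ j)) * χ (σ j (ξ j)))) =
      fun ξ => ∑ m ∈ T, c m * (fourierExp P m (∑ j, σ j (ξ j)) * ∏ j, χ (σ j (ξ j))) := by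
    ext ξ
    refine Finset.sum_congr rfl fun m _ => ?_
    rw [Finset.prod_mul_distrib, fourierExp_sum]
  rw [hmul] at hsum
  refine hsum.congr ?_
  have h1 : ∀ m, ((c m * (bracket (∑ j, s j) (m / P) : ℂ)) • tensorLp μ (fun j => f j m) :
      Lp ℂ 2 (Measure.pi μ)) =ᵐ[Measure.pi μ]
      fun x => (c m * (bracket (∑ j, s j) (m / P) : ℂ)) * tensorLp μ (fun j => f j m) x := fun m =>
    Lp.coeFn_smul _ _
  filter_upwards [Lp.coeFn_fun_finsetSum T fun m =>
    (c m * (bracket (∑ j, s j) (m / P) : ℂ)) • tensorLp μ (fun j => f j m), ae_all_iff.2 h1,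
    ae_all_iff.2 fun m => tensorLp_ae_eq fun j => f j m] with x h2 h3 h4
  rw [h2, Finset.mul_sum]
  refine Finset.sum_congr rfl fun m _ => ?_
  rw [h3, h4, Finset.prod_mul_distrib, ← Complex.ofReal_prod, Finset.prod_mul_distrib, prod_bracket]
  push_cast
  ring

/-- Kernels of Fourier series. -/
theorem exists_kernel_of_fourier_series [Nonempty ι]
    (hV : ∀ f, V (tensorLp μ f) = tensorLp ν fun i => U i (f i))
    (hwm : ∀ j, Measurable (w j)) (hw : ∀ j x, 1 ≤ w j x) (hσ : ∀ j, Measurable (σ j))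
    (hχ : Continuous χ) (hχ1 : ∀ x, ‖χ x‖ ≤ 1)
    (hf : ∀ j m, IsMultiplierKernel (I j) (U j)
      (fun ξ => fourierExp P m (σ j ξ) * χ (σ j ξ))
      (fun x => ((bracket (s j) (m / P) * (w j x)⁻¹ : ℝ) : ℂ) * f j m x)) {D : ι → ℝ}
    (hD : ∀ j (T : Finset ℤ) (b : ℤ → ℂ), ‖∑ m ∈ T, b m • f j m‖ ^ 2 ≤ D j * ∑ m ∈ T, ‖b m‖ ^ 2)
    {c : ℤ → ℂ} (hc : ∑' m, ‖c m * (bracket (∑ j, s j) (m / P) : ℂ)‖ₑ ^ 2 ≠ ⊤) {T : ℕ → Finset ℤ}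
    (hT : Filter.Tendsto T Filter.atTop Filter.atTop) {M : (∀ j, Y j) → ℂ}
    (hM : ∀ᵐ ξ ∂Measure.pi ν, Filter.Tendsto
      (fun i => ∑ m ∈ T i, c m * (fourierExp P m (∑ j, σ j (ξ j)) * ∏ j, χ (σ j (ξ j))))
      Filter.atTop (nhds (M ξ))) :
    ∃ k : (∀ i, G i) → ℂ, MemLp k 2 (Measure.pi μ) ∧
      IsMultiplierKernel (ModelWithCorners.pi I) V M k ∧
      eLpNorm (fun x => ((∏ j, w j (x j) : ℝ) : ℂ) * k x) 2 (Measure.pi μ) ^ 2 ≤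
        ENNReal.ofReal (∏ j, D j) * ∑' m, ‖c m * (bracket (∑ j, s j) (m / P) : ℂ)‖ₑ ^ 2 := by
  have hD0 : 0 ≤ ∏ j, D j := Finset.prod_nonneg fun j _ => by
    have := hD j {0} fun _ => 1
    simp only [Finset.sum_singleton, one_smul, norm_one, one_pow, mul_one] at this
    exact (sq_nonneg _).trans this
  -- `g` is the weighted kernel; it is built first, and the kernel is recovered by dividing by the
  -- weight, which is at least 1.
  obtain ⟨g, hg, hgn⟩ := hasSum_of_bessel hD0 (norm_sq_sum_tensorLp_le_prod hD) hc
  have hmw : ∀ h : Lp ℂ 2 (Measure.pi μ),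
      MemLp (fun x => ((∏ j, (w j (x j))⁻¹ : ℝ) : ℂ) * h x) 2 (Measure.pi μ) := fun h =>
    memLp_two_bdd_mul (measurable_prod_inv_weight hwm).aestronglyMeasurable
      (norm_prod_inv_weight_le hw) (Lp.memLp h)
  refine ⟨fun x => ((∏ j, (w j (x j))⁻¹ : ℝ) : ℂ) * g x, hmw g, ?_, ?_⟩
  · refine IsMultiplierKernel.of_tendsto (fun i => hmw _) (hmw g)
      (fun i => isMultiplierKernel_partial_sum hV hwm hw hσ hχ hχ1 hf (T i) c) ?_ hM
    have h1 := hg.comp hT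
    rw [Lp.tendsto_Lp_iff_tendsto_eLpNorm'] at h1
    refine tendsto_of_tendsto_of_tendsto_of_le_of_le tendsto_const_nhds h1 (fun _ => zero_le)
      fun i => eLpNorm_mono fun x => ?_
    rw [← mul_sub, norm_mul]
    exact mul_le_of_le_one_left (norm_nonneg _) (norm_prod_inv_weight_le hw x)
  · have : (fun x => ((∏ j, w j (x j) : ℝ) : ℂ) * (((∏ j, (w j (x j))⁻¹ : ℝ) : ℂ) * g x)) = g := by
      ext x
      rw [← mul_assoc, ← Complex.ofReal_mul, ← Finset.prod_mul_distrib, Finset.prod_eq_one,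
        Complex.ofReal_one, one_mul]
      exact fun j _ => mul_inv_cancel₀ (zero_lt_one.trans_le (hw j _)).ne'
    rw [this, ← Lp.enorm_def]
    exact hgn

end ProductEstimate

/-! ### The weighted kernel estimate for the sum -/

section FinalEstimate

variable {m : ℕ} {E H : Fin (m + 1) → Type*} [∀ i, NormedAddCommGroup (E i)]
  [∀ i, NormedSpace ℝ (E i)] [∀ i, TopologicalSpace (H i)]
  {I : ∀ i, ModelWithCorners ℝ (E i) (H i)} {G : Fin (m + 1) → Type*} [∀ i, TopologicalSpace (G i)]
  [∀ i, ChartedSpace (H i) (G i)] [∀ i, Group (G i)] [∀ i, IsManifold (I i) ∞ (G i)]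
  [∀ i, FiniteDimensional ℝ (E i)] [∀ i, IsTopologicalGroup (G i)] [∀ i, LocallyCompactSpace (G i)]
  [∀ i, T2Space (G i)] [∀ i, SecondCountableTopology (G i)] [∀ i, SigmaCompactSpace (G i)]
  [∀ i, MeasurableSpace (G i)] [∀ i, BorelSpace (G i)] {μ : ∀ i, Measure (G i)}
  [∀ i, SigmaFinite (μ i)] [∀ i, IsLocallyFiniteMeasure (μ i)] [∀ i, (μ i).IsMulLeftInvariant]
  [∀ i, (μ i).IsOpenPosMeasure] {L : ∀ j, (G j → ℂ) → (G j → ℂ)}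
  {R : ∀ j, SpectralRepresentation (closureGraph (I j) (μ j) (L j))}
  {V : Lp ℂ 2 (Measure.pi μ) ≃ₗᵢ[ℂ] Lp ℂ 2 (Measure.pi fun j => (R j).ν)}

/-- A function supported in `[-r, r]` is the limit of its localized Fourier series at sums of
nonnegative numbers. -/
theorem tendsto_localized_fourier_series {r : ℝ} {F χ : ℝ → ℂ}
    (hF : ∀ x, F x ≠ 0 → |x| ≤ r) (hχ1 : ∀ x, |x| ≤ r → χ x = 1)
    (hχ0 : ∀ x, r + 2 ≤ |x| → χ x = 0) {P : ℝ} (hP : (m + 1) * (r + 2) ≤ P / 2)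
    {T : ℕ → Finset ℤ} {c : ℤ → ℂ} {x : Fin (m + 1) → ℝ} (hx : ∀ j, 0 ≤ x j)
    (h : ∑ j, x j ∈ Set.Ioc (-(P / 2)) (P / 2) → Filter.Tendsto
      (fun i => ∑ n ∈ T i, c n * fourierExp P n (∑ j, x j)) Filter.atTop (nhds (F (∑ j, x j)))) :
    Filter.Tendsto (fun i => ∑ n ∈ T i, c n * (fourierExp P n (∑ j, x j) * ∏ j, χ (x j)))
      Filter.atTop (nhds (F (∑ j, x j))) := by
  have hle : ∀ j, x j ≤ ∑ j, x j := fun j =>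
    Finset.single_le_sum (f := x) (fun i _ => hx i) (Finset.mem_univ j)
  have hsum0 : 0 ≤ ∑ j, x j := Finset.sum_nonneg fun j _ => hx j
  -- If all `x j < r + 2`, the sum lies in the period interval and the series converges; where `F ≠
  -- 0`, nonnegativity gives `x j ≤ r`, so the cutoffs equal 1. Otherwise some cutoff vanishes, and
  -- the sum is at least `r + 2`, so `F` vanishes as well.
  by_cases hc : ∀ j, x j < r + 2
  · have hlt : ∑ j, x j < P / 2 := by
      refine lt_of_lt_of_le ?_ hP
      have := Finset.sum_lt_sum_of_nonempty (s := (Finset.univ : Finset (Fin (m + 1))))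
        ⟨0, Finset.mem_univ _⟩ fun j _ => hc j
      simpa only [Finset.sum_const, Finset.card_univ, Fintype.card_fin, nsmul_eq_mul,
        Nat.cast_add, Nat.cast_one] using this
    have h1 := (h ⟨by linarith, hlt.le⟩).mul_const (∏ j, χ (x j))
    have h2 : F (∑ j, x j) * ∏ j, χ (x j) = F (∑ j, x j) := by
      by_cases h0 : F (∑ j, x j) = 0
      · rw [h0, zero_mul]
      · have h3 := hF _ h0
        rw [abs_of_nonneg hsum0] at h3
        have hp : ∏ j, χ (x j) = 1 := Finset.prod_eq_one fun j _ => hχ1 _ (by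
          rw [abs_of_nonneg (hx j)]
          exact (hle j).trans h3)
        rw [hp, mul_one]
    rw [h2] at h1
    refine h1.congr fun i => ?_
    rw [Finset.sum_mul]
    exact Finset.sum_congr rfl fun n _ => mul_assoc _ _ _
  · push Not at hc
    obtain ⟨j, hj⟩ := hc
    have h1 : ∏ j, χ (x j) = 0 :=
      Finset.prod_eq_zero (Finset.mem_univ j) (hχ0 _ (by rwa [abs_of_nonneg (hx j)]))
    have h2 : F (∑ j, x j) = 0 := by
      by_contra h0
      have h3 := hF _ h0
      rw [abs_of_nonneg hsum0] at h3
      linarith [hle j]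
    rw [h1, h2]
    simp

/-- Absolute continuity is needed for just one factor `j₀`, positivity of the symbol for all of
them. The orders `s j` add up because the normalizing brackets multiply. -/
theorem exists_product_estimate
    (hV : ∀ f, V (tensorLp μ f) = tensorLp (fun j => (R j).ν) fun i => (R i).U (f i))
    (hpos : ∀ j, ∀ᵐ ξ ∂(R j).ν, 0 ≤ (R j).symbol ξ) (j₀ : Fin (m + 1))
    (hac : ∀ N : Set ℝ, MeasurableSet N → volume N = 0 → (R j₀).ν ((R j₀).symbol ⁻¹' N) = 0)
    {w : ∀ j, G j → ℝ} (hwm : ∀ j, Measurable (w j)) (hw : ∀ j x, 1 ≤ w j x) {s : Fin (m + 1) → ℝ}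
    (hs : ∀ j, 0 ≤ s j)
    (hest : ∀ j, ∀ K : Set ℝ, IsCompact K → ∃ C : ℝ≥0, ∀ F : ℝ → ℂ, Measurable F → tsupport F ⊆ K →
      sobolevNorm (s j) F < ⊤ → ∃ k : G j → ℂ, IsConvolutionKernel (I j) (μ j) (R j) F k ∧
        eLpNorm (fun x => (w j x : ℂ) * k x) 2 (μ j) ≤ C * sobolevNorm (s j) F)
    {K : Set ℝ} (hK : IsCompact K) :
    ∃ C : ℝ≥0, ∀ F : ℝ → ℂ, tsupport F ⊆ K → sobolevNorm (∑ j, s j) F < ⊤ →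
      ∃ k : (∀ j, G j) → ℂ, MemLp k 2 (Measure.pi μ) ∧
        IsMultiplierKernel (ModelWithCorners.pi I) V
          (fun ξ => F (∑ j, (R j).symbol (ξ j))) k ∧
        eLpNorm (fun x => ((∏ j, w j (x j) : ℝ) : ℂ) * k x) 2 (Measure.pi μ) ≤
          C * sobolevNorm (∑ j, s j) F := by
  obtain ⟨r, hr0, hKr⟩ : ∃ r : ℝ, 0 ≤ r ∧ ∀ x ∈ K, |x| ≤ r := by
    obtain ⟨r, hr⟩ := hK.isBounded.exists_norm_le
    exact ⟨max r 0, le_max_right _ _, fun x hx => (hr x hx).trans (le_max_left _ _)⟩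
  obtain ⟨χ, hχ, hχ', hχ1, hχ0, hχn⟩ := exists_cutoff hr0
  -- Half the period bounds the sum of `m + 1` numbers in the support of the cutoff, so periodicity
  -- of the Fourier series is never seen.
  obtain ⟨P, hP2⟩ : ∃ P : ℝ, (m + 1) * (r + 2) = P / 2 := ⟨2 * ((m + 1) * (r + 2)), by ring⟩
  have hrP : r + 2 ≤ P / 2 := by
    rw [← hP2]
    have : (0 : ℝ) ≤ m := Nat.cast_nonneg m
    nlinarith
  have hP : 0 < P := by linarith
  choose C₀ hC₀ using fun j => hest j (tsupport χ) hχ'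
  choose D f hf hD using fun j =>
    exists_bessel_kernels (R j) (hs j) (hwm j) (hw j) (hC₀ j) hχ hχ' subset_rfl hP
  obtain ⟨C₁, hC₁⟩ := tsum_fourier_coeff_le (s := ∑ j, s j) (Finset.sum_nonneg fun j _ => hs j)
    hP hχ hχ'
  -- Product of the Bessel constants, the squared normalization `1 / P` of the Fourier coefficients,
  -- and the constant of `tsum_fourier_coeff_le`. It bounds the square of the norm, whence the
  -- square root.
  set B : ℝ≥0 := (∏ j, D j).toNNReal * ((1 / P).toNNReal ^ 2 * C₁) with hB
  refine ⟨NNReal.sqrt B, fun F hFK hF => ?_⟩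
  have hFL := memLp_of_sobolevNorm_lt_top hF
  have hFr : ∀ x, F x ≠ 0 → |x| ≤ r := fun x hx => hKr x (hFK (subset_tsupport _ hx))
  obtain ⟨ns, hns, hae⟩ := exists_seq_tendsto_fourier_series hP hFL fun x hx => by
    have := abs_le.1 (hFr x hx)
    exact ⟨by linarith, by linarith⟩
  set c : ℤ → ℂ := fun n => (1 / P : ℝ) * ∫ y, F y * starRingEnd ℂ (fourierExp P n y) with hc
  have hcb : ∑' n : ℤ, ‖c n * (bracket (∑ j, s j) (n / P) : ℂ)‖ₑ ^ 2 ≤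
      ENNReal.ofReal (1 / P) ^ 2 * (C₁ * sobolevNorm (∑ j, s j) F ^ 2) := by
    refine le_trans (le_of_eq ?_) (mul_le_mul_right (hC₁ F hFL fun x hx => hχ1 x (hFr x hx)) _)
    rw [← ENNReal.tsum_mul_left]
    refine tsum_congr fun n => ?_
    rw [hc, enorm_mul, enorm_mul, ← ofReal_norm ((1 / P : ℝ) : ℂ),
      ← ofReal_norm ((bracket _ _ : ℝ) : ℂ), Complex.norm_real, Complex.norm_real,
      Real.norm_of_nonneg (by positivity), Real.norm_of_nonneg (bracket_pos _ _).le, mul_assoc, mul_pow]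
  have hcb' : ENNReal.ofReal (1 / P) ^ 2 * (C₁ * sobolevNorm (∑ j, s j) F ^ 2) < ⊤ :=
    ENNReal.mul_lt_top (ENNReal.pow_lt_top ENNReal.ofReal_lt_top)
      (ENNReal.mul_lt_top ENNReal.coe_lt_top (ENNReal.pow_lt_top hF))
  have hT : Filter.Tendsto (fun i => Finset.Icc (-(ns i : ℤ)) (ns i)) Filter.atTop Filter.atTop := by
    refine Filter.tendsto_atTop_finset_of_monotone (fun a b h => ?_) fun n => ⟨n.natAbs, ?_⟩
    · have := hns.monotone h
      exact Finset.Icc_subset_Icc (by simpa using this) (by simpa using this)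
    · have := hns.id_le n.natAbs
      simp only [Finset.mem_Icc, id] at this ⊢
      omega
  have hσ : ∀ i, Measurable (R i).symbol := fun i => (R i).measurable_symbol
  have hM : ∀ᵐ ξ ∂Measure.pi fun j => (R j).ν, Filter.Tendsto
      (fun i => ∑ n ∈ Finset.Icc (-(ns i : ℤ)) (ns i), c n *
        (fourierExp P n (∑ j, (R j).symbol (ξ j)) * ∏ j, χ ((R j).symbol (ξ j))))
      Filter.atTop (nhds (F (∑ j, (R j).symbol (ξ j)))) := by
    filter_upwards [ae_pi_sum (ν := fun j => (R j).ν) hσ j₀ hac hae, ae_pi_of_forall_ae hpos]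
      with ξ h1 h2
    exact tendsto_localized_fourier_series hFr hχ1 hχ0 hP2.le h2 h1
  obtain ⟨k, hk, hkm, hkn⟩ := exists_kernel_of_fourier_series hV hwm hw hσ hχ.continuous hχn hf hD
    (hcb.trans_lt hcb').ne hT hM
  refine ⟨k, hk, hkm, ?_⟩
  rw [← ENNReal.pow_le_pow_left_iff two_ne_zero, mul_pow, ← ENNReal.coe_pow, NNReal.sq_sqrt]
  refine (hkn.trans (mul_le_mul_right hcb _)).trans_eq ?_
  rw [hB]
  push_cast
  simp only [ENNReal.ofReal]
  ring

end FinalEstimate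

end

/-! ### Proof of the proposition -/

theorem AssumptionB.of_isMultiplierKernel {E H : Type*} [NormedAddCommGroup E] [NormedSpace ℝ E]
    [TopologicalSpace H] {I : ModelWithCorners ℝ E H} {G : Type*} [TopologicalSpace G]
    [ChartedSpace H G] [Group G] [MeasurableSpace G] [BorelSpace G]
    {μ : Measure G} [IsLocallyFiniteMeasure μ] {L : (G → ℂ) → (G → ℂ)} {t : ℝ} {Ω : Type}
    [MeasurableSpace Ω] {ν : Measure Ω} [SigmaFinite ν] (U : Lp ℂ 2 μ ≃ₗᵢ[ℂ] Lp ℂ 2 ν)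
    {symbol : Ω → ℝ} (hm : Measurable symbol)
    (h : ∀ u v : Lp ℂ 2 μ, (u, v) ∈ closureGraph I μ L ↔
      U v =ᵐ[ν] fun ξ => (symbol ξ : ℂ) * U u ξ)
    (hU : ∀ s : ℝ, t < s →
      ∃ w : G → ℝ, Measurable w ∧ (∀ x, 1 ≤ w x) ∧ MemLp (fun x => (w x)⁻¹) 2 μ ∧
        ∀ K : Set ℝ, IsCompact K →
          ∃ C : ℝ≥0, ∀ F : ℝ → ℂ, tsupport F ⊆ K → sobolevNorm s F < ⊤ →
            ∃ k : G → ℂ, MemLp k 2 μ ∧ IsMultiplierKernel I U (fun ξ => F (symbol ξ)) k ∧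
              eLpNorm (fun x => (w x : ℂ) * k x) 2 μ ≤ C * sobolevNorm s F) :
    AssumptionB I μ L t := by
  refine ⟨⟨Ω, ν, U, symbol, hm, h⟩, fun s hs => ?_⟩
  obtain ⟨w, hwm, hw, hwL, hest⟩ := hU s hs
  refine ⟨w, hwm, hw, hwL, fun K hK => ?_⟩
  obtain ⟨C, hC⟩ := hest K hK
  refine ⟨C, fun F _ hFK hF => ?_⟩
  obtain ⟨k, hk, hkm, hkn⟩ := hC F hFK hF
  exact ⟨k, ⟨hk.locallyIntegrable (by norm_num), hkm⟩, hkn⟩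

theorem mainTheorem6 (n : ℕ) (hn : 0 < n) (d : Fin n → ℕ)
    (G : Fin n → Type*)
    [∀ j, TopologicalSpace (G j)] [∀ j, T2Space (G j)] [∀ j, SecondCountableTopology (G j)]
    [∀ j, ChartedSpace (EuclideanSpace ℝ (Fin (d j))) (G j)]
    [∀ j, Group (G j)] [∀ j, LieGroup (𝓡 (d j)) ∞ (G j)]
    [∀ j, SimplyConnectedSpace (G j)]
    [∀ j, MeasurableSpace (G j)] [∀ j, BorelSpace (G j)]
    (μ : ∀ j, Measure (G j)) [∀ j, (μ j).IsHaarMeasure]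
    (S : ∀ j, Stratification (𝓡 (d j)) (G j))
    (L : ∀ j, (G j → ℂ) → (G j → ℂ))
    (hL : ∀ j, IsHomogeneousSublaplacian (S j) (L j))
    (t : Fin n → ℝ) (ht : ∀ j, 0 < t j)
    (hB : ∀ j, AssumptionB (𝓡 (d j)) (μ j) (L j) (t j)) :
    AssumptionB (ModelWithCorners.pi (fun j => 𝓡 (d j))) (Measure.pi μ)
      (fun (f : (∀ j, G j) → ℂ) x =>
        ∑ j, pushforwardOperator (MonoidHom.mulSingle G j) (L j) f x)
      (∑ j, t j) := by
  obtain ⟨m, rfl⟩ : ∃ m, n = m + 1 := ⟨n - 1, by omega⟩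
  haveI : ∀ j, IsTopologicalGroup (G j) := fun j => topologicalGroup_of_lieGroup (𝓡 (d j)) ∞
  haveI : ∀ j, LocallyCompactSpace (G j) := fun j =>
    Manifold.locallyCompact_of_finiteDimensional (𝓡 (d j))
  choose q X hX using hL
  obtain rfl : L = fun j => sumOfSquares (𝓡 (d j)) fun l => (X j l : GroupLieAlgebra (𝓡 (d j)) (G j)) :=
    funext hX
  choose R hR using hB
  obtain ⟨V, hV⟩ := exists_tensor_unitary (μ := μ) (ν := fun j => (R j).ν) fun j => (R j).U
  refine AssumptionB.of_isMultiplierKernel V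
    (Finset.measurable_fun_sum _ fun j _ => (R j).measurable_symbol.comp (measurable_pi_apply j))
    (fun u v => by
      rw [closureGraph_pi]
      exact mem_closure_iff_ae_eq hV) fun s hs => ?_
  -- The excess of `s` over `∑ j, t j` is shared equally among the `m + 1` factors.
  obtain ⟨s', hs', rfl⟩ : ∃ s' : Fin (m + 1) → ℝ, (∀ j, t j < s' j) ∧ ∑ j, s' j = s := by
    refine ⟨fun j => t j + (s - ∑ j, t j) / (m + 1), fun j => ?_, ?_⟩
    · have : 0 < (s - ∑ j, t j) / (m + 1) := div_pos (by linarith) (by positivity)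
      linarith
    · rw [Finset.sum_add_distrib]
      simp only [Finset.sum_const, Finset.card_univ, Fintype.card_fin, nsmul_eq_mul]
      push_cast
      field_simp
      ring
  choose w hwm hw hwL hest using fun j => hR j (s' j) (hs' j)
  have hw0 : ∀ j x, 0 < w j x := fun j x => zero_lt_one.trans_le (hw j x)
  refine ⟨fun x => ∏ j, w j (x j),
    Finset.measurable_fun_prod _ fun j _ => (hwm j).comp (measurable_pi_apply j),
    fun x => by simpa using Finset.prod_le_prod (s := Finset.univ) (f := fun _ => (1 : ℝ)) (fun _ _ => zero_le_one) fun j _ => hw j (x j), ?_, fun K hK => ?_⟩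
  -- The inverse of the product weight is the tensor product of the inverse weights, hence
  -- square-integrable.
  · have h := (MemLp.tensor fun j => (hwL j).ofReal (K := ℂ)).norm
    refine h.ae_eq (Filter.Eventually.of_forall fun x => ?_)
    simp only [norm_prod, RCLike.norm_ofReal]
    rw [← Finset.prod_inv_distrib]
    exact Finset.prod_congr rfl fun j _ => abs_of_nonneg (inv_nonneg.2 (hw0 j _).le)
  -- Factor 0 supplies the absolute continuity; it exists because the number of factors is positive.
  · exact exists_product_estimate hV
      (fun j => (R j).symbol_nonneg fun u v => re_inner_closureGraph_nonneg _ (R j)) 0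
      (fun N hN hN0 => measure_symbol_preimage_eq_zero (R 0) (hwm 0) (hw 0) (hest 0) hN hN0)
      hwm hw (fun j => ((ht j).trans (hs' j)).le) hest hK
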